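/- **Short-term coupling.** Let $p\in(0,1)$ and let $(\beta,h)$ be in the metastable regime: $\beta>1/p$ and $0<h<p\,\chi(\beta p)$, where $$\chi(\lambda)=\sqrt{1-\tfrac1\lambda}-\tfrac1{2\lambda}\log\Big[\lambda\Big(1+\sqrt{1-\tfrac1\lambda}\Big)^2\Big].$$ Let $G=(V,E)$ be the Erdős–Rényi random graph $\mathrm{ER}_n(p)$ on $n$ vertices, with law $\mathbb P_{\mathrm{ER}_n(p)}$. On $S_n=\{-1,+1\}^V$ put $H_n(\sigma)=-\frac1n\sum_{\{v,w\}\in E}\sigma(v)\sigma(w)-h\sum_{v\in V}\sigma(v)$. Given $G$, let $(\xi_t)_{t\ge0}$ be the continuous-time Markov process on $S_n$ that jumps from $\sigma$ to $\sigma'$ at rate $e^{-\beta[H_n(\sigma')-H_n(\sigma)]_+}$ if $\sigma,\sigma'$ differ at exactly one vertex and at rate $0$ otherwise. Put $\Gamma_n=\{-1,-1+\frac2n,\dots,1\}$, $I_n(a)=-\frac1n\log\binom{n}{(1+a)n/2}$ (extended to real $a$ by Gamma functions), $J_n(a)=2\beta(pa+h)-2I_n'(a)$, $\mathbf m_n=\min\{a\in\Gamma_n: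 J_n(a)\le0\}$, $\mathbf M_n=\frac n2(\mathbf m_n+1)$, and let $A_{\mathbf M_n}$ be the set of configurations with exactly $\mathbf M_n$ plus spins. Let $J(a)=2\beta(pa+h)+\log\frac{1-a}{1+a}$. Then $J$ has a smallest zero $\mathbf m$ in $(-1,1)$; it lies in $(-1,0)$, $J>0$ on $(-1,\mathbf m)$, $\mathbf m_n\to\mathbf m$, and $$\beta p<\frac1{1-\mathbf m^2}.$$ Moreover there are constants $\kappa,C>0$ depending only on $p,\beta,h$ such that, with $\mathbb P_{\mathrm{ER}_n(p)}$-probability tending to $1$ as $n\to\infty$, the following holds: for all initial states $\xi_0,\tilde\xi_0\in A_{\mathbf M_n}$ there is a coupling $(\xi_t,\tilde\xi_t)_{t\ge0}$ of the dynamics started from $\xi_0$ and the dynamics started from $\tilde\xi_0$ such that $$\mathbb P\big[\xi_{2n}\ne\tilde\xi_{2n}\big]\le e^{-n^{2/3}},$$ and such that the disagreement set $W_t=\{v\in V:\xi_t(v)\neq\tilde\xi_t(v)\}$ contracts: $$\mathbb E\,|W_t|\le C e^{-\kappa t}\,|W_0|+e^{-n^{2/3}}\qquad\text{for all }0\le t\le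 2n .$$ -/

import Mathlib

open scoped NNReal Topology

noncomputable section

namespace ERGlauber

/-- Spin configurations: each of the `n` vertices carries a spin `+1` or `-1`. -/
abbrev Config (n : ℕ) : Type := Fin n → ℤˣ

/-- The spin at `v` as a real number. -/
def spin {n : ℕ} (σ : Config n) (v : Fin n) : ℝ := ((σ v : ℤ) : ℝ)

/-- The vertex-volume: the number of `+1` spins. -/
def volume {n : ℕ} (σ : Config n) : ℕ := (Finset.univ.filter fun v => σ v = 1).card

/-- The set of vertices at which two configurations disagree. -/
def disagreement {n : ℕ} (σ σ' : Config n) : Finset (Fin n) :=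
  Finset.univ.filter fun v => σ v ≠ σ' v

open Classical in
/-- The Hamiltonian: interaction `1/n` along every (unordered) edge, external field `h`. -/
def hamiltonian {n : ℕ} (G : SimpleGraph (Fin n)) (h : ℝ) (σ : Config n) : ℝ :=
  -(1 / (n : ℝ)) * ∑ e ∈ G.edgeFinset, (e.map (spin σ)).mul - h * ∑ v, spin σ v

/-- The `ℓ¹`-distance between configurations. -/
def l1dist {n : ℕ} (σ σ' : Config n) : ℝ := ∑ v, |spin σ v - spin σ' v|

open Classical in
/-- The Metropolis jump rates: only single spin flips have positive rate. -/
def rate {n : ℕ} (G : SimpleGraph (Fin n)) (β h : ℝ) (σ σ' : Config n) : ℝ :=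
  if l1dist σ σ' = 2 then
    Real.exp (-β * max (hamiltonian G h σ' - hamiltonian G h σ) 0)
  else 0

/-- The generator (`Q`-matrix) of the dynamics. -/
def generator {n : ℕ} (G : SimpleGraph (Fin n)) (β h : ℝ) :
    Matrix (Config n) (Config n) ℝ :=
  Matrix.of fun σ σ' => if σ = σ' then -∑ η, rate G β h σ η else rate G β h σ σ'

/-- The transition probabilities `e^{tL}`, with `L` the generator. -/
def transition {n : ℕ} (G : SimpleGraph (Fin n)) (β h : ℝ) (t : ℝ) :
    Matrix (Config n) (Config n) ℝ :=
  NormedSpace.exp (t • generator G β h)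

/-- `X` is a version, on the probability space `(Ω, μ)`, of the continuous-time Markov process
with the above rates started from `σ₀`: its finite-dimensional distributions are those given by
the transition probabilities, and its paths are almost surely right-continuous with left limits
(the configuration space being finite and discrete). -/
structure IsDynamics {n : ℕ} (G : SimpleGraph (Fin n)) (β h : ℝ) (σ₀ : Config n)
    {Ω : Type} [MeasurableSpace Ω] (μ : MeasureTheory.Measure Ω)
    (X : ℝ≥0 → Ω → Config n) : Prop where
  measurable : ∀ t σ, MeasurableSet {ω | X t ω = σ}
  fdd : ∀ (k : ℕ) (t : Fin (k + 1) → ℝ≥0) (η : Fin (k + 1) → Config n),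
    Monotone t → t 0 = 0 → η 0 = σ₀ →
      μ.real {ω | ∀ i, X (t i) ω = η i} =
        ∏ i : Fin k, transition G β h ((t i.succ : ℝ) - (t i.castSucc : ℝ))
          (η i.castSucc) (η i.succ)
  right_continuous : ∀ᵐ ω ∂μ, ∀ t : ℝ≥0, ∀ᶠ s in 𝓝[>] t, X s ω = X t ω
  left_limits : ∀ᵐ ω ∂μ, ∀ t : ℝ≥0, ∃ σ : Config n, ∀ᶠ s in 𝓝[<] t, X s ω = σ

/-- A coupling of the dynamics started from `σ` with the dynamics started from `σ'`:
both processes are defined on one probability space. -/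
structure Coupling {n : ℕ} (G : SimpleGraph (Fin n)) (β h : ℝ) (σ σ' : Config n) where
  Ω : Type
  mΩ : MeasurableSpace Ω
  P : MeasureTheory.Measure Ω
  prob : MeasureTheory.IsProbabilityMeasure P
  X : ℝ≥0 → Ω → Config n
  Y : ℝ≥0 → Ω → Config n
  dynamics_X : IsDynamics G β h σ P X
  dynamics_Y : IsDynamics G β h σ' P Y

/-- The probability that the two coupled copies differ at time `t`. -/
def Coupling.probNe {n : ℕ} {G : SimpleGraph (Fin n)} {β h : ℝ} {σ σ' : Config n}
    (c : Coupling G β h σ σ') (t : ℝ≥0) : ℝ :=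
  letI := c.mΩ
  c.P.real {ω | c.X t ω ≠ c.Y t ω}

/-- The expected number of vertices at which the two coupled copies disagree at time `t`. -/
def Coupling.meanDisagreement {n : ℕ} {G : SimpleGraph (Fin n)} {β h : ℝ} {σ σ' : Config n}
    (c : Coupling G β h σ σ') (t : ℝ≥0) : ℝ :=
  letI := c.mΩ
  ∫ ω, ((disagreement (c.X t ω) (c.Y t ω)).card : ℝ) ∂c.P

/-- The threshold function of the metastable regime. -/
def chi (l : ℝ) : ℝ :=
  √(1 - 1 / l) - 1 / (2 * l) * Real.log (l * (1 + √(1 - 1 / l)) ^ 2)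

/-- The parameters `β, h` are in the metastable regime for edge probability `p`. -/
def Metastable (p β h : ℝ) : Prop := 1 / p < β ∧ 0 < h ∧ h < p * chi (β * p)

/-- The magnetizations `-1, -1 + 2/n, …, 1`. -/
def magGrid (n : ℕ) : Set ℝ := {a | ∃ k : ℕ, k ≤ n ∧ a = -1 + 2 * (k : ℝ) / n}

/-- `I_n(a) = -(1/n) log (n choose (1+a)n/2)`, the binomial coefficient being written with Gamma
functions so that `a` is a real variable in which `I_n` can be differentiated. -/
def In (n : ℕ) (a : ℝ) : ℝ :=
  -(1 / (n : ℝ)) * Real.log (Real.Gamma (n + 1) /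
    (Real.Gamma ((1 + a) / 2 * n + 1) * Real.Gamma ((1 - a) / 2 * n + 1)))

/-- `J_n(a) = 2β(pa + h) - 2 I_n'(a)`. -/
def Jn (p β h : ℝ) (n : ℕ) (a : ℝ) : ℝ := 2 * β * (p * a + h) - 2 * deriv (In n) a

/-- The limit `J(a) = 2β(pa + h) + log ((1-a)/(1+a))` of `J_n`, for `-1 < a < 1`. -/
def J (p β h a : ℝ) : ℝ := 2 * β * (p * a + h) + Real.log ((1 - a) / (1 + a))

/-- The metastable magnetization `m_n = min {a ∈ Γ_n : J_n(a) ≤ 0}` (a minimum over a finite set,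
nonempty for all large `n`). -/
def mn (p β h : ℝ) (n : ℕ) : ℝ := sInf {a | a ∈ magGrid n ∧ Jn p β h n a ≤ 0}

/-- The metastable volume `M_n = (n/2)(m_n + 1)`. -/
def Mn (p β h : ℝ) (n : ℕ) : ℝ := n / 2 * (mn p β h n + 1)

/-- The metastable set: the configurations of volume `M_n`. -/
def metastableSet (p β h : ℝ) (n : ℕ) : Set (Config n) := {σ | (volume σ : ℝ) = Mn p β h n}

end ERGlauber

end

/-!
On a typical realization of the Erdős–Rényi graph the degrees, and the cut norm of the adjacency
matrix against every configuration, are within `δ n` and `δ n²` of those of the constant graph `p`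
(Hoeffding's inequality for each of the `4ⁿ` pairs of sign patterns). On such a graph the
magnetization is an almost autonomous process: its drift, up to `O(δ)`, is the mean drift, which
has the sign of `J` and thus points towards the first zero `m`. Exponential moments of
`n |mag - m|` then show that the magnetization, started at `m_n → m`, stays close to `m` for a time
of order `n`, outside an event of probability `e^{-cn}`. Knowing the magnetization, the deviations
of the normalized sums of the spins over the neighbourhoods are forgotten exponentially fast, so
after a burn-in time all local fields are close to `p m + h < 0`.

Couple two copies so that they flip together at the largest possible rate wherever they agree. A
disagreement disappears at rate `1 + R`, where `R = e^{2β(pm+h)} = (1+m)/(1-m)` is the rate at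
which a minus spin flips, and creates others, among its nearly `(1-m)pn/2` neighbouring minus
spins, at total rate at most `2βR(1-m)p`. The balance is `(2/(1-m)) (βp(1-m²) - 1) < 0`, so the
expected number of disagreements decays exponentially. The burn-in only costs a constant factor,
and the exceptional event costs `C n^7 e^{-cn} ≤ e^{-n^{2/3}}`.
-/

noncomputable section

namespace FiniteMarkov

/-! ### Generators of finite Markov processes -/

section MatrixExponential

open NormedSpace Matrix

variable {S R : Type*} [Fintype S] [DecidableEq S] [Fintype R] [DecidableEq R]

lemma hasSum_exp (A : Matrix S S ℝ) :
    HasSum (fun k : ℕ => (k.factorial : ℝ)⁻¹ • A ^ k) (exp A) := by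
  let _ : NormedRing (Matrix S S ℝ) := Matrix.linftyOpNormedRing
  let _ : NormedAlgebra ℝ (Matrix S S ℝ) := Matrix.linftyOpNormedAlgebra
  exact exp_series_hasSum_exp' (𝕂 := ℝ) A

lemma hasDerivAt_exp_smul_apply (Q : Matrix S S ℝ) (t : ℝ) (i j : S) :
    HasDerivAt (fun u : ℝ => exp (u • Q) i j) ((exp (t • Q) * Q) i j) t := by
  let _ : NormedRing (Matrix S S ℝ) := Matrix.linftyOpNormedRing
  let _ : NormedAlgebra ℝ (Matrix S S ℝ) := Matrix.linftyOpNormedAlgebra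
  exact hasDerivAt_pi.1 (hasDerivAt_pi.1 (hasDerivAt_exp_smul_const (𝕂 := ℝ) Q t) i) j

lemma hasDerivAt_exp_smul_mulVec (Q : Matrix S S ℝ) {f f' : ℝ → S → ℝ} {t : ℝ}
    (hf : ∀ y, HasDerivAt (fun u => f u y) (f' t y) t) (z : S) :
    HasDerivAt (fun u => (exp (u • Q) *ᵥ f u) z) ((exp (t • Q) *ᵥ (Q *ᵥ f t + f' t)) z) t := by
  have product_rule : HasDerivAt (fun u => ∑ y, exp (u • Q) z y * f u y)
      (∑ y, ((exp (t • Q) * Q) z y * f t y + exp (t • Q) z y * f' t y)) t :=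
    HasDerivAt.fun_sum fun y _ => (hasDerivAt_exp_smul_apply Q t z y).mul (hf y)
  rw [Finset.sum_add_distrib] at product_rule
  rw [mulVec_add, mulVec_mulVec]
  exact product_rule

lemma exp_apply_nonneg {A : Matrix S S ℝ} (hA : ∀ i j, 0 ≤ A i j) (i j : S) : 0 ≤ exp A i j :=
  (Pi.hasSum.1 (Pi.hasSum.1 (hasSum_exp A) i) j).nonneg fun k =>
    mul_nonneg (by positivity) (pow_apply_nonneg hA k i j)

lemma exp_mul_of_intertwines {A : Matrix S S ℝ} {B : Matrix R R ℝ} {M : Matrix S R ℝ}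
    (h : A * M = M * B) : exp A * M = M * exp B := by
  have pow_intertwines (k : ℕ) : A ^ k * M = M * B ^ k := by
    induction k with
    | zero => simp only [pow_zero, Matrix.one_mul, Matrix.mul_one]
    | succ k ih => rw [pow_succ, pow_succ, Matrix.mul_assoc, h, ← Matrix.mul_assoc, ih,
        Matrix.mul_assoc]
  have left := (hasSum_exp A).map (addMonoidHomMulRight M)
    (continuous_id.matrix_mul continuous_const)
  have right := (hasSum_exp B).map (addMonoidHomMulLeft M)
    (continuous_const.matrix_mul continuous_id)
  refine left.unique (right.congr_fun fun k => ?_)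
  simp [addMonoidHomMulRight, addMonoidHomMulLeft, pow_intertwines]

lemma exp_mulVec_comp {Q : Matrix S S ℝ} {Q' : Matrix R R ℝ} {π : S → R}
    (h : ∀ f : R → ℝ, Q *ᵥ (f ∘ π) = (Q' *ᵥ f) ∘ π) (t : ℝ) (f : R → ℝ) :
    exp (t • Q) *ᵥ (f ∘ π) = (exp (t • Q') *ᵥ f) ∘ π := by
  let M : Matrix S R ℝ := (1 : Matrix R R ℝ).submatrix π id
  have mulVec_M (g : R → ℝ) : M *ᵥ g = g ∘ π := by
    funext z
    simp [M, mulVec, dotProduct, one_apply]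
  have hM : (t • Q) * M = M * (t • Q') := by
    refine Matrix.ext_iff_mulVec.2 fun g => ?_
    rw [← mulVec_mulVec, ← mulVec_mulVec, mulVec_M, mulVec_M, smul_mulVec, smul_mulVec, h]
    rfl
  rw [← mulVec_M, ← mulVec_M, mulVec_mulVec, mulVec_mulVec, exp_mul_of_intertwines hM]

/-- The left side of `hB` is the derivative of `t ↦ (e^{tQ} f_t) z`. -/
lemma exp_mulVec_le_add_mul {Q : Matrix S S ℝ} {f f' : ℝ → S → ℝ} {t₀ t₁ B : ℝ} (h01 : t₀ ≤ t₁)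
    (hf : ∀ t ∈ Set.Icc t₀ t₁, ∀ y, HasDerivAt (fun u => f u y) (f' t y) t) (z : S)
    (hB : ∀ t ∈ Set.Icc t₀ t₁, (exp (t • Q) *ᵥ (Q *ᵥ f t + f' t)) z ≤ B) :
    (exp (t₁ • Q) *ᵥ f t₁) z ≤ (exp (t₀ • Q) *ᵥ f t₀) z + B * (t₁ - t₀) := by
  have hd (t) (ht : t ∈ Set.Icc t₀ t₁) := hasDerivAt_exp_smul_mulVec Q (hf t ht) z
  have mean_value := (convex_Icc t₀ t₁).image_sub_le_mul_sub_of_deriv_le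
    (fun t ht => (hd t ht).continuousAt.continuousWithinAt)
    (fun t ht => (hd t (interior_subset ht)).differentiableAt.differentiableWithinAt)
    (fun t ht => (hd t (interior_subset ht)).deriv.trans_le (hB t (interior_subset ht)))
    t₀ (Set.left_mem_Icc.2 h01) t₁ (Set.right_mem_Icc.2 h01) h01
  linarith

lemma exp_smul_smul_sub_one (P : Matrix S S ℝ) (c t : ℝ) :
    exp (t • (c • (P - 1))) = Real.exp (-(c * t)) • exp ((c * t) • P) := by
  have decomposition :
      t • (c • (P - 1)) = (c * t) • P + algebraMap ℝ (Matrix S S ℝ) (-(c * t)) := by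
    rw [Algebra.algebraMap_eq_smul_one, smul_smul, smul_sub, mul_comm t c, neg_smul, sub_eq_add_neg]
  have exp_scalar :
      exp (algebraMap ℝ (Matrix S S ℝ) (-(c * t))) = algebraMap ℝ _ (Real.exp (-(c * t))) := by
    let _ : NormedRing (Matrix S S ℝ) := Matrix.linftyOpNormedRing
    let _ : NormedAlgebra ℝ (Matrix S S ℝ) := Matrix.linftyOpNormedAlgebra
    rw [Real.exp_eq_exp_ℝ]
    exact (algebraMap_exp_comm (𝕂 := ℝ) _).symm
  rw [decomposition, Matrix.exp_add_of_commute _ _ (Algebra.commute_algebraMap_right _ _),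
    exp_scalar, Algebra.algebraMap_eq_smul_one, mul_smul_comm, mul_one]

end MatrixExponential

section QMatrix

open NormedSpace Matrix

variable {S : Type*} [Fintype S] [DecidableEq S]

/-- A `Q`-matrix, that is, the generator of a continuous-time Markov chain on a finite state
space: nonnegative off the diagonal, with rows summing to zero. -/
structure IsQMatrix (Q : Matrix S S ℝ) : Prop where
  offDiag_nonneg : ∀ i j, i ≠ j → 0 ≤ Q i j
  row_sum : ∀ i, ∑ j, Q i j = 0

namespace IsQMatrix

variable {Q : Matrix S S ℝ}

lemma exists_eq_smul_rowStochastic_sub_one (hQ : IsQMatrix Q) :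
    ∃ c : ℝ, 0 < c ∧ ∃ P ∈ rowStochastic ℝ S, Q = c • (P - 1) := by
  let c : ℝ := 1 + ∑ k, |Q k k|
  have hc : 0 < c := by positivity
  have neg_diag_le (i : S) : -Q i i ≤ c := by
    have : |Q i i| ≤ ∑ k, |Q k k| :=
      Finset.single_le_sum (f := fun k => |Q k k|) (fun _ _ => abs_nonneg _) (Finset.mem_univ i)
    linarith [neg_le_abs (Q i i)]
  refine ⟨c, hc, 1 + c⁻¹ • Q, mem_rowStochastic_iff_sum.2 ⟨fun i j => ?_, fun i => ?_⟩, ?_⟩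
  · rw [Matrix.add_apply, Matrix.smul_apply, smul_eq_mul, inv_mul_eq_div]
    rcases eq_or_ne i j with rfl | hij
    · rw [one_apply_eq, ← neg_le_iff_add_nonneg', le_div_iff₀ hc]
      linarith [neg_diag_le i]
    · rw [one_apply_ne hij, zero_add]
      exact div_nonneg (hQ.offDiag_nonneg i j hij) hc.le
  · simp [Finset.sum_add_distrib, ← Finset.mul_sum, hQ.row_sum i, one_apply]
  · rw [add_sub_cancel_left, smul_smul, mul_inv_cancel₀ hc.ne', one_smul]

lemma exp_apply_nonneg (hQ : IsQMatrix Q) {t : ℝ} (ht : 0 ≤ t) (i j : S) :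
    0 ≤ exp (t • Q) i j := by
  obtain ⟨c, hc, P, hP, rfl⟩ := hQ.exists_eq_smul_rowStochastic_sub_one
  rw [exp_smul_smul_sub_one, Matrix.smul_apply, smul_eq_mul]
  exact mul_nonneg (Real.exp_pos _).le (FiniteMarkov.exp_apply_nonneg
    (fun i j => mul_nonneg (by positivity) (hP.1 i j)) i j)

lemma exp_mulVec_mono (hQ : IsQMatrix Q) {t : ℝ} (ht : 0 ≤ t) {f g : S → ℝ} (hfg : f ≤ g) (z : S) :
    (exp (t • Q) *ᵥ f) z ≤ (exp (t • Q) *ᵥ g) z :=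
  Finset.sum_le_sum fun y _ => mul_le_mul_of_nonneg_left (hfg y) (hQ.exp_apply_nonneg ht z y)

lemma exp_mulVec_const (hQ : IsQMatrix Q) (t a : ℝ) :
    (exp (t • Q) *ᵥ fun _ => a) = fun _ => a := by
  have := exp_mulVec_comp (Q := Q) (Q' := (0 : Matrix Unit Unit ℝ)) (π := fun _ => ())
    (fun f => funext fun z => by
      simp [mulVec, dotProduct, ← Finset.sum_mul, hQ.row_sum]) t (fun _ => a)
  rw [smul_zero, NormedSpace.exp_zero, one_mulVec] at this
  exact this

end IsQMatrix

end QMatrix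

section Moves

open Matrix

variable {S I : Type*} [Fintype S]

lemma IsQMatrix.add {Q Q' : Matrix S S ℝ} (hQ : IsQMatrix Q) (hQ' : IsQMatrix Q') :
    IsQMatrix (Q + Q') where
  offDiag_nonneg i j hij := add_nonneg (hQ.offDiag_nonneg i j hij) (hQ'.offDiag_nonneg i j hij)
  row_sum i := by
    simp only [Matrix.add_apply, Finset.sum_add_distrib, hQ.row_sum, hQ'.row_sum, add_zero]

/-- The `Q`-matrix of the process that, from the state `z`, makes the move `m i` at rate `a i z`. -/
def moveGen {S I : Type*} [DecidableEq S] [Fintype I] (a : I → S → ℝ) (m : I → S → S) :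
    Matrix S S ℝ :=
  of fun z y => ∑ i, a i z * ((if m i z = y then 1 else 0) - if z = y then 1 else 0)

variable [DecidableEq S] [Fintype I] {a : I → S → ℝ} {m : I → S → S}

lemma moveGen_mulVec (f : S → ℝ) (z : S) :
    (moveGen a m *ᵥ f) z = ∑ i, a i z * (f (m i z) - f z) := by
  simp only [moveGen, mulVec, dotProduct, of_apply, Finset.sum_mul]
  rw [Finset.sum_comm]
  refine Finset.sum_congr rfl fun i _ => ?_
  simp only [mul_assoc, sub_mul, ite_mul, one_mul, zero_mul, ← Finset.mul_sum,
    Finset.sum_sub_distrib, Finset.sum_ite_eq, Finset.mem_univ, if_true]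

lemma isQMatrix_moveGen (ha : ∀ i z, 0 ≤ a i z) : IsQMatrix (moveGen a m) where
  offDiag_nonneg z y hzy := by
    simp only [moveGen, of_apply, hzy, if_false, sub_zero]
    exact Finset.sum_nonneg fun i _ => mul_nonneg (ha i z) (by split_ifs <;> norm_num)
  row_sum z := by
    simpa [mulVec, dotProduct] using moveGen_mulVec (a := a) (m := m) (fun _ => 1) z

end Moves

section Drift

open Matrix NormedSpace

variable {S : Type*} [Fintype S] {Q : Matrix S S ℝ}

lemma IsQMatrix.mulVec_const (hQ : IsQMatrix Q) (a : ℝ) : (Q *ᵥ fun _ => a) = 0 := by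
  funext z
  simp only [mulVec, dotProduct, ← Finset.sum_mul, hQ.row_sum, zero_mul, Pi.zero_apply]

lemma IsQMatrix.mulVec_le_mulVec_of_le_of_eq (hQ : IsQMatrix Q) {f g : S → ℝ} (hfg : f ≤ g) {z : S}
    (hz : f z = g z) : (Q *ᵥ f) z ≤ (Q *ᵥ g) z := by
  refine Finset.sum_le_sum fun y _ => ?_
  rcases eq_or_ne z y with rfl | hzy
  · rw [hz]
  · exact mul_le_mul_of_nonneg_left (hfg y) (hQ.offDiag_nonneg z y hzy)

variable [DecidableEq S]

lemma exp_mulVec_le_exp_mul_add {f : S → ℝ} {κ t₀ t₁ B : ℝ} (h01 : t₀ ≤ t₁) (z : S)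
    (hB : ∀ s ∈ Set.Icc t₀ t₁,
      Real.exp (κ * (s - t₁)) * (exp (s • Q) *ᵥ (Q *ᵥ f + κ • f)) z ≤ B) :
    (exp (t₁ • Q) *ᵥ f) z ≤
      Real.exp (-κ * (t₁ - t₀)) * (exp (t₀ • Q) *ᵥ f) z + B * (t₁ - t₀) := by
  have weight_deriv (s : ℝ) : HasDerivAt (fun s => Real.exp (κ * (s - t₁)))
      (Real.exp (κ * (s - t₁)) * κ) s := by
    simpa using (((hasDerivAt_id s).sub_const t₁).const_mul κ).exp
  have := exp_mulVec_le_add_mul (Q := Q) (f := fun s => Real.exp (κ * (s - t₁)) • f)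
    (f' := fun s => (Real.exp (κ * (s - t₁)) * κ) • f) h01
    (fun s _ y => (weight_deriv s).mul_const (f y)) z
    (fun s hs => by
      rw [mulVec_smul, mul_smul, ← smul_add, mulVec_smul]
      exact hB s hs)
  simp only [mulVec_smul, Pi.smul_apply, smul_eq_mul, sub_self, mul_zero, Real.exp_zero,
    one_mul] at this
  rwa [neg_mul, ← mul_neg, neg_sub]

namespace IsQMatrix

lemma exp_mulVec_le_of_forall_le (hQ : IsQMatrix Q) {f : S → ℝ} {B t : ℝ} (ht : 0 ≤ t)
    (hf : ∀ y, f y ≤ B) (z : S) : (exp (t • Q) *ᵥ f) z ≤ B :=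
  (hQ.exp_mulVec_mono ht (g := fun _ => B) hf z).trans_eq (congrFun (hQ.exp_mulVec_const t B) z)

lemma exp_mulVec_le_add (hQ : IsQMatrix Q) {f : S → ℝ} {B t : ℝ} (ht : 0 ≤ t)
    (hf : ∀ y, (Q *ᵥ f) y ≤ B) (z : S) : (exp (t • Q) *ᵥ f) z ≤ f z + B * t := by
  simpa using exp_mulVec_le_exp_mul_add (Q := Q) (f := f) (κ := 0) ht z fun s hs => by
    simpa using hQ.exp_mulVec_le_of_forall_le hs.1 hf z

lemma exp_mulVec_le_exp_mul (hQ : IsQMatrix Q) {f : S → ℝ} {L t : ℝ} (ht : 0 ≤ t)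
    (hf : ∀ y, (Q *ᵥ f) y ≤ L * f y) (z : S) :
    (exp (t • Q) *ᵥ f) z ≤ Real.exp (L * t) * f z := by
  simpa using exp_mulVec_le_exp_mul_add (Q := Q) (f := f) (κ := -L) ht z fun s hs =>
    mul_nonpos_of_nonneg_of_nonpos (Real.exp_pos _).le
      (hQ.exp_mulVec_le_of_forall_le hs.1 (fun y => by simpa using hf y) z)

lemma exp_mulVec_indicator_le_exp_neg_mul (hQ : IsQMatrix Q) {A : Set S} {V : S → ℝ} {a t : ℝ}
    (ht : 0 ≤ t) (hV : ∀ y ∈ A, a ≤ V y) (z : S) :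
    (exp (t • Q) *ᵥ A.indicator 1) z ≤
      Real.exp (-a) * (exp (t • Q) *ᵥ fun y => Real.exp (V y)) z := by
  rw [← smul_eq_mul, ← Pi.smul_apply, ← mulVec_smul]
  refine hQ.exp_mulVec_mono ht (Set.indicator_le' (fun y hy => ?_) fun y _ => ?_) z <;>
    rw [Pi.smul_apply, smul_eq_mul, ← Real.exp_add]
  · exact Real.one_le_exp (by linarith [hV y hy])
  · exact (Real.exp_pos _).le

lemma exp_mulVec_indicator_iUnion_le (hQ : IsQMatrix Q) {ι : Type*} [Fintype ι] (A : ι → Set S)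
    {t : ℝ} (ht : 0 ≤ t) (z : S) :
    (exp (t • Q) *ᵥ (⋃ i, A i).indicator 1) z ≤ ∑ i, (exp (t • Q) *ᵥ (A i).indicator 1) z := by
  rw [← Finset.sum_apply, ← mulVec_sum]
  have summand_nonneg (i : ι) (y : S) : 0 ≤ (A i).indicator (1 : S → ℝ) y :=
    Set.indicator_nonneg (fun _ _ => zero_le_one) y
  refine hQ.exp_mulVec_mono ht (Set.indicator_le' (fun y hy => ?_) fun y _ => ?_) z <;>
    rw [Finset.sum_apply]
  · obtain ⟨i, hi⟩ := Set.mem_iUnion.1 hy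
    calc (1 : ℝ) = (A i).indicator 1 y := (Set.indicator_of_mem hi (1 : S → ℝ)).symm
      _ ≤ _ := Finset.single_le_sum (fun j _ => summand_nonneg j y) (Finset.mem_univ i)
  · exact Finset.sum_nonneg fun i _ => summand_nonneg i y

lemma exp_mulVec_indicator_abs_le (hQ : IsQMatrix Q) {X : S → ℝ} {a B t : ℝ} (ht : 0 ≤ t) {z : S}
    (hB : ∀ e : ℝ, |e| = 1 → (exp (t • Q) *ᵥ {y | a ≤ e * X y}.indicator 1) z ≤ B) :
    (exp (t • Q) *ᵥ {y | a ≤ |X y|}.indicator 1) z ≤ 2 * B := by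
  have two_sided : {y | a ≤ |X y|} = ⋃ b : Bool, {y | a ≤ (bif b then 1 else -1) * X y} := by
    ext y
    simp [Set.mem_iUnion, le_abs, or_comm]
  rw [two_sided]
  refine (hQ.exp_mulVec_indicator_iUnion_le _ ht z).trans ?_
  rw [Fintype.sum_bool, two_mul]
  exact add_le_add (hB _ (by simp)) (hB _ (by simp))

/-- The tilt of an exponential moment may grow at the rate at which `U` reverts to its mean: then
the growth of the tilt compensates the drift of `U` off the exceptional set `A`. -/
lemma exp_mulVec_exp_mul_le (hQ : IsQMatrix Q) {U : S → ℝ} {A : Set S} {a θ₀ K η t₁ : ℝ} {z : S}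
    (hθ₀ : 0 ≤ θ₀) (ha : 0 ≤ a) (hK : 0 ≤ K) (ht₁ : 0 ≤ t₁)
    (hgood : ∀ θ ∈ Set.Icc 0 θ₀, ∀ y ∉ A,
      (Q *ᵥ fun y => Real.exp (θ * U y)) y + a * θ * U y * Real.exp (θ * U y) ≤ 0)
    (hbad : ∀ θ ∈ Set.Icc 0 θ₀, ∀ y ∈ A,
      (Q *ᵥ fun y => Real.exp (θ * U y)) y + a * θ * U y * Real.exp (θ * U y) ≤ K)
    (hη : ∀ t ∈ Set.Icc 0 t₁, (exp (t • Q) *ᵥ A.indicator 1) z ≤ η) :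
    (exp (t₁ • Q) *ᵥ fun y => Real.exp (θ₀ * U y)) z ≤
      Real.exp (θ₀ * Real.exp (-(a * t₁)) * U z) + K * η * t₁ := by
  let θ : ℝ → ℝ := fun t => θ₀ * Real.exp (a * (t - t₁))
  have θ_mem (t : ℝ) (ht : t ≤ t₁) : θ t ∈ Set.Icc 0 θ₀ :=
    ⟨by positivity, mul_le_of_le_one_right hθ₀ (Real.exp_le_one_iff.2
      (mul_nonpos_of_nonneg_of_nonpos ha (sub_nonpos.2 ht)))⟩
  have θ_deriv (t : ℝ) : HasDerivAt θ (a * θ t) t :=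
    ((((hasDerivAt_id t).sub_const t₁).const_mul a).exp.const_mul θ₀).congr_deriv (by
      simp only [θ, id_eq]; ring)
  have drift_le (t : ℝ) (ht : t ≤ t₁) : ((Q *ᵥ fun y => Real.exp (θ t * U y)) +
      fun y => Real.exp (θ t * U y) * (a * θ t * U y)) ≤ K • A.indicator 1 := by
    intro y
    rw [Pi.add_apply, Pi.smul_apply, smul_eq_mul, mul_comm (Real.exp _)]
    by_cases hy : y ∈ A
    · rw [Set.indicator_of_mem hy, Pi.one_apply, mul_one]
      exact hbad _ (θ_mem t ht) y hy
    · rw [Set.indicator_of_notMem hy, mul_zero]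
      exact hgood _ (θ_mem t ht) y hy
  have := exp_mulVec_le_add_mul (Q := Q) (f := fun t y => Real.exp (θ t * U y))
    (f' := fun t y => Real.exp (θ t * U y) * (a * θ t * U y)) (B := K * η) ht₁
    (fun t _ y => ((θ_deriv t).mul_const (U y)).exp) z
    (fun t ht => by
      refine (hQ.exp_mulVec_mono ht.1 (drift_le t ht.2) z).trans ?_
      rw [mulVec_smul, Pi.smul_apply, smul_eq_mul]
      exact mul_le_mul_of_nonneg_left (hη t ht) hK)
  simpa only [θ, sub_self, mul_zero, Real.exp_zero, mul_one, zero_smul, exp_zero, one_mulVec,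
    sub_zero, zero_sub, mul_neg] using this

end IsQMatrix

end Drift

/-! ### Construction of Markov processes from exponential clocks -/

open MeasureTheory ProbabilityTheory

section ExponentialLaw

lemma measurable_exponentialPDF (c : ℝ) : Measurable (exponentialPDF c) :=
  (measurable_exponentialPDFReal c).ennreal_ofReal

lemma expMeasure_eq_withDensity (c : ℝ) :
    expMeasure c = volume.withDensity (exponentialPDF c) := rfl

lemma lintegral_expMeasure (c : ℝ) {g : ℝ → ENNReal} (hg : Measurable g) :
    ∫⁻ a, g a ∂expMeasure c =
      ∫⁻ a in Set.Ioi 0, ENNReal.ofReal (c * Real.exp (-(c * a))) * g a := by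
  rw [expMeasure_eq_withDensity,
    lintegral_withDensity_eq_lintegral_mul _ (measurable_exponentialPDF c) hg,
    ← setLIntegral_eq_of_support_subset (s := Set.Ici 0), restrict_Ioi_eq_restrict_Ici]
  · refine setLIntegral_congr_fun measurableSet_Ici fun a ha => ?_
    exact congrArg (· * g a) (exponentialPDF_of_nonneg ha)
  · intro a ha
    by_contra hneg
    exact ha (by simp [exponentialPDF_of_neg (not_le.1 hneg)])

lemma expMeasure_ae_pos (c : ℝ) : ∀ᵐ a ∂expMeasure c, 0 < a := by
  rw [expMeasure_eq_withDensity, ae_withDensity_iff (measurable_exponentialPDF c)]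
  filter_upwards [Measure.ae_ne volume 0] with a ha hpdf
  exact lt_of_le_of_ne (not_lt.1 fun hneg => hpdf (exponentialPDF_of_neg hneg)) ha.symm

lemma lintegral_expMeasure_eq_add (c : ℝ) {t : ℝ} (ht : 0 ≤ t) {g : ℝ → ENNReal}
    (hg : Measurable g) :
    ∫⁻ a, g a ∂expMeasure c =
      (∫⁻ a in Set.Ioc 0 t, ENNReal.ofReal (c * Real.exp (-(c * a))) * g a) +
        ENNReal.ofReal (Real.exp (-(c * t))) * ∫⁻ a, g (a + t) ∂expMeasure c := by
  have translate : ∫⁻ a in Set.Ioi t, ENNReal.ofReal (c * Real.exp (-(c * a))) * g a =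
      ∫⁻ a in Set.Ioi 0, ENNReal.ofReal (c * Real.exp (-(c * (a + t)))) * g (a + t) := by
    rw [← (measurePreserving_add_right volume t).setLIntegral_comp_preimage_emb
      (measurableEmbedding_addRight t)]
    simp
  have memoryless (a : ℝ) : ENNReal.ofReal (c * Real.exp (-(c * (a + t)))) * g (a + t) =
      ENNReal.ofReal (Real.exp (-(c * t))) *
        (ENNReal.ofReal (c * Real.exp (-(c * a))) * g (a + t)) := by
    rw [← mul_assoc, ← ENNReal.ofReal_mul (Real.exp_pos _).le, mul_left_comm, ← Real.exp_add]
    ring_nf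
  rw [lintegral_expMeasure c hg, ← Set.Ioc_union_Ioi_eq_Ioi ht,
    lintegral_union measurableSet_Ioi (Set.Ioc_disjoint_Ioi le_rfl), translate,
    lintegral_expMeasure c (g := fun a => g (a + t)) (hg.comp (measurable_add_const t))]
  simp only [memoryless, lintegral_const_mul' _ _ ENNReal.ofReal_ne_top]

lemma expMeasure_Iic_lt_one {c : ℝ} (hc : 0 < c) (t : ℝ) : expMeasure c (Set.Iic t) < 1 := by
  have := isProbabilityMeasure_expMeasure hc
  rw [← ofReal_cdf, ENNReal.ofReal_lt_one, cdf_expMeasure_eq hc]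
  split_ifs
  · linarith [Real.exp_pos (-(c * t))]
  · exact one_pos

end ExponentialLaw

section Prepend

variable {E : Type*}

/-- The sequence `a, ω 0, ω 1, …`. -/
def prepend (a : E) (ω : ℕ → E) : ℕ → E
  | 0 => a
  | i + 1 => ω i

lemma prepend_preimage_pi_range (B : ℕ → Set E) (N : ℕ) :
    (fun q : E × (ℕ → E) => prepend q.1 q.2) ⁻¹' Set.pi (Finset.range (N + 1)) B =
      B 0 ×ˢ Set.pi (Finset.range N) fun i => B (i + 1) := by
  ext ⟨a, ω⟩
  simp only [Set.mem_preimage, Set.mem_pi, Set.mem_prod, Finset.mem_coe, Finset.mem_range]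
  refine ⟨fun h => ⟨h 0 N.succ_pos, fun i hi => h (i + 1) (by omega)⟩, fun h i hi => ?_⟩
  cases i with
  | zero => exact h.1
  | succ i => exact h.2 i (by omega)

variable [MeasurableSpace E]

lemma measurable_prepend : Measurable fun q : E × (ℕ → E) => prepend q.1 q.2 := by
  refine measurable_pi_lambda _ fun i => ?_
  cases i with
  | zero => exact measurable_fst
  | succ i => exact (measurable_pi_apply i).comp measurable_snd

lemma map_prepend_infinitePi (ν : Measure E) [IsProbabilityMeasure ν] :
    (ν.prod (Measure.infinitePi fun _ : ℕ => ν)).map (fun q => prepend q.1 q.2) =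
      Measure.infinitePi fun _ : ℕ => ν := by
  classical
  refine Measure.eq_infinitePi _ fun s B hB => ?_
  obtain ⟨N, hN⟩ : ∃ N, s ⊆ Finset.range (N + 1) :=
    ⟨s.sup id, fun i hi => Finset.mem_range_succ_iff.2 (Finset.le_sup (f := id) hi)⟩
  let B' : ℕ → Set E := fun i => if i ∈ s then B i else Set.univ
  have hB' (i : ℕ) : MeasurableSet (B' i) := by
    unfold B'
    split_ifs
    exacts [hB i, .univ]
  have box_eq : Set.pi s B = Set.pi (Finset.range (N + 1)) B' := by
    ext ω
    refine ⟨fun h i _ => ?_, fun h i hi => by simpa [B', Finset.mem_coe.1 hi] using h i (hN hi)⟩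
    by_cases hi : i ∈ s
    · simpa [B', hi] using h i hi
    · simp [B', hi]
  have box_measurable : MeasurableSet (Set.pi (Finset.range (N + 1)) B') :=
    .pi (Finset.countable_toSet _) fun i _ => hB' i
  rw [box_eq, Measure.map_apply measurable_prepend box_measurable, prepend_preimage_pi_range,
    Measure.prod_prod, Measure.infinitePi_pi _ fun i _ => hB' (i + 1), mul_comm,
    ← Finset.prod_range_succ' (fun i => ν (B' i)) N,
    ← Finset.prod_subset hN fun i _ hi => by simp [B', hi]]
  exact Finset.prod_congr rfl fun i hi => by simp [B', hi]

lemma infinitePi_apply_eq_lintegral_prepend (ν : Measure E) [IsProbabilityMeasure ν]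
    {B : Set (ℕ → E)} (hB : MeasurableSet B) :
    (Measure.infinitePi fun _ : ℕ => ν) B =
      ∫⁻ a, (Measure.infinitePi fun _ : ℕ => ν) {ω | prepend a ω ∈ B} ∂ν := by
  conv_lhs => rw [← map_prepend_infinitePi ν]
  rw [Measure.map_apply measurable_prepend hB, Measure.prod_apply (measurable_prepend hB)]
  rfl

end Prepend

section JumpTimes

variable {M : Type*}

/-- The time of the `k`-th jump of a process with waiting times `(ω i).1`. The marks `(ω i).2`
will be the maps applied to the state at the jumps. -/
def arrival (ω : ℕ → ℝ × M) (k : ℕ) : ℝ := ∑ i ∈ Finset.range k, (ω i).1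

/-- The number of jumps up to time `t`, with value `0` if infinitely many occur. -/
def jumpCount (t : ℝ) (ω : ℕ → ℝ × M) : ℕ := sInf {k | t < arrival ω (k + 1)}

/-- Only finitely many jumps occur in finite time. -/
def NonExplosive (ω : ℕ → ℝ × M) : Prop := ∀ t : ℝ, ∃ k, t < arrival ω (k + 1)

lemma arrival_prepend (a : ℝ × M) (ω : ℕ → ℝ × M) (k : ℕ) :
    arrival (prepend a ω) (k + 1) = a.1 + arrival ω k := by
  rw [arrival, Finset.sum_range_succ', add_comm]
  rfl

lemma lt_arrival_jumpCount {t : ℝ} {ω : ℕ → ℝ × M} (h : ∃ k, t < arrival ω (k + 1)) :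
    t < arrival ω (jumpCount t ω + 1) :=
  Nat.sInf_mem (s := {k | t < arrival ω (k + 1)}) h

lemma jumpCount_le {t : ℝ} {ω : ℕ → ℝ × M} {k : ℕ} (h : t < arrival ω (k + 1)) :
    jumpCount t ω ≤ k :=
  Nat.sInf_le (s := {k | t < arrival ω (k + 1)}) h

lemma jumpCount_eq_iff {t : ℝ} {ω : ℕ → ℝ × M} (h : ∃ k, t < arrival ω (k + 1)) (k : ℕ) :
    jumpCount t ω = k ↔ t < arrival ω (k + 1) ∧ ∀ j < k, arrival ω (j + 1) ≤ t := by
  constructor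
  · rintro rfl
    exact ⟨lt_arrival_jumpCount h, fun j hj => le_of_not_gt fun hlt => (jumpCount_le hlt).not_gt hj⟩
  · rintro ⟨hk, hlt⟩
    refine (jumpCount_le hk).antisymm (le_of_not_gt fun hj => ?_)
    exact (hlt _ hj).not_gt (lt_arrival_jumpCount h)

lemma monotone_jumpCount {ω : ℕ → ℝ × M} (hω : NonExplosive ω) :
    Monotone fun t => jumpCount t ω :=
  fun _ t hst => jumpCount_le (hst.trans_lt (lt_arrival_jumpCount (hω t)))

lemma jumpCount_prepend_of_le {a : ℝ × M} {ω : ℕ → ℝ × M} (hω : NonExplosive ω) {t : ℝ}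
    (hat : a.1 ≤ t) : jumpCount t (prepend a ω) = jumpCount (t - a.1) ω + 1 := by
  obtain ⟨hlt, hle⟩ := (jumpCount_eq_iff (hω (t - a.1)) _).1 rfl
  have hlt' : t < arrival (prepend a ω) (jumpCount (t - a.1) ω + 1 + 1) := by
    rw [arrival_prepend]
    linarith
  refine (jumpCount_eq_iff ⟨_, hlt'⟩ _).2 ⟨hlt', fun j hj => ?_⟩
  rw [arrival_prepend]
  cases j with
  | zero => simpa [arrival] using hat
  | succ j => linarith [hle j (by omega)]

lemma jumpCount_add_prepend (a t s : ℝ) (φ : M) (ω : ℕ → ℝ × M) :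
    jumpCount (s + t) (prepend (a + t, φ) ω) = jumpCount s (prepend (a, φ) ω) := by
  simp only [jumpCount, arrival_prepend, add_right_comm a t, add_lt_add_iff_right]

lemma jumpCount_zero {ω : ℕ → ℝ × M} (h : 0 < (ω 0).1) : jumpCount 0 ω = 0 :=
  Nat.le_zero.1 (jumpCount_le (by simpa [arrival] using h))

variable [MeasurableSpace M]

lemma measurable_arrival (k : ℕ) : Measurable fun ω : ℕ → ℝ × M => arrival ω k :=
  Finset.measurable_sum _ fun i _ => measurable_fst.comp (measurable_pi_apply i)

lemma measurable_jumpCount : Measurable fun q : ℝ × (ℕ → ℝ × M) => jumpCount q.1 q.2 := by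
  let A : ℕ → Set (ℝ × (ℕ → ℝ × M)) := fun k => {q | q.1 < arrival q.2 (k + 1)}
  have hA (k : ℕ) : MeasurableSet (A k) :=
    measurableSet_lt measurable_fst ((measurable_arrival (k + 1)).comp measurable_snd)
  refine measurable_of_Iic fun k => ?_
  have preimage_eq : (fun q : ℝ × (ℕ → ℝ × M) => jumpCount q.1 q.2) ⁻¹' Set.Iic k =
      (⋃ j ∈ Set.Iic k, A j) ∪ ⋂ j, (A j)ᶜ := by
    ext q
    simp only [Set.mem_preimage, Set.mem_Iic, Set.mem_union, Set.mem_iUnion, exists_prop,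
      Set.mem_iInter]
    refine ⟨fun hk => or_iff_not_imp_right.2 fun h => ?_, ?_⟩
    · push Not at h
      exact ⟨_, hk, lt_arrival_jumpCount (h.imp fun _ => not_not.1)⟩
    · rintro (⟨j, hj, hq⟩ | h)
      · exact (jumpCount_le hq).trans hj
      · rw [show jumpCount q.1 q.2 = 0 from
          Nat.sInf_eq_zero.2 (Or.inr (Set.eq_empty_of_forall_notMem h))]
        exact k.zero_le
  rw [preimage_eq]
  exact (MeasurableSet.biUnion (Set.to_countable _) fun j _ => hA j).union
    (.iInter fun j => (hA j).compl)

/-- Let `B` be the event that infinitely many jumps occur by time `t`. The first waiting time must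
be at most `t`, and then the remaining sequence lies in `B` too; so `μ B ≤ ν {a ≤ t} * μ B`. -/
lemma infinitePi_forall_arrival_le (ν : Measure (ℝ × M)) [IsProbabilityMeasure ν]
    (hpos : ∀ᵐ a ∂ν, 0 < a.1) {t : ℝ} (ht : ν {a | a.1 ≤ t} < 1) :
    (Measure.infinitePi fun _ : ℕ => ν) {ω | ∀ k, arrival ω (k + 1) ≤ t} = 0 := by
  set μ := Measure.infinitePi fun _ : ℕ => ν
  set B : Set (ℕ → ℝ × M) := {ω | ∀ k, arrival ω (k + 1) ≤ t} with hB
  have B_measurable : MeasurableSet B := by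
    rw [hB, Set.ofPred_forall]
    exact .iInter fun k => measurableSet_le (measurable_arrival (k + 1)) measurable_const
  have tail_le : ∀ᵐ a ∂ν, μ {ω | prepend a ω ∈ B} ≤
      {a : ℝ × M | a.1 ≤ t}.indicator (fun _ => μ B) a := by
    filter_upwards [hpos] with a ha
    by_cases hat : a.1 ≤ t
    · rw [Set.indicator_of_mem (s := {a : ℝ × M | a.1 ≤ t}) hat]
      refine measure_mono fun ω hω k => ?_
      linarith [arrival_prepend a ω (k + 1), hω (k + 1)]
    · refine le_of_eq_of_le (measure_mono_null (fun ω hω => hat ?_) measure_empty) zero_le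
      simpa [arrival, prepend] using hω 0
  have self_le : μ B ≤ μ B * ν {a | a.1 ≤ t} := by
    rw [← lintegral_indicator_const (measurableSet_le measurable_fst measurable_const)]
    exact (infinitePi_apply_eq_lintegral_prepend ν B_measurable).trans_le
      (lintegral_mono_ae tail_le)
  by_contra hne
  refine self_le.not_gt ?_
  simpa using ENNReal.mul_lt_mul_right hne (measure_ne_top μ B) ht

lemma infinitePi_ae_nonExplosive (ν : Measure (ℝ × M)) [IsProbabilityMeasure ν]
    (hpos : ∀ᵐ a ∂ν, 0 < a.1) (hlt : ∀ t, ν {a | a.1 ≤ t} < 1) :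
    ∀ᵐ ω ∂Measure.infinitePi fun _ : ℕ => ν, NonExplosive ω := by
  have at_naturals : ∀ᵐ ω ∂Measure.infinitePi fun _ : ℕ => ν,
      ∀ m : ℕ, ∃ k, (m : ℝ) < arrival ω (k + 1) :=
    ae_all_iff.2 fun m => by
      simpa [ae_iff] using infinitePi_forall_arrival_le ν hpos (hlt m)
  filter_upwards [at_naturals] with ω hω t
  obtain ⟨m, hm⟩ := exists_nat_gt t
  exact (hω m).imp fun _ => hm.trans

end JumpTimes

section JumpPath

variable {S : Type*}

/-- The successive states `z`, `f₀ z`, `f₁ (f₀ z)`, … obtained by applying the maps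
`fₖ = (ω k).2`. -/
def embeddedChain (z : S) (ω : ℕ → ℝ × (S → S)) : ℕ → S
  | 0 => z
  | k + 1 => (ω k).2 (embeddedChain z ω k)

/-- The continuous-time path that follows the embedded chain, `(ω k).1` being the time it spends in
the `k`-th state. -/
def jumpPath (z : S) (ω : ℕ → ℝ × (S → S)) (t : ℝ) : S := embeddedChain z ω (jumpCount t ω)

/-- The path from time `t` on, as a function of nonnegative time. -/
def shiftPath (z : S) (t : ℝ) (ω : ℕ → ℝ × (S → S)) : ℝ≥0 → S := fun s => jumpPath z ω (s + t)

lemma embeddedChain_prepend (z : S) (a : ℝ × (S → S)) (ω : ℕ → ℝ × (S → S)) (k : ℕ) :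
    embeddedChain z (prepend a ω) (k + 1) = embeddedChain (a.2 z) ω k := by
  induction k with
  | zero => rfl
  | succ k ih => rw [embeddedChain, ih]; rfl

lemma shiftPath_prepend_of_le (z : S) {a : ℝ × (S → S)} {ω : ℕ → ℝ × (S → S)}
    (hω : NonExplosive ω) {t : ℝ} (hat : a.1 ≤ t) :
    shiftPath z t (prepend a ω) = shiftPath (a.2 z) (t - a.1) ω := by
  funext s
  have has : a.1 ≤ s + t := hat.trans (le_add_of_nonneg_left s.2)
  rw [shiftPath, jumpPath, jumpCount_prepend_of_le hω has, embeddedChain_prepend, shiftPath,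
    jumpPath, add_sub_assoc]

lemma shiftPath_add_prepend (z : S) (a t : ℝ) (φ : S → S) (ω : ℕ → ℝ × (S → S)) :
    shiftPath z t (prepend (a + t, φ) ω) = shiftPath z 0 (prepend (a, φ) ω) := by
  have embeddedChain_eq (k : ℕ) :
      embeddedChain z (prepend (a + t, φ) ω) k = embeddedChain z (prepend (a, φ) ω) k := by
    cases k with
    | zero => rfl
    | succ k => rw [embeddedChain_prepend, embeddedChain_prepend]
  funext s
  rw [shiftPath, jumpPath, jumpCount_add_prepend, embeddedChain_eq, shiftPath, add_zero, jumpPath]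

lemma jumpPath_zero {z : S} {ω : ℕ → ℝ × (S → S)} (h : 0 < (ω 0).1) : jumpPath z ω 0 = z := by
  rw [jumpPath, jumpCount_zero h]
  rfl

lemma jumpPath_eventuallyEq_nhdsGT (z : S) {ω : ℕ → ℝ × (S → S)} (hω : NonExplosive ω) (t : ℝ≥0) :
    ∀ᶠ s : ℝ≥0 in 𝓝[>] t, jumpPath z ω s = jumpPath z ω t := by
  obtain ⟨hlt, hle⟩ := (jumpCount_eq_iff (hω t) _).1 rfl
  have before_next_jump : ∀ᶠ s : ℝ≥0 in 𝓝[>] t, (s : ℝ) < arrival ω (jumpCount (t : ℝ) ω + 1) :=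
    nhdsWithin_le_nhds (NNReal.continuous_coe.continuousAt.eventually (eventually_lt_nhds hlt))
  filter_upwards [before_next_jump, self_mem_nhdsWithin] with s hs hts
  have hst : (t : ℝ) ≤ s := NNReal.coe_le_coe.2 (le_of_lt hts)
  rw [jumpPath, jumpPath, (jumpCount_eq_iff (hω s) _).2 ⟨hs, fun j hj => (hle j hj).trans hst⟩]

lemma exists_jumpPath_eventuallyEq_nhdsLT (z : S) {ω : ℕ → ℝ × (S → S)} (hω : NonExplosive ω)
    (t : ℝ≥0) : ∃ y : S, ∀ᶠ s : ℝ≥0 in 𝓝[<] t, jumpPath z ω s = y := by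
  have jumpCount_mono : Monotone fun s : ℝ≥0 => jumpCount (s : ℝ) ω :=
    (monotone_jumpCount hω).comp NNReal.coe_mono
  have limit := jumpCount_mono.tendsto_nhdsLT t
  rw [nhds_discrete, Filter.tendsto_pure] at limit
  exact ⟨_, limit.mono fun s hs => congrArg (embeddedChain z ω) hs⟩

variable [MeasurableSpace S] [Finite S] [DiscreteMeasurableSpace S]

lemma measurable_embeddedChain (z : S) (k : ℕ) :
    Measurable fun ω : ℕ → ℝ × (S → S) => embeddedChain z ω k := by
  induction k with
  | zero => exact measurable_const
  | succ k ih =>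
    have evaluation : Measurable fun q : S × (S → S) => q.2 q.1 :=
      measurable_from_prod_countable_right fun y => measurable_pi_apply y
    exact evaluation.comp (ih.prodMk (measurable_snd.comp (measurable_pi_apply k)))

lemma measurable_jumpPath (z : S) :
    Measurable fun q : ℝ × (ℕ → ℝ × (S → S)) => jumpPath z q.2 q.1 := by
  have chain_measurable : Measurable fun q : ℕ × (ℕ → ℝ × (S → S)) => embeddedChain z q.2 q.1 :=
    measurable_from_prod_countable_right fun k => measurable_embeddedChain z k
  exact chain_measurable.comp (measurable_jumpCount.prodMk measurable_snd)

lemma measurable_shiftPath (z : S) :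
    Measurable fun q : ℝ × (ℕ → ℝ × (S → S)) => shiftPath z q.1 q.2 :=
  measurable_pi_lambda _ fun _ =>
    (measurable_jumpPath z).comp ((measurable_fst.const_add _).prodMk measurable_snd)

lemma measurableSet_shiftPath_mem {A : Set (ℝ≥0 → S)} (hA : MeasurableSet A) (z : S) (t : ℝ) :
    MeasurableSet {ω | shiftPath z t ω ∈ A} :=
  (measurable_shiftPath z).comp measurable_prodMk_left hA

end JumpPath

section Uniformization

open Matrix

variable {S : Type*} [Fintype S]

lemma continuous_primitive_mulVec (Q : Matrix S S ℝ) {w : ℝ → S → ℝ}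
    (hw : ∀ y a b, IntervalIntegrable (fun s => w s y) volume a b) (z : S) :
    Continuous fun t => ∫ s in 0..t, (Q *ᵥ w s) z :=
  intervalIntegral.continuous_primitive (fun a b => by
    simpa only [mulVec, dotProduct, Finset.sum_fn] using
      IntervalIntegrable.sum _ fun y (_ : y ∈ Finset.univ) => (hw y a b).const_mul (Q z y)) 0

variable [DecidableEq S]

/-- Applying the integral equation twice replaces `w` by a differentiable function `v`, for which
`e^{uQ} v(t - u)` does not depend on `u`. -/
lemma eq_exp_mulVec_of_integral_eq {Q : Matrix S S ℝ} {w : ℝ → S → ℝ}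
    (hw : ∀ y a b, IntervalIntegrable (fun s => w s y) volume a b)
    (heq : ∀ t, 0 ≤ t → ∀ z, w t z = w 0 z + ∫ s in 0..t, (Q *ᵥ w s) z) {t : ℝ} (ht : 0 ≤ t) :
    w t = NormedSpace.exp (t • Q) *ᵥ w 0 := by
  let w' : ℝ → S → ℝ := fun t z => w 0 z + ∫ s in 0..t, (Q *ᵥ w s) z
  let v : ℝ → S → ℝ := fun t z => w 0 z + ∫ s in 0..t, (Q *ᵥ w' s) z
  have w'_eq (s : ℝ) (hs : 0 ≤ s) : w' s = w s := funext fun z => (heq s hs z).symm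
  have v_eq (s : ℝ) (hs : 0 ≤ s) : v s = w s := by
    funext z
    rw [heq s hs z]
    refine congrArg (w 0 z + ·) (intervalIntegral.integral_congr fun a ha => ?_)
    rw [Set.uIcc_of_le hs] at ha
    exact congrArg (fun f => (Q *ᵥ f) z) (w'_eq a ha.1)
  have hv (s : ℝ) (hs : 0 ≤ s) (z : S) : HasDerivAt (fun s => v s z) ((Q *ᵥ v s) z) s := by
    have w'_continuous (y : S) : Continuous fun s => w' s y :=
      continuous_const.add (continuous_primitive_mulVec Q hw y)
    have integrand_continuous : Continuous fun s => (Q *ᵥ w' s) z :=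
      continuous_finsetSum _ fun y _ => (w'_continuous y).const_mul (Q z y)
    rw [v_eq s hs, ← w'_eq s hs]
    exact (integrand_continuous.integral_hasStrictDerivAt 0 s).hasDerivAt.const_add _
  have reversed (u : ℝ) (hu : u ≤ t) (y : S) :
      HasDerivAt (fun u => v (t - u) y) (-(Q *ᵥ v (t - u)) y) u := by
    simpa using (hv (t - u) (sub_nonneg.2 hu) y).comp_const_sub t u
  have derivative_zero (u : ℝ) (hu : u ≤ t) (z : S) :
      HasDerivAt (fun u => (NormedSpace.exp (u • Q) *ᵥ v (t - u)) z) 0 u := by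
    simpa [← Pi.neg_def] using hasDerivAt_exp_smul_mulVec Q
      (f := fun u => v (t - u)) (f' := fun u => -(Q *ᵥ v (t - u))) (reversed u hu) z
  funext z
  have := constant_of_has_deriv_right_zero
    (fun u hu => (derivative_zero u hu.2 z).continuousAt.continuousWithinAt)
    (fun u hu => (derivative_zero u hu.2.le z).hasDerivWithinAt) t (Set.right_mem_Icc.2 ht)
  simp only [sub_self, sub_zero, zero_smul, NormedSpace.exp_zero, one_mulVec] at this
  rw [← v_eq t ht, ← this, v_eq 0 le_rfl]

/-- The data of a uniformized Markov chain: at the jumps of a Poisson process of rate `c` the state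
moves according to the stochastic matrix `P`. -/
structure Uniformized (S : Type*) [Fintype S] [DecidableEq S] where
  c : ℝ
  P : Matrix S S ℝ
  c_pos : 0 < c
  stochastic : P ∈ rowStochastic ℝ S

namespace Uniformized

/-- The generator of the uniformized chain. -/
def gen (D : Uniformized S) : Matrix S S ℝ := D.c • (D.P - 1)

variable [MeasurableSpace S]

/-- The law of the state after a jump from `z`. -/
def rowLaw (D : Uniformized S) (z : S) : Measure S :=
  ∑ y, ENNReal.ofReal (D.P z y) • Measure.dirac y

instance (D : Uniformized S) (z : S) : IsProbabilityMeasure (D.rowLaw z) := ⟨by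
  simp only [rowLaw, Measure.coe_finsetSum, Finset.sum_apply, Measure.smul_apply, measure_univ,
    smul_eq_mul, mul_one]
  rw [← ENNReal.ofReal_sum_of_nonneg fun j _ => D.stochastic.1 z j,
    sum_row_of_mem_rowStochastic D.stochastic, ENNReal.ofReal_one]⟩

instance (D : Uniformized S) : IsProbabilityMeasure (expMeasure D.c) :=
  isProbabilityMeasure_expMeasure D.c_pos

/-- The law of an exponential waiting time together with an independent random map `S → S` whose
values at the states `z` are independent with laws `rowLaw z`. -/
def stepLaw (D : Uniformized S) : Measure (ℝ × (S → S)) :=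
  (expMeasure D.c).prod (Measure.pi D.rowLaw)

instance (D : Uniformized S) : IsProbabilityMeasure D.stepLaw :=
  inferInstanceAs (IsProbabilityMeasure ((expMeasure D.c).prod _))

/-- The law of the i.i.d. sequence of waiting times and random maps that drives the chain from
every initial state. -/
def pathLaw (D : Uniformized S) : Measure (ℕ → ℝ × (S → S)) :=
  Measure.infinitePi fun _ => D.stepLaw

instance (D : Uniformized S) : IsProbabilityMeasure D.pathLaw :=
  inferInstanceAs (IsProbabilityMeasure (Measure.infinitePi _))

lemma stepLaw_ae_pos (D : Uniformized S) : ∀ᵐ a ∂D.stepLaw, 0 < a.1 :=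
  Measure.quasiMeasurePreserving_fst.ae (expMeasure_ae_pos D.c)

lemma pathLaw_ae_jumpPath_zero (D : Uniformized S) (z : S) : ∀ᵐ ω ∂D.pathLaw, jumpPath z ω 0 = z :=
  ((measurePreserving_eval_infinitePi (fun _ : ℕ => D.stepLaw) 0).quasiMeasurePreserving.ae
    D.stepLaw_ae_pos).mono fun _ => jumpPath_zero

lemma pathLaw_ae_nonExplosive (D : Uniformized S) : ∀ᵐ ω ∂D.pathLaw, NonExplosive ω :=
  infinitePi_ae_nonExplosive D.stepLaw D.stepLaw_ae_pos fun t => by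
    rw [show {a : ℝ × (S → S) | a.1 ≤ t} = Set.Iic t ×ˢ Set.univ by ext; simp, stepLaw,
      Measure.prod_prod, measure_univ, mul_one]
    exact expMeasure_Iic_lt_one D.c_pos t

variable [DiscreteMeasurableSpace S]

lemma lintegral_pi_rowLaw (D : Uniformized S) (z : S) (F : S → ENNReal) :
    ∫⁻ φ, F (φ z) ∂Measure.pi D.rowLaw = ∑ y, ENNReal.ofReal (D.P z y) * F y := by
  rw [(measurePreserving_eval D.rowLaw z).lintegral_comp (f := F) .of_discrete, rowLaw,
    lintegral_finsetSum_measure]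
  simp [lintegral_smul_measure, lintegral_dirac]

variable {A : Set (ℝ≥0 → S)}

/-- Conditioning on the first waiting time `a` and the first random map: if `a ≤ t`, the path
restarts from the state after the jump; if `a > t`, by the lack of memory of `a`, it restarts from
`z`. -/
lemma pathLaw_shiftPath_mem_eq_add (D : Uniformized S) (hA : MeasurableSet A) (z : S)
    {t : ℝ} (ht : 0 ≤ t) :
    D.pathLaw {ω | shiftPath z t ω ∈ A} =
      (∫⁻ a in Set.Ioc 0 t, ENNReal.ofReal (D.c * Real.exp (-(D.c * a))) *
        ∑ y, ENNReal.ofReal (D.P z y) * D.pathLaw {ω | shiftPath y (t - a) ω ∈ A}) +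
      ENNReal.ofReal (Real.exp (-(D.c * t))) * D.pathLaw {ω | shiftPath z 0 ω ∈ A} := by
  let g : ℝ → ℝ → ENNReal := fun s a =>
    ∫⁻ φ, D.pathLaw {ω | shiftPath z s (prepend (a, φ) ω) ∈ A} ∂Measure.pi D.rowLaw
  have prepended_measurable (s : ℝ) : Measurable fun a : ℝ × (S → S) =>
      D.pathLaw {ω | shiftPath z s (prepend a ω) ∈ A} :=
    measurable_measure_prodMk_left (measurable_prepend (measurableSet_shiftPath_mem hA z s))
  have disintegrate (s : ℝ) :
      D.pathLaw {ω | shiftPath z s ω ∈ A} = ∫⁻ a, g s a ∂expMeasure D.c := by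
    rw [pathLaw, infinitePi_apply_eq_lintegral_prepend D.stepLaw
      (measurableSet_shiftPath_mem hA z s)]
    exact lintegral_prod _ (prepended_measurable s).aemeasurable
  have before (a : ℝ) (hat : a ≤ t) :
      g t a = ∑ y, ENNReal.ofReal (D.P z y) * D.pathLaw {ω | shiftPath y (t - a) ω ∈ A} := by
    rw [← D.lintegral_pi_rowLaw z fun y => D.pathLaw {ω | shiftPath y (t - a) ω ∈ A}]
    refine lintegral_congr fun φ => measure_congr ?_
    filter_upwards [D.pathLaw_ae_nonExplosive] with ω hω
    exact congrArg (· ∈ A) (shiftPath_prepend_of_le z (a := (a, φ)) hω hat)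
  have after (a : ℝ) : g t (a + t) = g 0 a := by simp only [g, shiftPath_add_prepend]
  rw [disintegrate t, lintegral_expMeasure_eq_add D.c ht (g := g t)
    (prepended_measurable t).lintegral_prod_right', lintegral_congr after, disintegrate 0]
  refine congrArg (· + _) (setLIntegral_congr_fun measurableSet_Ioc fun a ha => ?_)
  exact congrArg (_ * ·) (before a ha.2)

/-- The probability, as a function of the initial state, that the path seen from time `t` on lies
in `A`. -/
def futureProb (D : Uniformized S) (A : Set (ℝ≥0 → S)) (t : ℝ) (z : S) : ℝ :=
  D.pathLaw.real {ω | shiftPath z t ω ∈ A}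

lemma measurable_futureProb (D : Uniformized S) (hA : MeasurableSet A) (z : S) :
    Measurable fun t => D.futureProb A t z :=
  (measurable_measure_prodMk_left (measurable_shiftPath z hA)).ennreal_toReal

lemma futureProb_eq_add (D : Uniformized S) (hA : MeasurableSet A) (z : S) {t : ℝ} (ht : 0 ≤ t) :
    D.futureProb A t z =
      (∫ a in 0..t, D.c * Real.exp (-(D.c * a)) * (D.P *ᵥ D.futureProb A (t - a)) z) +
      Real.exp (-(D.c * t)) * D.futureProb A 0 z := by
  let F : ℝ → ENNReal := fun a => ENNReal.ofReal (D.c * Real.exp (-(D.c * a))) *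
    ∑ y, ENNReal.ofReal (D.P z y) * D.pathLaw {ω | shiftPath y (t - a) ω ∈ A}
  have F_measurable : Measurable F :=
    Measurable.mul (by fun_prop) (Finset.measurable_sum _ fun y _ =>
      ((measurable_measure_prodMk_left (measurable_shiftPath y hA)).comp
        (measurable_const.sub measurable_id)).const_mul _)
  have F_lt_top (a : ℝ) : F a < ⊤ :=
    ENNReal.mul_lt_top ENNReal.ofReal_lt_top (ENNReal.sum_lt_top.2 fun y _ =>
      ENNReal.mul_lt_top ENNReal.ofReal_lt_top (measure_lt_top _ _))
  have toReal_F (a : ℝ) : (F a).toReal =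
      D.c * Real.exp (-(D.c * a)) * (D.P *ᵥ D.futureProb A (t - a)) z := by
    rw [ENNReal.toReal_mul, ENNReal.toReal_ofReal (mul_pos D.c_pos (Real.exp_pos _)).le,
      ENNReal.toReal_sum fun y _ =>
        (ENNReal.mul_lt_top ENNReal.ofReal_lt_top (measure_lt_top _ _)).ne]
    simp [mulVec, dotProduct, futureProb, measureReal_def, D.stochastic.1 z]
  have renewal := D.pathLaw_shiftPath_mem_eq_add hA z ht
  have integral_ne_top : ∫⁻ a in Set.Ioc 0 t, F a ≠ ⊤ :=
    ne_top_of_le_ne_top (measure_ne_top _ _) (le_self_add.trans_eq renewal.symm)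
  rw [intervalIntegral.integral_of_le ht, futureProb, measureReal_def, renewal,
    ENNReal.toReal_add integral_ne_top
      (ENNReal.mul_ne_top ENNReal.ofReal_ne_top (measure_ne_top _ _)),
    ← integral_toReal F_measurable.aemeasurable (ae_of_all _ F_lt_top), ENNReal.toReal_mul,
    ENNReal.toReal_ofReal (Real.exp_pos _).le]
  simp only [toReal_F]
  rfl

lemma exp_mul_futureProb_eq (D : Uniformized S) (hA : MeasurableSet A) (z : S) {t : ℝ}
    (ht : 0 ≤ t) :
    Real.exp (D.c * t) * D.futureProb A t z = D.futureProb A 0 z +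
      ∫ s in 0..t, ((D.c • D.P) *ᵥ (Real.exp (D.c * s) • D.futureProb A s)) z := by
  have reverse_time := intervalIntegral.integral_comp_sub_left (a := 0) (b := t)
    (fun s => D.c * Real.exp (-(D.c * (t - s))) * (D.P *ᵥ D.futureProb A s) z) t
  simp only [sub_sub_cancel, sub_zero, sub_self] at reverse_time
  rw [D.futureProb_eq_add hA z ht, mul_add, ← mul_assoc, ← Real.exp_add, add_neg_cancel,
    Real.exp_zero, one_mul, add_comm, reverse_time, ← intervalIntegral.integral_const_mul]
  refine congrArg _ (intervalIntegral.integral_congr fun s _ => ?_)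
  have exponents : Real.exp (D.c * t) * Real.exp (-(D.c * (t - s))) = Real.exp (D.c * s) := by
    rw [← Real.exp_add]
    ring_nf
  simp only [smul_mulVec, mulVec_smul, Pi.smul_apply, smul_eq_mul, ← exponents]
  ring

lemma futureProb_eq_exp_mulVec (D : Uniformized S) (hA : MeasurableSet A) {t : ℝ} (ht : 0 ≤ t) :
    D.futureProb A t = NormedSpace.exp (t • D.gen) *ᵥ D.futureProb A 0 := by
  let w : ℝ → S → ℝ := fun s => Real.exp (D.c * s) • D.futureProb A s
  have w_integrable (y : S) (a b : ℝ) : IntervalIntegrable (fun s => w s y) volume a b := by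
    refine IntervalIntegrable.continuousOn_mul (g := fun s => Real.exp (D.c * s)) ?_ (by fun_prop)
    rw [intervalIntegrable_iff, IntegrableOn]
    have : IsFiniteMeasure (volume.restrict (Set.uIoc a b)) := ⟨by simp [Set.uIoc]⟩
    refine Integrable.of_bound (D.measurable_futureProb hA y).aestronglyMeasurable 1
      (ae_of_all _ fun s => ?_)
    exact (Real.norm_of_nonneg measureReal_nonneg).trans_le measureReal_le_one
  have solution := eq_exp_mulVec_of_integral_eq (Q := D.c • D.P) w_integrable
    (fun s hs z => by simpa [w] using D.exp_mul_futureProb_eq hA z hs) ht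
  rw [gen, exp_smul_smul_sub_one, mul_comm D.c t, mul_smul, smul_mulVec]
  have w_zero : w 0 = D.futureProb A 0 := by simp [w]
  rw [← w_zero, ← solution, smul_smul, ← Real.exp_add, mul_comm t, neg_add_cancel, Real.exp_zero,
    one_smul]

end Uniformized

variable {R : Type*} [Fintype R] [DecidableEq R]

/-- The probability that a chain with generator `Q`, known to be at `η 0` at time `t 0`, visits the
states `η 1, …, η k` at the times `t 1 ≤ … ≤ t k`. -/
def transitionProd (Q : Matrix R R ℝ) {k : ℕ} (t : Fin (k + 1) → ℝ≥0) (η : Fin (k + 1) → R) : ℝ :=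
  ∏ i : Fin k, NormedSpace.exp (((t i.succ : ℝ) - (t i.castSucc : ℝ)) • Q)
    (η i.castSucc) (η i.succ)

lemma transitionProd_succ (Q : Matrix R R ℝ) {k : ℕ} (t : Fin (k + 2) → ℝ≥0)
    (η : Fin (k + 2) → R) :
    transitionProd Q t η = NormedSpace.exp (((t 1 : ℝ) - (t 0 : ℝ)) • Q) (η 0) (η 1) *
      transitionProd Q (fun i => t i.succ) (fun i => η i.succ) :=
  Fin.prod_univ_succ _

lemma transitionProd_tsub (Q : Matrix R R ℝ) {k : ℕ} {t : Fin (k + 1) → ℝ≥0} {s : ℝ≥0}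
    (hs : ∀ i, s ≤ t i) (η : Fin (k + 1) → R) :
    transitionProd Q (fun i => t i - s) η = transitionProd Q t η :=
  Finset.prod_congr rfl fun _ _ => by
    rw [NNReal.coe_sub (hs _), NNReal.coe_sub (hs _), sub_sub_sub_cancel_right]

namespace Uniformized

variable [MeasurableSpace S] [DiscreteMeasurableSpace S] {π : S → R} {Q : Matrix R R ℝ}

lemma pathLaw_real_visits_of_zero_time (D : Uniformized S)
    (hπ : ∀ f : R → ℝ, D.gen *ᵥ (f ∘ π) = (Q *ᵥ f) ∘ π) {k : ℕ}
    (hzero : ∀ (t : Fin (k + 1) → ℝ≥0) (η : Fin (k + 1) → R) (y : S), Monotone t → t 0 = 0 →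
      D.pathLaw.real {ω | ∀ i, π (jumpPath y ω (t i)) = η i} =
        if π y = η 0 then transitionProd Q t η else 0)
    {t : Fin (k + 1) → ℝ≥0} (ht : Monotone t) (η : Fin (k + 1) → R) (z : S) :
    D.pathLaw.real {ω | ∀ i, π (jumpPath z ω (t i)) = η i} =
      NormedSpace.exp ((t 0 : ℝ) • Q) (π z) (η 0) * transitionProd Q t η := by
  let A : Set (ℝ≥0 → S) := {x | ∀ i, π (x (t i - t 0)) = η i}
  have A_measurable : MeasurableSet A := by
    rw [show A = ⋂ i, (fun x : ℝ≥0 → S => x (t i - t 0)) ⁻¹' {y | π y = η i} by ext; simp [A]]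
    exact MeasurableSet.iInter fun i => measurable_pi_apply _ .of_discrete
  have t_zero_le (i : Fin (k + 1)) : t 0 ≤ t i := ht (Fin.zero_le i)
  have shifted : D.pathLaw.real {ω | ∀ i, π (jumpPath z ω (t i)) = η i} =
      D.futureProb A (t 0) z := by
    simp only [futureProb, A, Set.mem_ofPred_eq, shiftPath, NNReal.coe_sub (t_zero_le _),
      sub_add_cancel]
  have initial : D.futureProb A 0 =
      (fun r => if r = η 0 then transitionProd Q t η else 0) ∘ π := by
    funext y
    simp only [futureProb, A, Set.mem_ofPred_eq, shiftPath, add_zero, Function.comp_apply]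
    rw [hzero _ η y (fun i j hij => tsub_le_tsub_right (ht hij) _) (tsub_self _),
      transitionProd_tsub Q t_zero_le]
  rw [shifted, D.futureProb_eq_exp_mulVec A_measurable (t 0).coe_nonneg, initial,
    exp_mulVec_comp hπ]
  simp [mulVec, dotProduct]

lemma pathLaw_real_visits (D : Uniformized S)
    (hπ : ∀ f : R → ℝ, D.gen *ᵥ (f ∘ π) = (Q *ᵥ f) ∘ π) {k : ℕ} (t : Fin (k + 1) → ℝ≥0)
    (η : Fin (k + 1) → R) (z : S) (ht : Monotone t) (ht0 : t 0 = 0) :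
    D.pathLaw.real {ω | ∀ i, π (jumpPath z ω (t i)) = η i} =
      if π z = η 0 then transitionProd Q t η else 0 := by
  induction k generalizing z with
  | zero =>
    have : {ω | ∀ i, π (jumpPath z ω (t i)) = η i} =ᵐ[D.pathLaw] {_ω | π z = η 0} := by
      filter_upwards [D.pathLaw_ae_jumpPath_zero z] with ω hω
      exact propext (Fin.forall_fin_one.trans (by rw [ht0, NNReal.coe_zero, hω]; rfl))
    rw [measureReal_congr this]
    split_ifs with h <;> simp [h, transitionProd]
  | succ k ih =>
    have : {ω | ∀ i, π (jumpPath z ω (t i)) = η i} =ᵐ[D.pathLaw]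
        {ω | π z = η 0 ∧ ∀ i : Fin (k + 1), π (jumpPath z ω (t i.succ)) = η i.succ} := by
      filter_upwards [D.pathLaw_ae_jumpPath_zero z] with ω hω
      exact propext (Fin.forall_fin_succ.trans (by rw [ht0, NNReal.coe_zero, hω]; rfl))
    rw [measureReal_congr this]
    split_ifs with h
    · simp only [h, true_and]
      rw [D.pathLaw_real_visits_of_zero_time hπ ih (t := fun i => t i.succ)
        (ht.comp Fin.strictMono_succ.monotone) (fun i => η i.succ), transitionProd_succ, h, ht0,
        NNReal.coe_zero, sub_zero, Fin.succ_zero_eq_one]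
    · simp [h]

end Uniformized

/-- `X` is, under `μ`, a continuous-time Markov chain with generator `Q` started from `z`: it has
the finite-dimensional distributions given by `exp (t • Q)`, and almost surely right-continuous
paths with left limits, for the discrete topology of the state space. -/
structure IsMarkovChain (Q : Matrix R R ℝ) (z : R) {Ω : Type*} [MeasurableSpace Ω]
    (μ : Measure Ω) (X : ℝ≥0 → Ω → R) : Prop where
  measurable : ∀ t y, MeasurableSet {ω | X t ω = y}
  fdd : ∀ (k : ℕ) (t : Fin (k + 1) → ℝ≥0) (η : Fin (k + 1) → R), Monotone t → t 0 = 0 → η 0 = z →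
    μ.real {ω | ∀ i, X (t i) ω = η i} = transitionProd Q t η
  right_continuous : ∀ᵐ ω ∂μ, ∀ t : ℝ≥0, ∀ᶠ s in 𝓝[>] t, X s ω = X t ω
  left_limits : ∀ᵐ ω ∂μ, ∀ t : ℝ≥0, ∃ y, ∀ᶠ s in 𝓝[<] t, X s ω = y

lemma Uniformized.isMarkovChain_comp_jumpPath [MeasurableSpace S] [DiscreteMeasurableSpace S]
    (D : Uniformized S) {π : S → R} {Q : Matrix R R ℝ}
    (hπ : ∀ f : R → ℝ, D.gen *ᵥ (f ∘ π) = (Q *ᵥ f) ∘ π) (z : S) :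
    IsMarkovChain Q (π z) D.pathLaw fun t ω => π (jumpPath z ω t) where
  measurable t y := ((measurable_jumpPath z).comp measurable_prodMk_left)
    (MeasurableSet.of_discrete (s := {x | π x = y}))
  fdd _ t η ht ht0 hη := by rw [D.pathLaw_real_visits hπ t η z ht ht0, if_pos hη.symm]
  right_continuous := D.pathLaw_ae_nonExplosive.mono fun _ hω t =>
    (jumpPath_eventuallyEq_nhdsGT z hω t).mono fun _ hs => congrArg π hs
  left_limits := D.pathLaw_ae_nonExplosive.mono fun _ hω t =>
    let ⟨y, hy⟩ := exists_jumpPath_eventuallyEq_nhdsLT z hω t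
    ⟨π y, hy.mono fun _ hs => congrArg π hs⟩

theorem IsQMatrix.exists_isMarkovChain_comp {S : Type} [Fintype S] {Q : Matrix S S ℝ}
    (hQ : IsQMatrix Q) (z : S) :
    ∃ (Ω : Type) (_ : MeasurableSpace Ω) (μ : Measure Ω) (X : ℝ≥0 → Ω → S),
      IsProbabilityMeasure μ ∧
      ∀ (R : Type) [Fintype R] [DecidableEq R] (π : S → R) (Q' : Matrix R R ℝ),
        (∀ f : R → ℝ, Q *ᵥ (f ∘ π) = (Q' *ᵥ f) ∘ π) →
          IsMarkovChain Q' (π z) μ fun t ω => π (X t ω) := by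
  classical
  obtain ⟨c, hc, P, hP, rfl⟩ := hQ.exists_eq_smul_rowStochastic_sub_one
  let _ : MeasurableSpace S := ⊤
  let D : Uniformized S := ⟨c, P, hc, hP⟩
  exact ⟨ℕ → ℝ × (S → S), inferInstance, D.pathLaw, fun t ω => jumpPath z ω t, inferInstance,
    fun R _ _ π Q' hπ => D.isMarkovChain_comp_jumpPath hπ z⟩

namespace IsMarkovChain

variable {Q : Matrix R R ℝ} {z : R} {Ω : Type*} [MeasurableSpace Ω] {μ : Measure Ω}
  [IsProbabilityMeasure μ] {X : ℝ≥0 → Ω → R}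

lemma ae_zero_eq (hX : IsMarkovChain Q z μ X) : ∀ᵐ ω ∂μ, X 0 ω = z := by
  have start : μ.real {ω | X 0 ω = z} = 1 := by
    simpa [transitionProd] using hX.fdd 0 (fun _ => 0) (fun _ => z) monotone_const rfl rfl
  rw [ae_iff, ← Set.compl_ofPred, prob_compl_eq_zero_iff (hX.measurable 0 z)]
  exact (ENNReal.toReal_eq_one_iff _).1 start

lemma real_eq (hX : IsMarkovChain Q z μ X) (t : ℝ≥0) (y : R) :
    μ.real {ω | X t ω = y} = NormedSpace.exp ((t : ℝ) • Q) z y := by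
  have monotone : Monotone ![0, t] := by
    simp [Fin.monotone_iff_le_succ]
  have two_times := hX.fdd 1 ![0, t] ![z, y] monotone rfl rfl
  have start : {ω | ∀ i, X (![0, t] i) ω = ![z, y] i} =ᵐ[μ] {ω | X t ω = y} :=
    hX.ae_zero_eq.mono fun ω hω => propext (Fin.forall_fin_two.trans (and_iff_right hω))
  rw [← measureReal_congr start, two_times]
  simp [transitionProd]

lemma integral_comp (hX : IsMarkovChain Q z μ X) (t : ℝ≥0) (f : R → ℝ) :
    ∫ ω, f (X t ω) ∂μ = (NormedSpace.exp ((t : ℝ) • Q) *ᵥ f) z := by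
  let _ : MeasurableSpace R := ⊤
  have X_measurable : Measurable (X t) := measurable_to_countable' (hX.measurable t)
  have := Measure.isProbabilityMeasure_map (μ := μ) X_measurable.aemeasurable
  rw [← integral_map (f := f) X_measurable.aemeasurable .of_discrete, integral_fintype .of_finite]
  refine Finset.sum_congr rfl fun y _ => ?_
  rw [map_measureReal_apply X_measurable .of_discrete, smul_eq_mul]
  exact congrArg (· * f y) (hX.real_eq t y)

end IsMarkovChain

end Uniformization

end FiniteMarkov

namespace ERGlauber

/-! ### The coupled dynamics -/

section Dynamics

open Matrix FiniteMarkov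

variable {n : ℕ}

/-- The configuration obtained from `σ` by flipping the spin at `v`. -/
def flip (v : Fin n) (σ : Config n) : Config n := Function.update σ v (-σ v)

lemma flip_self (v : Fin n) (σ : Config n) : flip v σ v = -σ v := Function.update_self _ _ _

lemma flip_of_ne {v w : Fin n} (h : w ≠ v) (σ : Config n) : flip v σ w = σ w :=
  Function.update_of_ne h _ _

lemma flip_injective (σ : Config n) : Function.Injective fun v => flip v σ := by
  intro v w h
  by_contra hne
  have at_v : flip v σ v = flip w σ v := congrFun h v
  rw [flip_self, flip_of_ne hne] at at_v
  exact neg_units_ne_self _ at_v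

lemma spin_flip_self (v : Fin n) (σ : Config n) : spin (flip v σ) v = -spin σ v := by
  simp [spin, flip_self]

lemma spin_flip_of_ne {v w : Fin n} (h : w ≠ v) (σ : Config n) :
    spin (flip v σ) w = spin σ w := by
  simp [spin, flip_of_ne h]

lemma spin_cases (σ : Config n) (v : Fin n) :
    (σ v = 1 ∧ spin σ v = 1) ∨ (σ v = -1 ∧ spin σ v = -1) := by
  rcases Int.units_eq_one_or (σ v) with h | h <;> simp [spin, h]

lemma abs_spin (σ : Config n) (v : Fin n) : |spin σ v| = 1 := by
  rcases spin_cases σ v with ⟨-, h⟩ | ⟨-, h⟩ <;> simp [h]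

lemma abs_spin_sub (σ σ' : Config n) (v : Fin n) :
    |spin σ v - spin σ' v| = if σ v ≠ σ' v then 2 else 0 := by
  rcases spin_cases σ v with ⟨h, e⟩ | ⟨h, e⟩ <;> rcases spin_cases σ' v with ⟨h', e'⟩ | ⟨h', e'⟩ <;>
    rw [h, e, h', e'] <;> norm_num [neg_units_ne_self, units_ne_neg_self]

lemma card_disagreement (σ σ' : Config n) :
    ((disagreement σ σ').card : ℝ) = ∑ v, if σ v ≠ σ' v then 1 else 0 := by
  rw [disagreement, Finset.card_filter, Nat.cast_sum]
  push_cast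
  rfl

lemma l1dist_eq (σ σ' : Config n) : l1dist σ σ' = 2 * (disagreement σ σ').card := by
  rw [card_disagreement, l1dist, Finset.mul_sum]
  exact Finset.sum_congr rfl fun v _ => by rw [abs_spin_sub, mul_ite, mul_one, mul_zero]

lemma disagreement_eq_singleton_iff (σ σ' : Config n) (v : Fin n) :
    disagreement σ σ' = {v} ↔ flip v σ = σ' := by
  simp only [disagreement, Finset.ext_iff, Finset.mem_filter, Finset.mem_univ, true_and,
    Finset.mem_singleton, funext_iff]
  refine forall_congr' fun w => ?_
  by_cases hw : w = v
  · subst hw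
    rw [flip_self, iff_true_right rfl, ne_comm, Int.units_ne_iff_eq_neg, eq_comm]
  · rw [flip_of_ne hw, iff_false_right hw, not_not]

lemma l1dist_eq_two_iff (σ σ' : Config n) : l1dist σ σ' = 2 ↔ ∃ v, flip v σ = σ' := by
  simp_rw [l1dist_eq, mul_eq_left₀ (two_ne_zero' ℝ), Nat.cast_eq_one, Finset.card_eq_one,
    disagreement_eq_singleton_iff]

open Classical in
/-- The adjacency matrix of `G` with real entries. -/
abbrev adj (G : SimpleGraph (Fin n)) : Matrix (Fin n) (Fin n) ℝ := G.adjMatrix ℝ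

/-- The local field felt by the vertex `v`. -/
def localField (G : SimpleGraph (Fin n)) (h : ℝ) (σ : Config n) (v : Fin n) : ℝ :=
  1 / n * ∑ w, adj G v w * spin σ w + h

/-- The Metropolis rate at which the spin at `v` flips. -/
def flipRate (G : SimpleGraph (Fin n)) (β h : ℝ) (v : Fin n) (σ : Config n) : ℝ :=
  Real.exp (-β * max (2 * spin σ v * localField G h σ v) 0)

lemma sum_spin_flip_sub (v : Fin n) (σ : Config n) :
    ∑ w, spin (flip v σ) w - ∑ w, spin σ w = -2 * spin σ v := by
  rw [← Finset.sum_sub_distrib, Fintype.sum_eq_single v fun w hw => by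
    rw [spin_flip_of_ne hw, sub_self], spin_flip_self]
  ring

lemma incidenceFinset_eq_image {V : Type*} [Fintype V] [DecidableEq V] (G : SimpleGraph V)
    [DecidableRel G.Adj] (v : V) :
    G.incidenceFinset v = (G.neighborFinset v).image fun w => s(v, w) := by
  ext e
  induction e with | _ x y => ?_
  simp only [SimpleGraph.mem_incidenceFinset, Finset.mem_image, SimpleGraph.mem_neighborFinset,
    SimpleGraph.mk'_mem_incidenceSet_iff, Sym2.eq_iff]
  constructor
  · rintro ⟨hxy, rfl | rfl⟩
    · exact ⟨y, hxy, Or.inl ⟨rfl, rfl⟩⟩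
    · exact ⟨x, hxy.symm, Or.inr ⟨rfl, rfl⟩⟩
  · rintro ⟨w, hvw, ⟨rfl, rfl⟩ | ⟨rfl, rfl⟩⟩
    · exact ⟨hvw, Or.inl rfl⟩
    · exact ⟨hvw.symm, Or.inr rfl⟩

lemma sum_incidenceFinset {V : Type*} [Fintype V] [DecidableEq V] (G : SimpleGraph V)
    [DecidableRel G.Adj] (v : V) (f : Sym2 V → ℝ) :
    ∑ e ∈ G.incidenceFinset v, f e = ∑ w, G.adjMatrix ℝ v w * f s(v, w) := by
  rw [incidenceFinset_eq_image, Finset.sum_image fun x _ y _ hxy => Sym2.congr_right.1 hxy,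
    SimpleGraph.neighborFinset_eq_filter, Finset.sum_filter]
  simp only [SimpleGraph.adjMatrix_apply, ite_mul, one_mul, zero_mul]

open Classical in
lemma sum_edgeFinset_flip_sub (G : SimpleGraph (Fin n)) (v : Fin n) (σ : Config n) :
    ∑ e ∈ G.edgeFinset, (e.map (spin (flip v σ))).mul - ∑ e ∈ G.edgeFinset, (e.map (spin σ)).mul =
      -2 * spin σ v * ∑ w, adj G v w * spin σ w := by
  rw [← Finset.sum_sub_distrib, ← Finset.sum_subset (G.incidenceFinset_subset v),
    sum_incidenceFinset, Finset.mul_sum]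
  · refine Finset.sum_congr rfl fun w _ => ?_
    rcases eq_or_ne w v with rfl | hw
    · simp
    · simp only [Sym2.map_mk, Sym2.mul_mk, spin_flip_self, spin_flip_of_ne hw]
      ring
  · intro e he not_incident
    induction e with | _ x y => ?_
    rw [SimpleGraph.mem_incidenceFinset, SimpleGraph.mk'_mem_incidenceSet_iff, not_and_or,
      not_or] at not_incident
    have hxy : G.Adj x y := by simpa using he
    obtain ⟨hx, hy⟩ := not_incident.resolve_left (not_not_intro hxy)
    simp only [Sym2.map_mk, Sym2.mul_mk, spin_flip_of_ne (Ne.symm hx),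
      spin_flip_of_ne (Ne.symm hy), sub_self]

lemma hamiltonian_flip_sub (G : SimpleGraph (Fin n)) (h : ℝ) (v : Fin n) (σ : Config n) :
    hamiltonian G h (flip v σ) - hamiltonian G h σ = 2 * spin σ v * localField G h σ v := by
  rw [hamiltonian, hamiltonian, localField]
  linear_combination -(1 / (n : ℝ)) * sum_edgeFinset_flip_sub G v σ - h * sum_spin_flip_sub v σ

lemma rate_flip (G : SimpleGraph (Fin n)) (β h : ℝ) (v : Fin n) (σ : Config n) :
    rate G β h σ (flip v σ) = flipRate G β h v σ := by
  rw [rate, if_pos ((l1dist_eq_two_iff _ _).2 ⟨v, rfl⟩), hamiltonian_flip_sub, flipRate]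

lemma sum_rate_mul (G : SimpleGraph (Fin n)) (β h : ℝ) (σ : Config n) (g : Config n → ℝ) :
    ∑ η, rate G β h σ η * g η = ∑ v, flipRate G β h v σ * g (flip v σ) := by
  classical
  simp_rw [← rate_flip]
  rw [← Finset.sum_image (s := Finset.univ) (f := fun η => rate G β h σ η * g η)
    (flip_injective σ).injOn]
  refine (Finset.sum_subset (Finset.subset_univ _) fun η _ hη => ?_).symm
  rw [rate, if_neg, zero_mul]
  rwa [l1dist_eq_two_iff, ← Set.mem_range, ← Set.image_univ, ← Finset.coe_univ,
    ← Finset.coe_image, Finset.mem_coe]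

lemma generator_apply (G : SimpleGraph (Fin n)) (β h : ℝ) (σ η : Config n) :
    generator G β h σ η = rate G β h σ η - if σ = η then ∑ η, rate G β h σ η else 0 := by
  rw [generator, of_apply]
  split_ifs with hση
  · have rate_self : rate G β h σ σ = 0 := if_neg (by simp [l1dist])
    rw [← hση, rate_self, zero_sub]
  · rw [sub_zero]

lemma generator_mulVec (G : SimpleGraph (Fin n)) (β h : ℝ) (f : Config n → ℝ) (σ : Config n) :
    (generator G β h *ᵥ f) σ = ∑ v, flipRate G β h v σ * (f (flip v σ) - f σ) := by
  have total_rate : ∑ η, rate G β h σ η = ∑ v, flipRate G β h v σ := by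
    simpa using sum_rate_mul G β h σ fun _ => 1
  simp only [mulVec, dotProduct, generator_apply, sub_mul, Finset.sum_sub_distrib, sum_rate_mul,
    ite_mul, zero_mul, Finset.sum_ite_eq, Finset.mem_univ, if_true, total_rate, mul_sub,
    Finset.sum_mul]

lemma flipRate_nonneg (G : SimpleGraph (Fin n)) (β h : ℝ) (v : Fin n) (σ : Config n) :
    0 ≤ flipRate G β h v σ := (Real.exp_pos _).le

lemma generator_eq_moveGen (G : SimpleGraph (Fin n)) (β h : ℝ) :
    generator G β h = moveGen (flipRate G β h) flip :=
  ext_of_mulVec_single fun _ => funext fun _ => by rw [generator_mulVec, moveGen_mulVec]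

lemma isQMatrix_generator (G : SimpleGraph (Fin n)) (β h : ℝ) : IsQMatrix (generator G β h) := by
  rw [generator_eq_moveGen]
  exact isQMatrix_moveGen (flipRate_nonneg G β h)

/-- The rate at which both copies flip at `v` simultaneously. -/
def commonRate (G : SimpleGraph (Fin n)) (β h : ℝ) (v : Fin n) (z : Config n × Config n) : ℝ :=
  if z.1 v = z.2 v then min (flipRate G β h v z.1) (flipRate G β h v z.2) else 0

/-- The generator of the coupled dynamics: where the copies agree they flip together at the largest
possible rate, and where they disagree they flip independently. -/
def coupledGen (G : SimpleGraph (Fin n)) (β h : ℝ) :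
    Matrix (Config n × Config n) (Config n × Config n) ℝ :=
  moveGen (commonRate G β h) (fun v z => (flip v z.1, flip v z.2)) +
    moveGen (fun v z => flipRate G β h v z.1 - commonRate G β h v z)
      (fun v z => (flip v z.1, z.2)) +
    moveGen (fun v z => flipRate G β h v z.2 - commonRate G β h v z)
      (fun v z => (z.1, flip v z.2))

lemma commonRate_mem_Icc (G : SimpleGraph (Fin n)) (β h : ℝ) (v : Fin n)
    (z : Config n × Config n) :
    commonRate G β h v z ∈ Set.Icc 0 (min (flipRate G β h v z.1) (flipRate G β h v z.2)) := by
  have nonneg := le_min (flipRate_nonneg G β h v z.1) (flipRate_nonneg G β h v z.2)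
  rw [commonRate]
  split_ifs
  exacts [⟨nonneg, le_rfl⟩, ⟨le_rfl, nonneg⟩]

lemma isQMatrix_coupledGen (G : SimpleGraph (Fin n)) (β h : ℝ) : IsQMatrix (coupledGen G β h) :=
  ((isQMatrix_moveGen fun v z => (commonRate_mem_Icc G β h v z).1).add
    (isQMatrix_moveGen fun v z => sub_nonneg.2
      ((commonRate_mem_Icc G β h v z).2.trans (min_le_left _ _)))).add
    (isQMatrix_moveGen fun v z => sub_nonneg.2
      ((commonRate_mem_Icc G β h v z).2.trans (min_le_right _ _)))

lemma coupledGen_mulVec (G : SimpleGraph (Fin n)) (β h : ℝ) (f : Config n × Config n → ℝ)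
    (z : Config n × Config n) :
    (coupledGen G β h *ᵥ f) z = ∑ v,
      (commonRate G β h v z * (f (flip v z.1, flip v z.2) - f z) +
        (flipRate G β h v z.1 - commonRate G β h v z) * (f (flip v z.1, z.2) - f z) +
        (flipRate G β h v z.2 - commonRate G β h v z) * (f (z.1, flip v z.2) - f z)) := by
  simp only [coupledGen, add_mulVec, Pi.add_apply, moveGen_mulVec, Finset.sum_add_distrib]

lemma coupledGen_mulVec_comp_fst (G : SimpleGraph (Fin n)) (β h : ℝ) (f : Config n → ℝ) :
    coupledGen G β h *ᵥ (f ∘ Prod.fst) = (generator G β h *ᵥ f) ∘ Prod.fst := by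
  funext z
  simp only [coupledGen_mulVec, generator_mulVec, Function.comp_apply, sub_self, mul_zero,
    add_zero, ← add_mul, add_sub_cancel]

lemma coupledGen_mulVec_comp_snd (G : SimpleGraph (Fin n)) (β h : ℝ) (f : Config n → ℝ) :
    coupledGen G β h *ᵥ (f ∘ Prod.snd) = (generator G β h *ᵥ f) ∘ Prod.snd := by
  funext z
  simp only [coupledGen_mulVec, generator_mulVec, Function.comp_apply, sub_self, mul_zero,
    add_zero, ← add_mul, add_sub_cancel]

/-- The number of vertices at which the two copies disagree. -/
def discrepancy (z : Config n × Config n) : ℝ := (disagreement z.1 z.2).card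

lemma discrepancy_nonneg (z : Config n × Config n) : 0 ≤ discrepancy z := Nat.cast_nonneg _

lemma discrepancy_le (z : Config n × Config n) : discrepancy z ≤ n :=
  Nat.cast_le.2 ((Finset.card_le_univ _).trans_eq (Fintype.card_fin n))

lemma discrepancy_comm (σ σ' : Config n) : discrepancy (σ, σ') = discrepancy (σ', σ) := by
  simp only [discrepancy, card_disagreement, ne_comm]

lemma one_le_discrepancy {σ σ' : Config n} (h : σ ≠ σ') : 1 ≤ discrepancy (σ, σ') := by
  obtain ⟨v, hv⟩ := Function.ne_iff.1 h
  exact Nat.one_le_cast.2 (Finset.card_pos.2 ⟨v, by simpa [disagreement] using hv⟩)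

lemma discrepancy_flip_left_sub (v : Fin n) (σ σ' : Config n) :
    discrepancy (flip v σ, σ') - discrepancy (σ, σ') = if σ v = σ' v then 1 else -1 := by
  simp only [discrepancy, card_disagreement]
  rw [← Finset.sum_sub_distrib, Fintype.sum_eq_single v fun w hw => by
    rw [flip_of_ne hw, sub_self], flip_self]
  by_cases h : σ v = σ' v
  · simp [h]
  · simp [Int.units_ne_iff_eq_neg.1 h]

lemma discrepancy_flip_right_sub (v : Fin n) (σ σ' : Config n) :
    discrepancy (σ, flip v σ') - discrepancy (σ, σ') = if σ v = σ' v then 1 else -1 := by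
  rw [discrepancy_comm σ, discrepancy_comm σ, discrepancy_flip_left_sub]
  simp only [eq_comm]

lemma discrepancy_flip_flip (v : Fin n) (σ σ' : Config n) :
    discrepancy (flip v σ, flip v σ') = discrepancy (σ, σ') := by
  simp only [discrepancy, card_disagreement]
  refine Finset.sum_congr rfl fun w _ => ?_
  rcases eq_or_ne w v with rfl | hw
  · simp only [flip_self, ne_eq, neg_inj]
  · rw [flip_of_ne hw, flip_of_ne hw]

lemma coupledGen_mulVec_discrepancy (G : SimpleGraph (Fin n)) (β h : ℝ)
    (z : Config n × Config n) :
    (coupledGen G β h *ᵥ discrepancy) z = ∑ v, if z.1 v = z.2 v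
      then |flipRate G β h v z.1 - flipRate G β h v z.2|
      else -(flipRate G β h v z.1 + flipRate G β h v z.2) := by
  rw [coupledGen_mulVec]
  refine Finset.sum_congr rfl fun v _ => ?_
  obtain ⟨σ, σ'⟩ := z
  simp only [discrepancy_flip_left_sub, discrepancy_flip_right_sub, discrepancy_flip_flip,
    sub_self, mul_zero, zero_add, commonRate]
  split_ifs
  · rw [mul_one, mul_one, ← max_sub_min_eq_abs']
    linear_combination -min_add_max (flipRate G β h v σ) (flipRate G β h v σ')
  · ring

lemma isDynamics_of_isMarkovChain {G : SimpleGraph (Fin n)} {β h : ℝ} {σ : Config n} {Ω : Type}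
    [MeasurableSpace Ω] {μ : MeasureTheory.Measure Ω} {X : ℝ≥0 → Ω → Config n}
    (hX : IsMarkovChain (generator G β h) σ μ X) : IsDynamics G β h σ μ X :=
  ⟨hX.measurable, hX.fdd, hX.right_continuous, hX.left_limits⟩

lemma exists_coupling (G : SimpleGraph (Fin n)) (β h : ℝ) (σ σ' : Config n) :
    ∃ c : Coupling G β h σ σ', ∀ t, c.meanDisagreement t =
      (NormedSpace.exp ((t : ℝ) • coupledGen G β h) *ᵥ discrepancy) (σ, σ') := by
  obtain ⟨Ω, mΩ, μ, X, hμ, hX⟩ := (isQMatrix_coupledGen G β h).exists_isMarkovChain_comp (σ, σ')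
  have first := hX _ Prod.fst _ (coupledGen_mulVec_comp_fst G β h)
  have second := hX _ Prod.snd _ (coupledGen_mulVec_comp_snd G β h)
  have joint := hX _ id (coupledGen G β h) fun _ => rfl
  exact ⟨⟨Ω, mΩ, μ, hμ, fun t ω => (X t ω).1, fun t ω => (X t ω).2,
    isDynamics_of_isMarkovChain first, isDynamics_of_isMarkovChain second⟩,
    fun t => joint.integral_comp t discrepancy⟩

lemma probNe_le_meanDisagreement {G : SimpleGraph (Fin n)} {β h : ℝ} {σ σ' : Config n}
    (c : Coupling G β h σ σ') (t : ℝ≥0) : c.probNe t ≤ c.meanDisagreement t := by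
  let _ := c.mΩ
  have := c.prob
  let _ : MeasurableSpace (Config n) := ⊤
  have : DiscreteMeasurableSpace (Config n) := ⟨fun _ => trivial⟩
  have pair_measurable : Measurable fun ω => (c.X t ω, c.Y t ω) :=
    (measurable_to_countable' (c.dynamics_X.measurable t)).prodMk
      (measurable_to_countable' (c.dynamics_Y.measurable t))
  have discrepancy_measurable : Measurable fun ω => discrepancy (c.X t ω, c.Y t ω) :=
    (Measurable.of_discrete (f := discrepancy)).comp pair_measurable
  have discrepancy_integrable :
      MeasureTheory.Integrable (fun ω => discrepancy (c.X t ω, c.Y t ω)) c.P :=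
    .of_bound discrepancy_measurable.aestronglyMeasurable n (.of_forall fun _ =>
      (Real.norm_of_nonneg (discrepancy_nonneg _)).trans_le (discrepancy_le _))
  have markov := MeasureTheory.mul_meas_ge_le_integral_of_nonneg
    (.of_forall fun ω => discrepancy_nonneg (c.X t ω, c.Y t ω)) discrepancy_integrable 1
  rw [one_mul] at markov
  exact (MeasureTheory.measureReal_mono fun ω => one_le_discrepancy).trans markov

end Dynamics

/-! ### Concentration of the magnetization and of the local fields -/

section AffineDrift

open Matrix FiniteMarkov

variable {n : ℕ}

/-- The Metropolis acceptance probability of a move that changes the energy by `e`. -/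
def metropolis (β e : ℝ) : ℝ := Real.exp (-β * max e 0)

lemma metropolis_le_one {β : ℝ} (hβ : 0 ≤ β) (e : ℝ) : metropolis β e ≤ 1 :=
  Real.exp_le_one_iff.2 (mul_nonpos_of_nonpos_of_nonneg (neg_nonpos.2 hβ) (le_max_right _ _))

lemma abs_exp_neg_sub_exp_neg_le {a b : ℝ} (ha : 0 ≤ a) (hb : 0 ≤ b) :
    |Real.exp (-a) - Real.exp (-b)| ≤ |a - b| := by
  wlog hab : a ≤ b generalizing a b
  · rw [abs_sub_comm, abs_sub_comm a]
    exact this hb ha (le_of_not_ge hab)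
  have exp_le_one : Real.exp (-a) ≤ 1 := Real.exp_le_one_iff.2 (neg_nonpos.2 ha)
  have one_sub_le : 1 - (b - a) ≤ Real.exp (-(b - a)) := Real.one_sub_le_exp_neg _
  have exp_eq : Real.exp (-b) = Real.exp (-a) * Real.exp (-(b - a)) := by
    rw [← Real.exp_add]; ring_nf
  rw [abs_of_nonneg (sub_nonneg.2 (Real.exp_le_exp.2 (neg_le_neg hab))), abs_sub_comm,
    abs_of_nonneg (sub_nonneg.2 hab), exp_eq]
  nlinarith [Real.exp_pos (-a)]

lemma abs_metropolis_sub_le {β : ℝ} (hβ : 0 ≤ β) (e e' : ℝ) :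
    |metropolis β e - metropolis β e'| ≤ β * |e - e'| := by
  rw [metropolis, metropolis, neg_mul, neg_mul]
  refine (abs_exp_neg_sub_exp_neg_le (mul_nonneg hβ (le_max_right e 0))
    (mul_nonneg hβ (le_max_right e' 0))).trans ?_
  rw [← mul_sub, abs_mul, abs_of_nonneg hβ]
  exact mul_le_mul_of_nonneg_left (abs_max_sub_max_le_abs e e' 0) hβ

lemma abs_metropolis_spin_sub_le {β : ℝ} (hβ : 0 ≤ β) (σ : Config n) (v : Fin n) (s s' : ℝ) :
    |metropolis β (2 * spin σ v * s) - metropolis β (2 * spin σ v * s')| ≤ 2 * β * |s - s'| := by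
  refine (abs_metropolis_sub_le hβ _ _).trans_eq ?_
  rw [← mul_sub, abs_mul, abs_mul, abs_spin, abs_two]
  ring

lemma metropolis_of_nonpos (β : ℝ) {e : ℝ} (he : e ≤ 0) : metropolis β e = 1 := by
  rw [metropolis, max_eq_right he, mul_zero, Real.exp_zero]

lemma metropolis_of_nonneg (β : ℝ) {e : ℝ} (he : 0 ≤ e) : metropolis β e = Real.exp (-β * e) := by
  rw [metropolis, max_eq_left he]

lemma metropolis_spin_mul_spin (β : ℝ) {s : ℝ} (hs : s ≤ 0) (σ : Config n) (v : Fin n) :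
    metropolis β (2 * spin σ v * s) * (-2 * spin σ v) =
      -(1 + Real.exp (2 * β * s)) * spin σ v + (Real.exp (2 * β * s) - 1) := by
  rcases spin_cases σ v with ⟨-, h⟩ | ⟨-, h⟩ <;> rw [h]
  · rw [metropolis_of_nonpos β (by linarith)]; ring
  · rw [metropolis_of_nonneg β (by linarith)]; ring_nf

lemma flipRate_le_one {β : ℝ} (hβ : 0 ≤ β) (G : SimpleGraph (Fin n)) (h : ℝ) (v : Fin n)
    (σ : Config n) : flipRate G β h v σ ≤ 1 := metropolis_le_one hβ _

lemma generator_mulVec_le {β : ℝ} (hβ : 0 ≤ β) (G : SimpleGraph (Fin n)) (h : ℝ)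
    {f : Config n → ℝ} (hf : ∀ σ, 0 ≤ f σ) {σ : Config n} {B : ℝ} (hB : 0 ≤ B)
    (hflip : ∀ v, f (flip v σ) ≤ B) : (generator G β h *ᵥ f) σ ≤ n * B := by
  rw [generator_mulVec]
  calc ∑ v, flipRate G β h v σ * (f (flip v σ) - f σ) ≤ ∑ _v : Fin n, B :=
        Finset.sum_le_sum fun v _ => by
          refine (mul_le_mul_of_nonneg_left ?_ (flipRate_nonneg G β h v σ)).trans
            (mul_le_of_le_one_left hB (flipRate_le_one hβ G h v σ))
          linarith [hf σ, hflip v]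
    _ = n * B := by simp

/-- The affine function of the spins with coefficients `a` and constant term `b`. -/
def affine (a : Fin n → ℝ) (b : ℝ) (σ : Config n) : ℝ := ∑ v, a v * spin σ v + b

lemma affine_flip (a : Fin n → ℝ) (b : ℝ) (σ : Config n) (v : Fin n) :
    affine a b (flip v σ) = affine a b σ - 2 * (a v * spin σ v) := by
  have flip_sub : ∑ w, a w * spin (flip v σ) w - ∑ w, a w * spin σ w = -2 * (a v * spin σ v) := by
    rw [← Finset.sum_sub_distrib, Fintype.sum_eq_single v fun w hw => by
      rw [spin_flip_of_ne hw, sub_self], spin_flip_self]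
    ring
  unfold affine
  linarith

lemma abs_mul_spin_le {a : Fin n → ℝ} (ha : ∀ v, |a v| ≤ 1) (σ : Config n) (v : Fin n) :
    |a v * spin σ v| ≤ 1 := by
  rw [abs_mul, abs_spin, mul_one]
  exact ha v

lemma mul_exp_sub_one_le {r y : ℝ} (hr0 : 0 ≤ r) (hr1 : r ≤ 1) (hy : |y| ≤ 1) :
    r * (Real.exp y - 1) ≤ r * y + y ^ 2 := by
  have := (abs_le.1 (Real.abs_exp_sub_one_sub_id_le hy)).2
  nlinarith [sq_nonneg y]

lemma generator_exp_affine_le {β : ℝ} (hβ : 0 ≤ β) (G : SimpleGraph (Fin n)) (h : ℝ)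
    {a : Fin n → ℝ} (ha : ∀ v, |a v| ≤ 1) (b : ℝ) {θ : ℝ} (hθ : θ ∈ Set.Icc 0 (1 / 2))
    (σ : Config n) :
    (generator G β h *ᵥ fun σ => Real.exp (θ * affine a b σ)) σ ≤
      Real.exp (θ * affine a b σ) *
        (θ * ∑ v, flipRate G β h v σ * (-2 * (a v * spin σ v)) + 4 * θ ^ 2 * n) := by
  have summand_le (v : Fin n) : flipRate G β h v σ *
      (Real.exp (θ * affine a b (flip v σ)) - Real.exp (θ * affine a b σ)) ≤
      Real.exp (θ * affine a b σ) *
        (θ * (flipRate G β h v σ * (-2 * (a v * spin σ v))) + 4 * θ ^ 2) := by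
    have spin_le := abs_mul_spin_le ha σ v
    have step_le : |-2 * θ * (a v * spin σ v)| ≤ 1 := by
      rw [abs_mul, abs_mul, abs_of_nonneg hθ.1, abs_neg, abs_two]
      nlinarith [hθ.1, hθ.2, abs_nonneg (a v * spin σ v)]
    have step_sq_le : (-2 * θ * (a v * spin σ v)) ^ 2 ≤ 4 * θ ^ 2 := by
      rw [mul_pow, ← sq_abs (a v * spin σ v)]
      nlinarith [sq_nonneg θ, pow_le_one₀ (n := 2) (abs_nonneg _) spin_le]
    have exp_flip : Real.exp (θ * affine a b (flip v σ)) =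
        Real.exp (θ * affine a b σ) * Real.exp (-2 * θ * (a v * spin σ v)) := by
      rw [affine_flip, ← Real.exp_add]; ring_nf
    have expansion := mul_exp_sub_one_le (flipRate_nonneg G β h v σ)
      (flipRate_le_one hβ G h v σ) step_le
    calc _ = Real.exp (θ * affine a b σ) * (flipRate G β h v σ *
          (Real.exp (-2 * θ * (a v * spin σ v)) - 1)) := by rw [exp_flip]; ring
      _ ≤ _ := mul_le_mul_of_nonneg_left (by linarith) (Real.exp_pos _).le
  rw [generator_mulVec]
  refine (Finset.sum_le_sum fun v _ => summand_le v).trans_eq ?_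
  rw [← Finset.mul_sum, Finset.sum_add_distrib, ← Finset.mul_sum]
  simp [mul_comm]

/-- Replacing the local fields by a constant `s ≤ 0` linearizes the drift of an affine function. -/
lemma sum_flipRate_le {β : ℝ} (hβ : 0 ≤ β) (G : SimpleGraph (Fin n)) (h : ℝ) {a : Fin n → ℝ}
    (ha : ∀ v, |a v| ≤ 1) (σ : Config n) {s : ℝ} (hs : s ≤ 0) :
    ∑ v, flipRate G β h v σ * (-2 * (a v * spin σ v)) ≤
      ∑ v, a v * (-(1 + Real.exp (2 * β * s)) * spin σ v + (Real.exp (2 * β * s) - 1)) +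
        4 * β * ∑ v, |localField G h σ v - s| := by
  rw [Finset.mul_sum, ← Finset.sum_add_distrib]
  refine Finset.sum_le_sum fun v _ => ?_
  rw [← metropolis_spin_mul_spin β hs]
  have replace_field : (flipRate G β h v σ - metropolis β (2 * spin σ v * s)) *
      (-2 * (a v * spin σ v)) ≤ 4 * β * |localField G h σ v - s| := by
    refine (le_abs_self _).trans ?_
    rw [abs_mul, abs_mul, abs_neg, abs_two]
    calc _ ≤ (2 * β * |localField G h σ v - s|) * (2 * 1) :=
          mul_le_mul (abs_metropolis_spin_sub_le hβ σ v _ s)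
            (mul_le_mul_of_nonneg_left (abs_mul_spin_le ha σ v) zero_le_two) (by positivity)
            (by positivity)
      _ = 4 * β * |localField G h σ v - s| := by ring
  linarith

/-- The magnetization, the average of the spins (`0` if there are no vertices). -/
def mag (σ : Config n) : ℝ := 1 / n * ∑ v, spin σ v

lemma sum_spin (hn : 0 < n) (σ : Config n) : ∑ v, spin σ v = n * mag σ := by
  have : (n : ℝ) ≠ 0 := (Nat.cast_pos.2 hn).ne'
  rw [mag]; field_simp

/-- Closeness of `G` to the constant graph `p`, up to `δ`, in the degrees and in the cut norm, the
cut norm being tested against configurations. -/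
structure Quasirandom (G : SimpleGraph (Fin n)) (p δ : ℝ) : Prop where
  degree : ∀ w, |∑ v, adj G w v - p * n| ≤ δ * n
  cut : ∀ σ : Config n, ∑ v, |∑ w, (adj G v w - p) * spin σ w| ≤ δ * (n : ℝ) ^ 2

namespace Quasirandom

variable {G : SimpleGraph (Fin n)} {p δ δ' : ℝ}

lemma mono (hG : Quasirandom G p δ) (hδ : δ ≤ δ') : Quasirandom G p δ' where
  degree w := (hG.degree w).trans (by gcongr)
  cut σ := (hG.cut σ).trans (by gcongr)

lemma sum_abs_localField_sub_le (hG : Quasirandom G p δ) (hn : 0 < n) (h : ℝ) (σ : Config n)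
    (s : ℝ) : ∑ v, |localField G h σ v - s| ≤ n * (δ + |p * mag σ + h - s|) := by
  have : (n : ℝ) ≠ 0 := (Nat.cast_pos.2 hn).ne'
  have localField_sub (v : Fin n) : localField G h σ v - s =
      1 / n * ∑ w, (adj G v w - p) * spin σ w + (p * mag σ + h - s) := by
    simp only [sub_mul, Finset.sum_sub_distrib, ← Finset.mul_sum, localField, mag]
    ring
  calc ∑ v, |localField G h σ v - s|
      ≤ ∑ v, (1 / n * |∑ w, (adj G v w - p) * spin σ w| + |p * mag σ + h - s|) := by
        refine Finset.sum_le_sum fun v _ => ?_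
        rw [localField_sub v]
        refine (abs_add_le _ _).trans ?_
        rw [abs_mul, abs_of_nonneg (by positivity : (0 : ℝ) ≤ 1 / n)]
    _ = 1 / n * ∑ v, |∑ w, (adj G v w - p) * spin σ w| + n * |p * mag σ + h - s| := by
        rw [Finset.sum_add_distrib, ← Finset.mul_sum]; simp
    _ ≤ 1 / n * (δ * (n : ℝ) ^ 2) + n * |p * mag σ + h - s| := by
        gcongr
        exact hG.cut σ
    _ = n * (δ + |p * mag σ + h - s|) := by field_simp

lemma sum_flipRate_le {β h : ℝ} (hG : Quasirandom G p δ) (hn : 0 < n) (hβ : 0 ≤ β)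
    {a : Fin n → ℝ} (ha : ∀ v, |a v| ≤ 1) (σ : Config n) {s : ℝ} (hs : s ≤ 0) :
    ∑ v, flipRate G β h v σ * (-2 * (a v * spin σ v)) ≤
      ∑ v, a v * (-(1 + Real.exp (2 * β * s)) * spin σ v + (Real.exp (2 * β * s) - 1)) +
        n * (4 * β * (δ + |p * mag σ + h - s|)) := by
  refine (ERGlauber.sum_flipRate_le hβ G h ha σ hs).trans ?_
  rw [mul_left_comm]
  gcongr
  exact hG.sum_abs_localField_sub_le hn h σ s

end Quasirandom

end AffineDrift

section Concentration

open Matrix FiniteMarkov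

variable {n : ℕ} {G : SimpleGraph (Fin n)} {p β h m δ ε c lam e : ℝ}

/-- The mean-field drift: the infinitesimal expected change of the magnetization `x` when every
vertex feels the field `p x + h`, supposed to be nonpositive. -/
def meanDrift (p β h x : ℝ) : ℝ := (1 - x) * Real.exp (2 * β * (p * x + h)) - (1 + x)

lemma affine_const (hn : 0 < n) (e m : ℝ) (σ : Config n) :
    affine (fun _ => e) (-(e * n * m)) σ = n * (e * (mag σ - m)) := by
  rw [affine, ← Finset.mul_sum, sum_spin hn]; ring

lemma mag_flip_le (hn : 0 < n) (he : |e| ≤ 1) (m : ℝ) (v : Fin n) (σ : Config n) :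
    n * (e * (mag (flip v σ) - m)) ≤ n * (e * (mag σ - m)) + 2 := by
  rw [← affine_const hn, ← affine_const hn, affine_flip]
  linarith [(abs_le.1 (abs_mul_spin_le (fun _ => he) σ v)).1]

lemma Quasirandom.generator_exp_mag_le (hG : Quasirandom G p δ) (hn : 0 < n) (hβ : 0 ≤ β)
    (he : |e| ≤ 1) (hlam : lam ∈ Set.Icc 0 (1 / 2)) (m : ℝ) {σ : Config n}
    (hs : p * mag σ + h ≤ 0) :
    (generator G β h *ᵥ fun σ => Real.exp (lam * (n * (e * (mag σ - m))))) σ ≤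
      Real.exp (lam * (n * (e * (mag σ - m)))) *
        (lam * n * (e * meanDrift p β h (mag σ) + (4 * β * δ + 4 * lam))) := by
  have spin_drift := hG.sum_flipRate_le (h := h) hn hβ (a := fun _ => e)
    (fun _ => he) σ hs
  rw [sub_self, abs_zero, add_zero] at spin_drift
  have mean_eq : ∑ v, e * (-(1 + Real.exp (2 * β * (p * mag σ + h))) * spin σ v +
      (Real.exp (2 * β * (p * mag σ + h)) - 1)) = n * (e * meanDrift p β h (mag σ)) := by
    rw [← Finset.mul_sum, Finset.sum_add_distrib, ← Finset.mul_sum, sum_spin hn, meanDrift]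
    simp only [Finset.sum_const, Finset.card_univ, Fintype.card_fin, nsmul_eq_mul]
    ring
  rw [mean_eq] at spin_drift
  have exp_drift := generator_exp_affine_le hβ G h (a := fun _ => e) (fun _ => he)
    (-(e * n * m)) hlam σ
  simp only [affine_const hn] at exp_drift
  refine exp_drift.trans (mul_le_mul_of_nonneg_left ?_ (Real.exp_pos _).le)
  linarith [mul_le_mul_of_nonneg_left spin_drift hlam.1]

/-- Below half the height the cap is not felt and the bound is crude, between half and full height
the drift points inwards, and above the capped function is maximal. -/
lemma Quasirandom.generator_exp_capped_mag_le (hG : Quasirandom G p δ) (hn : 0 < n) (hβ : 0 ≤ β)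
    (he : |e| ≤ 1) (hlam : lam ∈ Set.Icc 0 (1 / 2))
    (hneg : ∀ x, e * (x - m) ∈ Set.Icc (ε / 2) ε → p * x + h ≤ 0)
    (hdrift : ∀ x, e * (x - m) ∈ Set.Icc (ε / 2) ε → e * meanDrift p β h x ≤ -c)
    (hc : 4 * β * δ + 4 * lam ≤ c) (σ : Config n) :
    (generator G β h *ᵥ fun σ => Real.exp (lam * (n * min (e * (mag σ - m)) ε))) σ ≤
      n * (3 * Real.exp (n * lam * ε / 2)) := by
  have hQ := isQMatrix_generator G β h
  have bound_nonneg : 0 ≤ 3 * Real.exp (n * lam * ε / 2) := by positivity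
  have hlam0 := hlam.1
  rcases le_or_gt ε (e * (mag σ - m)) with above | below
  · refine (hQ.mulVec_le_mulVec_of_le_of_eq (g := fun _ => Real.exp (lam * (n * ε)))
      (fun τ => ?_) ?_).trans ?_
    · dsimp only
      gcongr
      exact min_le_right _ _
    · rw [min_eq_right above]
    · rw [hQ.mulVec_const]
      exact mul_nonneg n.cast_nonneg bound_nonneg
  rcases le_or_gt (ε / 2) (e * (mag σ - m)) with half_le | lt_half
  · have shell : e * (mag σ - m) ∈ Set.Icc (ε / 2) ε := ⟨half_le, below.le⟩
    refine (hQ.mulVec_le_mulVec_of_le_of_eq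
      (g := fun σ => Real.exp (lam * (n * (e * (mag σ - m))))) (fun τ => ?_) ?_).trans
      ((hG.generator_exp_mag_le hn hβ he hlam m (hneg _ shell)).trans ?_)
    · dsimp only
      gcongr
      exact min_le_left _ _
    · rw [min_eq_left below.le]
    · refine le_trans (mul_nonpos_of_nonneg_of_nonpos (Real.exp_pos _).le
        (mul_nonpos_of_nonneg_of_nonpos (by positivity) ?_)) (mul_nonneg n.cast_nonneg bound_nonneg)
      linarith [hdrift _ shell]
  · refine generator_mulVec_le hβ G h (fun _ => (Real.exp_pos _).le) bound_nonneg fun v => ?_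
    have exponent_le : lam * (n * min (e * (mag (flip v σ) - m)) ε) ≤
        1 + n * lam * ε / 2 := by
      have half_height : (n : ℝ) * (e * (mag σ - m)) ≤ n * (ε / 2) := by gcongr
      have capped_le : n * min (e * (mag (flip v σ) - m)) ε ≤ n * (ε / 2) + 2 :=
        (mul_le_mul_of_nonneg_left (min_le_left _ _) n.cast_nonneg).trans
          ((mag_flip_le hn he m v σ).trans (by linarith))
      linarith [mul_le_mul_of_nonneg_left capped_le hlam0, hlam.2]
    refine (Real.exp_le_exp.2 exponent_le).trans ?_
    rw [Real.exp_add]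
    exact mul_le_mul_of_nonneg_right Real.exp_one_lt_three.le (Real.exp_pos _).le

lemma Quasirandom.mag_tail (hG : Quasirandom G p δ) (hn : 0 < n) (hβ : 0 ≤ β)
    (he : |e| ≤ 1) (hlam : lam ∈ Set.Icc 0 (1 / 2))
    (hneg : ∀ x, e * (x - m) ∈ Set.Icc (ε / 2) ε → p * x + h ≤ 0)
    (hdrift : ∀ x, e * (x - m) ∈ Set.Icc (ε / 2) ε → e * meanDrift p β h x ≤ -c)
    (hc : 4 * β * δ + 4 * lam ≤ c) {σ₀ : Config n} (h0 : e * (mag σ₀ - m) ≤ ε / 2)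
    {t : ℝ} (ht : 0 ≤ t) :
    (NormedSpace.exp (t • generator G β h) *ᵥ {σ | ε ≤ e * (mag σ - m)}.indicator 1) σ₀ ≤
      (1 + 3 * n * t) * Real.exp (-(n * lam * ε / 2)) := by
  have hQ := isQMatrix_generator G β h
  have hlam0 := hlam.1
  have initial_le : Real.exp (lam * (n * min (e * (mag σ₀ - m)) ε)) ≤
      Real.exp (n * lam * ε / 2) := by
    have : lam * (n * min (e * (mag σ₀ - m)) ε) ≤ lam * (n * (ε / 2)) := by
      gcongr
      exact (min_le_left _ _).trans h0
    exact Real.exp_le_exp.2 (by linarith)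
  calc _ ≤ Real.exp (-(lam * (n * ε))) * (NormedSpace.exp (t • generator G β h) *ᵥ
        fun σ => Real.exp (lam * (n * min (e * (mag σ - m)) ε))) σ₀ :=
        hQ.exp_mulVec_indicator_le_exp_neg_mul ht (fun σ hσ => by rw [min_eq_right hσ]) σ₀
    _ ≤ Real.exp (-(lam * (n * ε))) * (Real.exp (n * lam * ε / 2) +
        n * (3 * Real.exp (n * lam * ε / 2)) * t) := by
        refine mul_le_mul_of_nonneg_left ?_ (Real.exp_pos _).le
        exact (hQ.exp_mulVec_le_add ht (hG.generator_exp_capped_mag_le hn hβ he hlam hneg hdrift hc)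
          σ₀).trans (by gcongr)
    _ = (1 + 3 * n * t) * (Real.exp (-(lam * (n * ε))) * Real.exp (n * lam * ε / 2)) := by ring
    _ = _ := by rw [← Real.exp_add]; ring_nf

/-- The sum of `spin - m` over the neighbours of `w`, divided by `n`. -/
def localDev (G : SimpleGraph (Fin n)) (m : ℝ) (w : Fin n) (σ : Config n) : ℝ :=
  1 / n * ∑ v, adj G w v * (spin σ v - m)

lemma adj_nonneg (G : SimpleGraph (Fin n)) (v w : Fin n) : 0 ≤ adj G v w := by
  rw [adj, SimpleGraph.adjMatrix_apply]; split_ifs <;> norm_num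

lemma adj_le_one (G : SimpleGraph (Fin n)) (v w : Fin n) : adj G v w ≤ 1 := by
  rw [adj, SimpleGraph.adjMatrix_apply]; split_ifs <;> norm_num

lemma abs_localDev_le (G : SimpleGraph (Fin n)) (hm : |m| ≤ 1) (w : Fin n) (σ : Config n) :
    |localDev G m w σ| ≤ 2 := by
  have hn : (0 : ℝ) < n := Nat.cast_pos.2 w.pos
  have summand_le (v : Fin n) : |adj G w v * (spin σ v - m)| ≤ 2 := by
    rw [abs_mul, abs_of_nonneg (adj_nonneg G w v)]
    refine (mul_le_of_le_one_left (abs_nonneg _) (adj_le_one G w v)).trans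
      ((abs_sub _ _).trans ?_)
    rw [abs_spin]
    linarith
  rw [localDev, abs_mul, abs_of_pos (one_div_pos.2 hn), one_div_mul_eq_div, div_le_iff₀ hn]
  refine (Finset.abs_sum_le_sum_abs _ _).trans
    ((Finset.sum_le_sum fun v _ => summand_le v).trans_eq ?_)
  simp [mul_comm]

lemma affine_adj (G : SimpleGraph (Fin n)) (e m γ : ℝ) (w : Fin n) (σ : Config n) :
    affine (fun v => e * adj G w v) (-(∑ v, e * adj G w v * m) - n * γ) σ =
      n * (e * localDev G m w σ - γ) := by
  have hn : (n : ℝ) ≠ 0 := (Nat.cast_pos.2 w.pos).ne'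
  have : n * (e * localDev G m w σ - γ) = e * ∑ v, adj G w v * (spin σ v - m) - n * γ := by
    rw [localDev]; field_simp
  rw [this, affine, Finset.mul_sum, ← add_sub_assoc, ← sub_eq_add_neg, ← Finset.sum_sub_distrib]
  congr 1
  exact Finset.sum_congr rfl fun v _ => by ring

lemma abs_mul_adj_le (G : SimpleGraph (Fin n)) (he : |e| ≤ 1) (w v : Fin n) :
    |e * adj G w v| ≤ 1 := by
  rw [abs_mul, abs_of_nonneg (adj_nonneg G w v)]
  exact mul_le_one₀ he (adj_nonneg G w v) (adj_le_one G w v)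

lemma Quasirandom.sum_flipRate_adj_le (hG : Quasirandom G p δ) (hp : p ∈ Set.Icc (0 : ℝ) 1)
    (hβ : 0 ≤ β) (he : |e| ≤ 1) (hs : p * m + h ≤ 0) (hfix : meanDrift p β h m = 0)
    (w : Fin n) {σ : Config n} (hσ : |mag σ - m| ≤ ε) :
    ∑ v, flipRate G β h v σ * (-2 * (e * adj G w v * spin σ v)) ≤
      n * (-(1 + Real.exp (2 * β * (p * m + h))) * (e * localDev G m w σ) +
        4 * β * (δ + ε)) := by
  have hn : (n : ℝ) ≠ 0 := (Nat.cast_pos.2 w.pos).ne'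
  have field_close : |p * mag σ + h - (p * m + h)| ≤ ε := by
    rw [add_sub_add_right_eq_sub, ← mul_sub, abs_mul, abs_of_nonneg hp.1]
    exact (mul_le_of_le_one_left (abs_nonneg _) hp.2).trans hσ
  have mean_reversion : ∑ v, e * adj G w v *
      (-(1 + Real.exp (2 * β * (p * m + h))) * spin σ v + (Real.exp (2 * β * (p * m + h)) - 1)) =
      n * (-(1 + Real.exp (2 * β * (p * m + h))) * (e * localDev G m w σ)) := by
    have fixed : Real.exp (2 * β * (p * m + h)) - 1 = (1 + Real.exp (2 * β * (p * m + h))) * m := by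
      rw [meanDrift] at hfix
      linarith
    rw [localDev, fixed]
    field_simp
    rw [Finset.mul_sum, ← Finset.sum_neg_distrib]
    exact Finset.sum_congr rfl fun v _ => by ring
  refine (hG.sum_flipRate_le w.pos hβ (abs_mul_adj_le G he w) σ hs).trans ?_
  rw [mean_reversion, ← mul_add]
  gcongr

lemma Quasirandom.generator_exp_localDev_le (hG : Quasirandom G p δ) (hp : p ∈ Set.Icc (0 : ℝ) 1)
    (hβ : 0 ≤ β) (he : |e| ≤ 1) (hs : p * m + h ≤ 0) (hfix : meanDrift p β h m = 0)
    {θ γ : ℝ} (hθ : θ ∈ Set.Icc 0 (1 / 2)) (hγ0 : 0 ≤ γ)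
    (hγ : 4 * β * (δ + ε) + 4 * θ ≤ γ) (w : Fin n) {σ : Config n} (hσ : |mag σ - m| ≤ ε) :
    (generator G β h *ᵥ fun σ => Real.exp (θ * (n * (e * localDev G m w σ - γ)))) σ +
      (1 + Real.exp (2 * β * (p * m + h))) * θ * (n * (e * localDev G m w σ - γ)) *
        Real.exp (θ * (n * (e * localDev G m w σ - γ))) ≤ 0 := by
  have exp_drift := generator_exp_affine_le hβ G h (abs_mul_adj_le G he w)
    (-(∑ v, e * adj G w v * m) - n * γ) hθ σ
  simp only [affine_adj] at exp_drift
  have spin_drift := mul_le_mul_of_nonneg_left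
    (hG.sum_flipRate_adj_le hp hβ he hs hfix w hσ) hθ.1
  have error_le : 4 * β * (δ + ε) + 4 * θ ≤ (1 + Real.exp (2 * β * (p * m + h))) * γ :=
    hγ.trans (le_mul_of_one_le_left hγ0 (le_add_of_nonneg_right (Real.exp_pos _).le))
  have total_le : θ * ∑ v, flipRate G β h v σ * (-2 * (e * adj G w v * spin σ v)) +
      4 * θ ^ 2 * n ≤
      -((1 + Real.exp (2 * β * (p * m + h))) * θ * (n * (e * localDev G m w σ - γ))) := by
    linarith [mul_le_mul_of_nonneg_left error_le (mul_nonneg hθ.1 n.cast_nonneg)]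
  linarith [mul_le_mul_of_nonneg_left total_le
    (Real.exp_pos (θ * (n * (e * localDev G m w σ - γ)))).le]

lemma mul_localDev_sub_le (G : SimpleGraph (Fin n)) (hm : |m| ≤ 1) (he : |e| ≤ 1) {γ : ℝ}
    (hγ : 0 ≤ γ) (w : Fin n) (σ : Config n) : n * (e * localDev G m w σ - γ) ≤ 2 * n := by
  have : e * localDev G m w σ ≤ 2 := by
    refine (le_abs_self _).trans ?_
    rw [abs_mul]
    exact (mul_le_of_le_one_left (abs_nonneg _) he).trans (abs_localDev_le G hm w σ)
  rw [mul_comm 2]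
  exact mul_le_mul_of_nonneg_left (by linarith) n.cast_nonneg

/-- What remains true on the event, of small probability, that the magnetization is not near `m`. -/
lemma generator_exp_localDev_le_crude (hβ : 0 ≤ β) (hm : |m| ≤ 1) (he : |e| ≤ 1) {θ θ₀ γ a : ℝ}
    (hθ : θ ∈ Set.Icc 0 θ₀) (hγ : 0 ≤ γ) (ha : 0 ≤ a) (haθ : a * θ₀ ≤ 1) (w : Fin n)
    (σ : Config n) :
    (generator G β h *ᵥ fun σ => Real.exp (θ * (n * (e * localDev G m w σ - γ)))) σ +
      a * θ * (n * (e * localDev G m w σ - γ)) *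
        Real.exp (θ * (n * (e * localDev G m w σ - γ))) ≤
      3 * n * Real.exp (2 * n * θ₀) := by
  have exp_le (τ : Config n) :
      Real.exp (θ * (n * (e * localDev G m w τ - γ))) ≤ Real.exp (2 * n * θ₀) := by
    refine Real.exp_le_exp.2 ?_
    calc _ ≤ θ * (2 * n) := mul_le_mul_of_nonneg_left (mul_localDev_sub_le G hm he hγ w τ) hθ.1
      _ ≤ 2 * n * θ₀ := by rw [mul_comm]; exact mul_le_mul_of_nonneg_left hθ.2 (by positivity)
  have generator_le := generator_mulVec_le hβ G h (σ := σ)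
    (fun τ => (Real.exp_pos (θ * (n * (e * localDev G m w τ - γ)))).le)
    (Real.exp_pos (2 * n * θ₀)).le fun v => exp_le (flip v σ)
  have aθ_le : a * θ ≤ 1 := (mul_le_mul_of_nonneg_left hθ.2 ha).trans haθ
  have linear_le : a * θ * (n * (e * localDev G m w σ - γ)) ≤ 2 * n :=
    (mul_le_mul_of_nonneg_left (mul_localDev_sub_le G hm he hγ w σ) (mul_nonneg ha hθ.1)).trans
      (mul_le_of_le_one_left (by positivity) aθ_le)
  have tilt_le : a * θ * (n * (e * localDev G m w σ - γ)) *
      Real.exp (θ * (n * (e * localDev G m w σ - γ))) ≤ 2 * n * Real.exp (2 * n * θ₀) :=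
    mul_le_mul linear_le (exp_le σ) (Real.exp_pos _).le (by positivity)
  linarith

lemma Quasirandom.exp_localDev_le (hG : Quasirandom G p δ) (hp : p ∈ Set.Icc (0 : ℝ) 1)
    (hβ : 0 ≤ β) (hm : |m| ≤ 1) (he : |e| ≤ 1) (hs : p * m + h ≤ 0)
    (hfix : meanDrift p β h m = 0) {θ₀ γ η t₁ : ℝ} (hθ₀ : θ₀ ∈ Set.Icc 0 (1 / 2)) (hγ0 : 0 ≤ γ)
    (hγ : 4 * β * (δ + ε) + 4 * θ₀ ≤ γ) (ht₁ : 0 ≤ t₁) (w : Fin n) {σ₀ : Config n}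
    (hη : ∀ t ∈ Set.Icc 0 t₁,
      (NormedSpace.exp (t • generator G β h) *ᵥ {σ | ε ≤ |mag σ - m|}.indicator 1) σ₀ ≤ η) :
    (NormedSpace.exp (t₁ • generator G β h) *ᵥ
        fun σ => Real.exp (θ₀ * (n * (e * localDev G m w σ - γ)))) σ₀ ≤
      Real.exp (2 * n * θ₀ * Real.exp (-t₁)) + 3 * n * Real.exp (2 * n * θ₀) * η * t₁ := by
  set r : ℝ := Real.exp (2 * β * (p * m + h))
  have r_pos : 0 < r := Real.exp_pos _
  have r_le_one : r ≤ 1 :=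
    Real.exp_le_one_iff.2 (mul_nonpos_of_nonneg_of_nonpos (by positivity) hs)
  have tilted := (isQMatrix_generator G β h).exp_mulVec_exp_mul_le (a := 1 + r) (z := σ₀)
    (U := fun σ => n * (e * localDev G m w σ - γ)) (K := 3 * n * Real.exp (2 * n * θ₀))
    hθ₀.1 (by positivity) (by positivity) ht₁
    (fun θ hθ σ hσ => hG.generator_exp_localDev_le hp hβ he hs hfix
      ⟨hθ.1, hθ.2.trans hθ₀.2⟩ hγ0 (by linarith [hθ.2]) w (not_le.1 hσ).le)
    (fun θ hθ σ _ => generator_exp_localDev_le_crude hβ hm he hθ hγ0 (by positivity)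
      (by nlinarith [hθ₀.1, hθ₀.2]) w σ) hη
  refine tilted.trans (add_le_add_left (Real.exp_le_exp.2 ?_) _)
  calc θ₀ * Real.exp (-((1 + r) * t₁)) * (n * (e * localDev G m w σ₀ - γ))
      ≤ θ₀ * Real.exp (-t₁) * (2 * n) := by
        have decay_le : Real.exp (-((1 + r) * t₁)) ≤ Real.exp (-t₁) :=
          Real.exp_le_exp.2 (by nlinarith)
        exact (mul_le_mul_of_nonneg_left (mul_localDev_sub_le G hm he hγ0 w σ₀)
          (mul_nonneg hθ₀.1 (Real.exp_pos _).le)).trans (mul_le_mul_of_nonneg_right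
            (mul_le_mul_of_nonneg_left decay_le hθ₀.1) (by positivity))
    _ = 2 * n * θ₀ * Real.exp (-t₁) := by ring

end Concentration

/-! ### Contraction of the disagreement set -/

section Contraction

open Matrix FiniteMarkov

variable {n : ℕ} {p β h m : ℝ}

section Influence

variable (G : SimpleGraph (Fin n)) (h : ℝ) (z : Config n × Config n)

/-- The largest change of the local field at `v` that the disagreement set of `z` can cause. -/
def influence (v : Fin n) : ℝ := 2 / n * ∑ w, adj G w v * if z.1 w ≠ z.2 w then 1 else 0

lemma influence_nonneg (v : Fin n) : 0 ≤ influence G z v :=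
  mul_nonneg (by positivity) (Finset.sum_nonneg fun w _ =>
    mul_nonneg (adj_nonneg G w v) (by split_ifs <;> norm_num))

lemma abs_localField_sub_localField_le (v : Fin n) :
    |localField G h z.1 v - localField G h z.2 v| ≤ influence G z v := by
  have adj_comm (w : Fin n) : adj G v w = adj G w v := by
    rw [adj, SimpleGraph.adjMatrix_apply, SimpleGraph.adjMatrix_apply, G.adj_comm]
  have sub_eq : localField G h z.1 v - localField G h z.2 v =
      1 / n * ∑ w, adj G w v * (spin z.1 w - spin z.2 w) := by
    simp only [localField, mul_sub, Finset.sum_sub_distrib, adj_comm]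
    ring
  rw [sub_eq, abs_mul, abs_of_nonneg (by positivity : (0 : ℝ) ≤ 1 / n)]
  refine (mul_le_mul_of_nonneg_left (Finset.abs_sum_le_sum_abs _ _) (by positivity)).trans_eq ?_
  rw [influence, Finset.mul_sum, Finset.mul_sum]
  refine Finset.sum_congr rfl fun w _ => ?_
  rw [abs_mul, abs_of_nonneg (adj_nonneg G w v), abs_spin_sub]
  split_ifs <;> ring

lemma sum_mul_influence_le {x : Fin n → ℝ} {B : ℝ} (hB : ∀ w, 2 / n * ∑ v, adj G w v * x v ≤ B) :
    ∑ v, x v * influence G z v ≤ B * discrepancy z := by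
  have double_count : ∑ v, x v * influence G z v =
      ∑ w, (2 / n * ∑ v, adj G w v * x v) * if z.1 w ≠ z.2 w then 1 else 0 := by
    simp only [influence, Finset.mul_sum, Finset.sum_mul]
    rw [Finset.sum_comm]
    exact Finset.sum_congr rfl fun w _ => Finset.sum_congr rfl fun v _ => by ring
  rw [double_count, discrepancy, card_disagreement, Finset.mul_sum]
  refine Finset.sum_le_sum fun w _ => mul_le_mul_of_nonneg_right (hB w) ?_
  split_ifs <;> norm_num

lemma coupledGen_mulVec_discrepancy_le (hβ : 0 ≤ β) :
    (coupledGen G β h *ᵥ discrepancy) z ≤ 4 * β * discrepancy z := by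
  have weight_le (w : Fin n) : 2 / (n : ℝ) * ∑ v, adj G w v * (2 * β) ≤ 4 * β := by
    have : (0 : ℝ) < n := Nat.cast_pos.2 w.pos
    calc 2 / (n : ℝ) * ∑ v, adj G w v * (2 * β) ≤ 2 / (n : ℝ) * ∑ _v : Fin n, 1 * (2 * β) := by
          gcongr with v
          exact adj_le_one G w v
      _ = 4 * β := by simp; field_simp; ring
  rw [coupledGen_mulVec_discrepancy]
  refine le_trans (Finset.sum_le_sum fun v _ => ?_)
    (sum_mul_influence_le G z (x := fun _ => 2 * β) weight_le)
  split_ifs with agree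
  · have spin_eq : spin z.2 v = spin z.1 v := by rw [spin, spin, agree]
    have rate_sub_le := abs_metropolis_spin_sub_le hβ z.1 v (localField G h z.1 v)
      (localField G h z.2 v)
    nth_rw 2 [← spin_eq] at rate_sub_le
    exact rate_sub_le.trans
      (mul_le_mul_of_nonneg_left (abs_localField_sub_localField_le G h z v) (by positivity))
  · linarith [flipRate_nonneg G β h v z.1, flipRate_nonneg G β h v z.2,
      mul_nonneg (by positivity : 0 ≤ 2 * β) (influence_nonneg G z v)]

end Influence

lemma abs_exp_sub_exp_le {x y M : ℝ} (hx : x ≤ M) (hy : y ≤ M) :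
    |Real.exp x - Real.exp y| ≤ Real.exp M * |x - y| := by
  have factor : Real.exp x - Real.exp y =
      Real.exp M * (Real.exp (-(M - x)) - Real.exp (-(M - y))) := by
    rw [mul_sub, ← Real.exp_add, ← Real.exp_add]; ring_nf
  rw [factor, abs_mul, abs_of_pos (Real.exp_pos M), abs_sub_comm x y]
  refine mul_le_mul_of_nonneg_left ?_ (Real.exp_pos M).le
  simpa only [sub_sub_sub_cancel_left] using
    abs_exp_neg_sub_exp_neg_le (sub_nonneg.2 hx) (sub_nonneg.2 hy)

section Rates

variable {G : SimpleGraph (Fin n)} {z : Config n × Config n} {v : Fin n} {s : ℝ}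

lemma flipRate_of_spin_eq_one {σ : Config n} (hσ : spin σ v = 1) (hf : localField G h σ v ≤ 0) :
    flipRate G β h v σ = 1 := by
  refine metropolis_of_nonpos β ?_
  rw [hσ]; linarith

lemma flipRate_of_spin_eq_neg_one {σ : Config n} (hσ : spin σ v = -1)
    (hf : localField G h σ v ≤ 0) :
    flipRate G β h v σ = Real.exp (2 * β * localField G h σ v) := by
  refine (metropolis_of_nonneg β ?_).trans ?_ <;> rw [hσ]
  · linarith
  · ring_nf

/-- In a negative field only the minus spins react to a change of the field. -/
lemma abs_flipRate_sub_le (hβ : 0 ≤ β) (hz : z.1 v = z.2 v) (hs : s ≤ 0)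
    (h₁ : localField G h z.1 v ≤ s) (h₂ : localField G h z.2 v ≤ s) :
    |flipRate G β h v z.1 - flipRate G β h v z.2| ≤
      2 * β * Real.exp (2 * β * s) * ((1 - spin z.1 v) / 2) * influence G z v := by
  have spin_eq : spin z.2 v = spin z.1 v := by rw [spin, spin, hz]
  rcases spin_cases z.1 v with ⟨-, plus⟩ | ⟨-, minus⟩
  · rw [flipRate_of_spin_eq_one plus (h₁.trans hs),
      flipRate_of_spin_eq_one (spin_eq.trans plus) (h₂.trans hs), plus]
    simp
  · rw [flipRate_of_spin_eq_neg_one minus (h₁.trans hs),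
      flipRate_of_spin_eq_neg_one (spin_eq.trans minus) (h₂.trans hs), minus]
    calc |Real.exp (2 * β * localField G h z.1 v) - Real.exp (2 * β * localField G h z.2 v)|
        ≤ Real.exp (2 * β * s) * |2 * β * localField G h z.1 v - 2 * β * localField G h z.2 v| :=
          abs_exp_sub_exp_le (by gcongr) (by gcongr)
      _ = Real.exp (2 * β * s) * (2 * β * |localField G h z.1 v - localField G h z.2 v|) := by
          rw [← mul_sub, abs_mul, abs_of_nonneg (by positivity : 0 ≤ 2 * β)]
      _ ≤ Real.exp (2 * β * s) * (2 * β * influence G z v) := by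
          gcongr
          exact abs_localField_sub_localField_le G h z v
      _ = _ := by ring

lemma one_add_exp_le_flipRate_add (hβ : 0 ≤ β) (hz : z.1 v ≠ z.2 v)
    (h₁ : localField G h z.1 v ∈ Set.Icc s 0) (h₂ : localField G h z.2 v ∈ Set.Icc s 0) :
    1 + Real.exp (2 * β * s) ≤ flipRate G β h v z.1 + flipRate G β h v z.2 := by
  rcases spin_cases z.1 v with ⟨eq₁, spin₁⟩ | ⟨eq₁, spin₁⟩ <;>
    rcases spin_cases z.2 v with ⟨eq₂, spin₂⟩ | ⟨eq₂, spin₂⟩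
  · exact absurd (eq₁.trans eq₂.symm) hz
  · rw [flipRate_of_spin_eq_one spin₁ h₁.2, flipRate_of_spin_eq_neg_one spin₂ h₂.2]
    gcongr
    exact h₂.1
  · rw [flipRate_of_spin_eq_neg_one spin₁ h₁.2, flipRate_of_spin_eq_one spin₂ h₂.2, add_comm]
    gcongr
    exact h₁.1
  · exact absurd (eq₁.trans eq₂.symm) hz

end Rates

/-- A bound for the exponential growth rate of the expected disagreement when all local fields
differ from `p m + h` by at most `2 ρ`: every disagreement creates others among the neighbouring
minus spins, of which there are nearly `(1 - m) p n / 2`, and disappears when either copy flips. -/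
def discrepancyDrift (p β h m ρ : ℝ) : ℝ :=
  2 * β * Real.exp (2 * β * (p * m + h + 2 * ρ)) * ((1 - m) * (p + ρ) + ρ) -
    (1 + Real.exp (2 * β * (p * m + h - 2 * ρ)))

namespace Quasirandom

variable {G : SimpleGraph (Fin n)} {δ ρ : ℝ}

lemma abs_localField_sub_le (hG : Quasirandom G p δ) (h : ℝ) (hm : |m| ≤ 1) (σ : Config n)
    (v : Fin n) : |localField G h σ v - (p * m + h)| ≤ |localDev G m v σ| + δ := by
  have hn : (0 : ℝ) < n := Nat.cast_pos.2 v.pos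
  have sub_eq : localField G h σ v - (p * m + h) =
      localDev G m v σ + m * (1 / n * (∑ w, adj G v w - p * n)) := by
    simp only [localField, localDev, mul_sub, Finset.sum_sub_distrib, ← Finset.sum_mul]
    field_simp
    ring
  rw [sub_eq]
  refine (abs_add_le _ _).trans (add_le_add le_rfl ?_)
  rw [abs_mul, abs_mul, abs_of_nonneg (by positivity : (0 : ℝ) ≤ 1 / n)]
  calc |m| * (1 / n * |∑ w, adj G v w - p * n|) ≤ 1 * (1 / n * (δ * n)) := by
        gcongr; exact hG.degree v
    _ = δ := by field_simp

lemma sum_adj_mul_minus_le (hG : Quasirandom G p δ) (hm : m ≤ 1) (σ : Config n) (w : Fin n) :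
    2 / n * ∑ v, adj G w v * ((1 - spin σ v) / 2) ≤
      (1 - m) * (p + δ) + |localDev G m w σ| := by
  have hn : (0 : ℝ) < n := Nat.cast_pos.2 w.pos
  have sum_eq : 2 / n * ∑ v, adj G w v * ((1 - spin σ v) / 2) =
      (1 - m) * (1 / n * ∑ v, adj G w v) - localDev G m w σ := by
    rw [localDev, ← mul_assoc, mul_comm (1 - m), mul_assoc, ← mul_sub, Finset.mul_sum _ _ (1 - m),
      ← Finset.sum_sub_distrib, Finset.mul_sum, Finset.mul_sum]
    exact Finset.sum_congr rfl fun v _ => by ring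
  have degree_le : 1 / n * ∑ v, adj G w v ≤ p + δ := by
    rw [one_div, inv_mul_le_iff₀ hn]
    linarith [(abs_le.1 (hG.degree w)).2]
  rw [sum_eq]
  linarith [mul_le_mul_of_nonneg_left degree_le (sub_nonneg.2 hm),
    neg_abs_le (localDev G m w σ)]

lemma coupledGen_mulVec_discrepancy_le (hG : Quasirandom G p ρ) (hβ : 0 ≤ β) (hm : |m| ≤ 1)
    (hneg : p * m + h + 2 * ρ ≤ 0) {z : Config n × Config n}
    (h₁ : ∀ w, |localDev G m w z.1| ≤ ρ) (h₂ : ∀ w, |localDev G m w z.2| ≤ ρ) :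
    (coupledGen G β h *ᵥ discrepancy) z ≤ discrepancyDrift p β h m ρ * discrepancy z := by
  have field_close (v : Fin n) {σ : Config n} (hσ : ∀ w, |localDev G m w σ| ≤ ρ) :
      localField G h σ v ∈ Set.Icc (p * m + h - 2 * ρ) (p * m + h + 2 * ρ) := by
    have := abs_le.1 ((hG.abs_localField_sub_le h hm σ v).trans (add_le_add_left (hσ v) ρ))
    exact ⟨by linarith, by linarith⟩
  set R : ℝ := Real.exp (2 * β * (p * m + h + 2 * ρ))
  set r : ℝ := Real.exp (2 * β * (p * m + h - 2 * ρ))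
  have weight_le (w : Fin n) : 2 / n * ∑ v, adj G w v * (2 * β * R * ((1 - spin z.1 v) / 2)) ≤
      2 * β * R * ((1 - m) * (p + ρ) + ρ) := by
    simp only [mul_left_comm (adj G w _) (2 * β * R)]
    rw [← Finset.mul_sum, mul_left_comm]
    have minus_le := hG.sum_adj_mul_minus_le (abs_le.1 hm).2 z.1 w
    gcongr
    linarith [h₁ w]
  have term_le (v : Fin n) :
      (if z.1 v = z.2 v then |flipRate G β h v z.1 - flipRate G β h v z.2|
        else -(flipRate G β h v z.1 + flipRate G β h v z.2)) ≤
      2 * β * R * ((1 - spin z.1 v) / 2) * influence G z v +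
        -(1 + r) * if z.1 v ≠ z.2 v then 1 else 0 := by
    have f₁ := field_close v h₁
    have f₂ := field_close v h₂
    by_cases agree : z.1 v = z.2 v
    · simpa [agree] using abs_flipRate_sub_le hβ agree hneg f₁.2 f₂.2
    · have spin_le : 0 ≤ (1 - spin z.1 v) / 2 := by
        linarith [(abs_le.1 (abs_spin z.1 v).le).2]
      have := mul_nonneg (by positivity : 0 ≤ 2 * β * R * ((1 - spin z.1 v) / 2))
        (influence_nonneg G z v)
      rw [if_neg agree, if_pos agree]
      linarith [one_add_exp_le_flipRate_add hβ agree ⟨f₁.1, f₁.2.trans hneg⟩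
        ⟨f₂.1, f₂.2.trans hneg⟩]
  rw [coupledGen_mulVec_discrepancy]
  refine (Finset.sum_le_sum fun v _ => term_le v).trans ?_
  rw [Finset.sum_add_distrib, ← Finset.mul_sum, ← card_disagreement, ← discrepancy,
    discrepancyDrift, sub_mul]
  linarith [sum_mul_influence_le G z weight_le]

end Quasirandom

end Contraction

section Well

open Matrix FiniteMarkov

variable {n : ℕ} {p β h m : ℝ}

/-- Constants quantifying that `m` is a stable zero of the mean drift at which the disagreement set
contracts: the graph is `δ`-quasirandom, the magnetization stays within `ε` of `m` and the local
deviations within `ρ` of `0`, and `lam` and `θ` are the tilts of the exponential moments that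
control the last two. -/
structure WellConstants (p β h m : ℝ) where
  δ : ℝ
  ε : ℝ
  lam : ℝ
  θ : ℝ
  ρ : ℝ
  p_mem : p ∈ Set.Icc (0 : ℝ) 1
  β_nonneg : 0 ≤ β
  abs_m_le_one : |m| ≤ 1
  meanDrift_eq_zero : meanDrift p β h m = 0
  δ_pos : 0 < δ
  δ_le_ρ : δ ≤ ρ
  ε_pos : 0 < ε
  lam_mem : lam ∈ Set.Ioc (0 : ℝ) (1 / 2)
  θ_mem : θ ∈ Set.Ioc (0 : ℝ) (1 / 2)
  field_nonpos : ∀ x, |x - m| ≤ ε → p * x + h ≤ 0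
  drift_le : ∀ e : ℝ, |e| = 1 → ∀ x, e * (x - m) ∈ Set.Icc (ε / 2) ε →
    e * meanDrift p β h x ≤ -(4 * β * δ + 4 * lam)
  θ_le : 2 * θ ≤ lam * ε / 2
  error_le : 4 * β * (δ + ε) + 4 * θ ≤ ρ / 2
  field_add_nonpos : p * m + h + 2 * ρ ≤ 0
  discrepancyDrift_neg : discrepancyDrift p β h m ρ < 0

namespace WellConstants

variable (K : WellConstants p β h m) {G : SimpleGraph (Fin n)} {σ₀ : Config n} {t T : ℝ}

/-- The rate at which the disagreement set contracts. -/
def κ : ℝ := -discrepancyDrift p β h m K.ρ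

include K

lemma κ_pos : 0 < K.κ := neg_pos.2 K.discrepancyDrift_neg

lemma ρ_pos : 0 < K.ρ := K.δ_pos.trans_le K.δ_le_ρ

lemma mag_tail (hG : Quasirandom G p K.δ) (hn : 0 < n) (h₀ : |mag σ₀ - m| ≤ K.ε / 2)
    (ht : t ∈ Set.Icc (0 : ℝ) (2 * n)) :
    (NormedSpace.exp (t • generator G β h) *ᵥ {σ | K.ε ≤ |mag σ - m|}.indicator 1) σ₀ ≤
      14 * (n : ℝ) ^ 2 * Real.exp (-(n * K.lam * K.ε / 2)) := by
  have n_ge_one : (1 : ℝ) ≤ n := Nat.one_le_cast.2 hn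
  have one_sided (e : ℝ) (he : |e| = 1) :
      (NormedSpace.exp (t • generator G β h) *ᵥ {σ | K.ε ≤ e * (mag σ - m)}.indicator 1) σ₀ ≤
        7 * (n : ℝ) ^ 2 * Real.exp (-(n * K.lam * K.ε / 2)) := by
    have abs_mul_eq (x : ℝ) : |e * x| = |x| := by rw [abs_mul, he, one_mul]
    refine (hG.mag_tail hn K.β_nonneg he.le (Set.Ioc_subset_Icc_self K.lam_mem)
      (fun x hx => K.field_nonpos x ?_) (K.drift_le e he) le_rfl
      ((le_abs_self _).trans (by rwa [abs_mul_eq])) ht.1).trans ?_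
    · rw [← abs_mul_eq, abs_of_nonneg (by linarith [hx.1, K.ε_pos])]
      exact hx.2
    · gcongr
      nlinarith [ht.2]
  refine ((isQMatrix_generator G β h).exp_mulVec_indicator_abs_le ht.1 one_sided).trans_eq ?_
  ring

lemma exp_localDev_le (hG : Quasirandom G p K.δ) (hn : 0 < n) (h₀ : |mag σ₀ - m| ≤ K.ε / 2)
    (ht : t ∈ Set.Icc (0 : ℝ) (2 * n)) (hT : Real.exp (-t) ≤ K.ρ / 8) {e : ℝ} (he : |e| ≤ 1)
    (w : Fin n) :
    (NormedSpace.exp (t • generator G β h) *ᵥ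
        fun σ => Real.exp (K.θ * (n * (e * localDev G m w σ - K.ρ / 2)))) σ₀ ≤
      85 * (n : ℝ) ^ 4 * Real.exp (n * K.θ * K.ρ / 4) := by
  have n_pos : (0 : ℝ) < n := Nat.cast_pos.2 hn
  have n_ge_one : (1 : ℝ) ≤ n := Nat.one_le_cast.2 hn
  have θ_pos := K.θ_mem.1
  have ρ_pos := K.ρ_pos
  have moment_le := hG.exp_localDev_le K.p_mem K.β_nonneg K.abs_m_le_one he
    (K.field_nonpos m (by simpa using K.ε_pos.le)) K.meanDrift_eq_zero
    (Set.Ioc_subset_Icc_self K.θ_mem) (by linarith) K.error_le ht.1 w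
    fun s hs => K.mag_tail hG hn h₀ ⟨hs.1, hs.2.trans ht.2⟩
  have initial_le : Real.exp (2 * n * K.θ * Real.exp (-t)) ≤ Real.exp (n * K.θ * K.ρ / 4) := by
    refine Real.exp_le_exp.2 ?_
    linarith [mul_le_mul_of_nonneg_left hT (by positivity : 0 ≤ 2 * n * K.θ)]
  have exp_mul_exp_le : Real.exp (2 * n * K.θ) * Real.exp (-(n * K.lam * K.ε / 2)) ≤ 1 := by
    rw [← Real.exp_add, Real.exp_le_one_iff]
    linarith [mul_le_mul_of_nonneg_left K.θ_le n_pos.le]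
  have one_le : 1 ≤ Real.exp (n * K.θ * K.ρ / 4) := Real.one_le_exp (by positivity)
  calc _ ≤ Real.exp (2 * n * K.θ * Real.exp (-t)) + 3 * n * Real.exp (2 * n * K.θ) *
          (14 * (n : ℝ) ^ 2 * Real.exp (-(n * K.lam * K.ε / 2))) * t := moment_le
    _ = Real.exp (2 * n * K.θ * Real.exp (-t)) + 42 * (n : ℝ) ^ 3 *
          (Real.exp (2 * n * K.θ) * Real.exp (-(n * K.lam * K.ε / 2))) * t := by ring
    _ ≤ (n : ℝ) ^ 4 * Real.exp (n * K.θ * K.ρ / 4) + 42 * (n : ℝ) ^ 3 * 1 * (2 * n) := by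
        gcongr
        · exact initial_le.trans (le_mul_of_one_le_left (Real.exp_pos _).le (one_le_pow₀ n_ge_one))
        · exact ht.1
        · exact ht.2
    _ = (n : ℝ) ^ 4 * Real.exp (n * K.θ * K.ρ / 4) + 84 * (n : ℝ) ^ 4 * 1 := by ring
    _ ≤ (n : ℝ) ^ 4 * Real.exp (n * K.θ * K.ρ / 4) +
          84 * (n : ℝ) ^ 4 * Real.exp (n * K.θ * K.ρ / 4) := by gcongr
    _ = _ := by ring

lemma localDev_tail (hG : Quasirandom G p K.δ) (hn : 0 < n) (h₀ : |mag σ₀ - m| ≤ K.ε / 2)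
    (ht : t ∈ Set.Icc (0 : ℝ) (2 * n)) (hT : Real.exp (-t) ≤ K.ρ / 8) :
    (NormedSpace.exp (t • generator G β h) *ᵥ
        (⋃ w, {σ | K.ρ ≤ |localDev G m w σ|}).indicator 1) σ₀ ≤
      170 * (n : ℝ) ^ 5 * Real.exp (-(n * K.θ * K.ρ / 4)) := by
  have hQ := isQMatrix_generator G β h
  have θ_pos := K.θ_mem.1
  have one_sided (w : Fin n) (e : ℝ) (he : |e| = 1) :
      (NormedSpace.exp (t • generator G β h) *ᵥ
        {σ | K.ρ ≤ e * localDev G m w σ}.indicator 1) σ₀ ≤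
      85 * (n : ℝ) ^ 4 * Real.exp (-(n * K.θ * K.ρ / 4)) := by
    have chernoff := hQ.exp_mulVec_indicator_le_exp_neg_mul (a := n * K.θ * K.ρ / 2)
      (A := {σ | K.ρ ≤ e * localDev G m w σ})
      (V := fun σ => K.θ * (n * (e * localDev G m w σ - K.ρ / 2))) ht.1
      (fun σ hσ => by
        have := mul_le_mul_of_nonneg_left (Set.mem_ofPred_eq ▸ hσ) (by positivity : 0 ≤ K.θ * n)
        linarith) σ₀
    refine (chernoff.trans (mul_le_mul_of_nonneg_left (K.exp_localDev_le hG hn h₀ ht hT he.le w)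
      (Real.exp_pos _).le)).trans_eq ?_
    rw [mul_left_comm, ← Real.exp_add]
    ring_nf
  refine (hQ.exp_mulVec_indicator_iUnion_le _ ht.1 σ₀).trans ((Finset.sum_le_sum fun w _ =>
    hQ.exp_mulVec_indicator_abs_le ht.1 (one_sided w)).trans_eq ?_)
  simp only [Finset.sum_const, Finset.card_univ, Fintype.card_fin, nsmul_eq_mul]
  ring

lemma coupledGen_mulVec_discrepancy_add_le (hG : Quasirandom G p K.δ) :
    coupledGen G β h *ᵥ discrepancy + K.κ • discrepancy ≤
      ((4 * β + K.κ) * n) • ((⋃ w, {σ | K.ρ ≤ |localDev G m w σ|}).indicator 1 ∘ Prod.fst +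
        (⋃ w, {σ | K.ρ ≤ |localDev G m w σ|}).indicator 1 ∘ Prod.snd) := by
  intro y
  set bad : Set (Config n) := ⋃ w, {σ | K.ρ ≤ |localDev G m w σ|}
  have β_nonneg := K.β_nonneg
  have κ_pos := K.κ_pos
  have bad_nonneg (σ : Config n) : 0 ≤ bad.indicator (1 : Config n → ℝ) σ :=
    Set.indicator_nonneg (fun _ _ => zero_le_one) σ
  change (coupledGen G β h *ᵥ discrepancy) y + K.κ * discrepancy y ≤
    (4 * β + K.κ) * n * (bad.indicator 1 y.1 + bad.indicator 1 y.2)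
  by_cases hy : y.1 ∈ bad ∨ y.2 ∈ bad
  · have one_le : 1 ≤ bad.indicator (1 : Config n → ℝ) y.1 + bad.indicator 1 y.2 := by
      rcases hy with hy | hy <;> rw [Set.indicator_of_mem hy, Pi.one_apply]
      · linarith [bad_nonneg y.2]
      · linarith [bad_nonneg y.1]
    calc (coupledGen G β h *ᵥ discrepancy) y + K.κ * discrepancy y
        ≤ (4 * β + K.κ) * discrepancy y := by
          linarith [coupledGen_mulVec_discrepancy_le G h y β_nonneg]
      _ ≤ (4 * β + K.κ) * n := by
          gcongr
          exact discrepancy_le y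
      _ ≤ _ := le_mul_of_one_le_right (by positivity) one_le
  · simp only [bad, Set.mem_iUnion, Set.mem_ofPred_eq, not_or, not_exists, not_le] at hy
    have good := (hG.mono K.δ_le_ρ).coupledGen_mulVec_discrepancy_le K.β_nonneg K.abs_m_le_one
      K.field_add_nonpos (fun w => (hy.1 w).le) fun w => (hy.2 w).le
    have : 0 ≤ (4 * β + K.κ) * n * (bad.indicator 1 y.1 + bad.indicator 1 y.2) :=
      mul_nonneg (by positivity) (add_nonneg (bad_nonneg _) (bad_nonneg _))
    have κ_eq : K.κ = -discrepancyDrift p β h m K.ρ := rfl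
    rw [κ_eq] at this ⊢
    linarith

lemma exp_mulVec_discrepancy_drift_le (hG : Quasirandom G p K.δ) (hn : 0 < n)
    {z : Config n × Config n} (h₁ : |mag z.1 - m| ≤ K.ε / 2) (h₂ : |mag z.2 - m| ≤ K.ε / 2)
    (ht : t ∈ Set.Icc (0 : ℝ) (2 * n)) (hT : Real.exp (-t) ≤ K.ρ / 8) :
    (NormedSpace.exp (t • coupledGen G β h) *ᵥ
        (coupledGen G β h *ᵥ discrepancy + K.κ • discrepancy)) z ≤
      (4 * β + K.κ) * 340 * (n : ℝ) ^ 6 * Real.exp (-(n * K.θ * K.ρ / 4)) := by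
  have β_nonneg := K.β_nonneg
  have κ_pos := K.κ_pos
  refine ((isQMatrix_coupledGen G β h).exp_mulVec_mono ht.1
    (K.coupledGen_mulVec_discrepancy_add_le hG) z).trans ?_
  rw [mulVec_smul, mulVec_add, exp_mulVec_comp (coupledGen_mulVec_comp_fst G β h),
    exp_mulVec_comp (coupledGen_mulVec_comp_snd G β h)]
  calc _ ≤ (4 * β + K.κ) * n * (170 * (n : ℝ) ^ 5 * Real.exp (-(n * K.θ * K.ρ / 4)) +
          170 * (n : ℝ) ^ 5 * Real.exp (-(n * K.θ * K.ρ / 4))) :=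
        mul_le_mul_of_nonneg_left (add_le_add (K.localDev_tail hG hn h₁ ht hT)
          (K.localDev_tail hG hn h₂ ht hT)) (by positivity)
    _ = _ := by ring

/-- Up to the burn-in time `T`, after which the local deviations have forgotten the initial state,
the disagreement set may grow; from then on it contracts. -/
lemma exp_mulVec_discrepancy_le (hG : Quasirandom G p K.δ) (hn : 0 < n)
    (hT0 : 0 ≤ T) (hT : Real.exp (-T) ≤ K.ρ / 8) {z : Config n × Config n}
    (h₁ : |mag z.1 - m| ≤ K.ε / 2) (h₂ : |mag z.2 - m| ≤ K.ε / 2)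
    (ht : t ∈ Set.Icc (0 : ℝ) (2 * n)) :
    (NormedSpace.exp (t • coupledGen G β h) *ᵥ discrepancy) z ≤
      Real.exp ((4 * β + K.κ) * T) * Real.exp (-K.κ * t) * discrepancy z +
        (4 * β + K.κ) * 680 * (n : ℝ) ^ 7 * Real.exp (-(n * K.θ * K.ρ / 4)) := by
  have β_nonneg := K.β_nonneg
  have κ_pos := K.κ_pos
  have crude {s : ℝ} (hs : 0 ≤ s) : (NormedSpace.exp (s • coupledGen G β h) *ᵥ discrepancy) z ≤
      Real.exp (4 * β * s) * discrepancy z :=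
    (isQMatrix_coupledGen G β h).exp_mulVec_le_exp_mul hs
      (fun y => coupledGen_mulVec_discrepancy_le G h y β_nonneg) z
  have error_nonneg : 0 ≤ (4 * β + K.κ) * 340 * (n : ℝ) ^ 6 *
      Real.exp (-(n * K.θ * K.ρ / 4)) := by positivity
  rw [← Real.exp_add]
  rcases le_total t T with htT | hTt
  · refine (crude ht.1).trans (le_add_of_le_of_nonneg ?_ (by positivity))
    refine mul_le_mul_of_nonneg_right (Real.exp_le_exp.2 ?_) (discrepancy_nonneg z)
    nlinarith
  · have contraction := exp_mulVec_le_exp_mul_add (Q := coupledGen G β h) (f := discrepancy)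
      (κ := K.κ) (B := (4 * β + K.κ) * 340 * (n : ℝ) ^ 6 * Real.exp (-(n * K.θ * K.ρ / 4))) hTt z
      (fun s hs => by
        have drift_le := K.exp_mulVec_discrepancy_drift_le hG hn h₁ h₂
          ⟨hT0.trans hs.1, hs.2.trans ht.2⟩ ((Real.exp_le_exp.2 (neg_le_neg hs.1)).trans hT)
        refine (mul_le_mul_of_nonneg_left drift_le (Real.exp_pos _).le).trans
          (mul_le_of_le_one_left error_nonneg (Real.exp_le_one_iff.2 ?_))
        exact mul_nonpos_of_nonneg_of_nonpos κ_pos.le (sub_nonpos.2 hs.2))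
    calc _ ≤ Real.exp (-K.κ * (t - T)) * (Real.exp (4 * β * T) * discrepancy z) +
          (4 * β + K.κ) * 340 * (n : ℝ) ^ 6 * Real.exp (-(n * K.θ * K.ρ / 4)) * (2 * n) := by
          refine contraction.trans (add_le_add (by gcongr; exact crude hT0) ?_)
          exact mul_le_mul_of_nonneg_left (by linarith [ht.2]) error_nonneg
      _ = _ := by
          rw [← mul_assoc, ← Real.exp_add]
          ring_nf

end WellConstants

end Well

/-! ### Quasirandomness of the binomial random graph -/

section RandomGraph

open MeasureTheory ProbabilityTheory

section Edges

variable {V : Type*}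

/-- The law, as a truth value, of the presence of the unordered pair `e` among the edges of the
binomial random graph; diagonal pairs are never present. -/
def edgeLaw (p : unitInterval) (e : Sym2 V) : Measure Prop :=
  unitInterval.toNNReal p • .dirac (e ∈ Sym2.diagSetᶜ) +
    unitInterval.toNNReal (unitInterval.symm p) • .dirac False

instance (p : unitInterval) (e : Sym2 V) : IsProbabilityMeasure (edgeLaw p e) := by
  unfold edgeLaw
  infer_instance

open Classical in
/-- The indicator of `x`, the presence of the unordered pair `e` as an edge, minus its mean under
`edgeLaw p e`. -/
def edgeDeviation (p : ℝ) (e : Sym2 V) (x : Prop) : ℝ :=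
  if e.IsDiag then 0 else (if x then 1 else 0) - p

lemma edgeDeviation_mem_Icc (p : unitInterval) (e : Sym2 V) (x : Prop) :
    edgeDeviation p e x ∈ Set.Icc (-(p : ℝ)) (1 - p) := by
  have := p.2.1
  have := p.2.2
  unfold edgeDeviation
  split_ifs <;> constructor <;> linarith

lemma integral_edgeDeviation (p : unitInterval) (e : Sym2 V) :
    ∫ x, edgeDeviation p e x ∂edgeLaw p e = 0 := by
  rw [edgeLaw, integral_add_measure .of_finite .of_finite, integral_smul_nnreal_measure,
    integral_smul_nnreal_measure, integral_dirac, integral_dirac, NNReal.smul_def,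
    NNReal.smul_def, unitInterval.coe_toNNReal, unitInterval.coe_toNNReal,
    unitInterval.coe_symm_eq]
  by_cases he : e.IsDiag
  · simp [edgeDeviation, he]
  · simp only [edgeDeviation, he, Set.mem_compl_iff, Sym2.mem_diagSet, not_false_eq_true, if_true,
      if_false, smul_eq_mul]
    ring

lemma hasSubgaussianMGF_edgeDeviation (p : unitInterval) (e : Sym2 V) :
    HasSubgaussianMGF (edgeDeviation p e) (1 / 4) (edgeLaw p e) := by
  have hoeffding := hasSubgaussianMGF_of_mem_Icc_of_integral_eq_zero (μ := edgeLaw p e)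
    Measurable.of_discrete.aemeasurable (ae_of_all _ (edgeDeviation_mem_Icc p e))
    (integral_edgeDeviation p e)
  convert! hoeffding using 1
  rw [sub_neg_eq_add, sub_add_cancel, nnnorm_one]
  norm_num

lemma measurable_fromEdgeSet_setOf :
    Measurable fun ω : Sym2 V → Prop => SimpleGraph.fromEdgeSet {e | ω e} :=
  SimpleGraph.measurable_fromEdgeSet.comp MeasurableEquiv.setOfPred.measurable

lemma binomialRandom_eq_map_infinitePi [Countable V] (p : unitInterval) :
    SimpleGraph.binomialRandom V p =
      (Measure.infinitePi (edgeLaw p)).map fun ω => SimpleGraph.fromEdgeSet {e | ω e} := by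
  have measurable_setOf : Measurable fun ω : Sym2 V → Prop => {e | ω e} :=
    MeasurableEquiv.setOfPred.measurable
  rw [SimpleGraph.binomialRandom_eq_map, setBernoulli_eq_map,
    Measure.map_map SimpleGraph.measurable_fromEdgeSet measurable_setOf]
  rfl

lemma edgeDeviation_fromEdgeSet (p : ℝ) (ω : Sym2 V → Prop) (e : Sym2 V) :
    edgeDeviation p e (e ∈ (SimpleGraph.fromEdgeSet {e | ω e}).edgeSet) =
      edgeDeviation p e (ω e) := by
  by_cases he : e.IsDiag
  · simp only [edgeDeviation, he, if_true]
  · have : e ∈ (SimpleGraph.fromEdgeSet {e | ω e}).edgeSet ↔ ω e := by simp [he]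
    rw [this]

lemma hasSubgaussianMGF_mul_edgeDeviation (p : unitInterval) (a : ℝ) (e : Sym2 V) :
    HasSubgaussianMGF (fun ω : Sym2 V → Prop => a * edgeDeviation p e (ω e)) (‖a‖₊ ^ 2 * (1 / 4))
      (Measure.infinitePi (edgeLaw p)) := by
  have deviation : HasSubgaussianMGF (fun ω : Sym2 V → Prop => edgeDeviation p e (ω e)) (1 / 4)
      (Measure.infinitePi (edgeLaw p)) := by
    refine .of_map (measurable_pi_apply e).aemeasurable (X := edgeDeviation p e) ?_
    rw [Measure.infinitePi_map_eval]
    exact hasSubgaussianMGF_edgeDeviation p e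
  have nnnorm_sq : ‖a‖₊ ^ 2 = NNReal.mk (a ^ 2) (sq_nonneg a) := NNReal.eq (sq_abs a)
  rw [nnnorm_sq]
  exact deviation.const_mul a

lemma binomialRandom_linear_tail [Fintype V] (p : unitInterval) {a : Sym2 V → ℝ} {S x : ℝ}
    (hS : ∑ e, a e ^ 2 ≤ S) (hx : 0 ≤ x) :
    (SimpleGraph.binomialRandom V p).real
        {G | x ≤ ∑ e, a e * edgeDeviation p e (e ∈ G.edgeSet)} ≤
      Real.exp (-(2 * x ^ 2 / S)) := by
  have measurable_sum : Measurable fun G : SimpleGraph V =>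
      ∑ e, a e * edgeDeviation p e (e ∈ G.edgeSet) := by
    refine Finset.measurable_sum _ fun e _ => Measurable.const_mul ?_ _
    exact (Measurable.of_discrete (f := edgeDeviation p e)).comp
      (measurable_set_iff.1 SimpleGraph.measurable_edgeSet e)
  have indep : iIndepFun (fun e (ω : Sym2 V → Prop) => a e * edgeDeviation p e (ω e))
      (Measure.infinitePi (edgeLaw p)) :=
    iIndepFun_infinitePi (X := fun e x => a e * edgeDeviation p e x)
      fun _ => Measurable.of_discrete
  have subgaussian := HasSubgaussianMGF.sum_of_iIndepFun indep (s := Finset.univ)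
    fun e _ => hasSubgaussianMGF_mul_edgeDeviation p (a e) e
  have parameter_le : ((∑ e, ‖a e‖₊ ^ 2 * (1 / 4) : ℝ≥0) : ℝ) ≤ ((S / 4).toNNReal : ℝ) := by
    push_cast
    simp only [Real.norm_eq_abs, sq_abs, ← Finset.sum_mul]
    exact le_max_of_le_left (by linarith)
  have subgaussian_S : HasSubgaussianMGF (fun ω => ∑ e, a e * edgeDeviation p e (ω e))
      (S / 4).toNNReal (Measure.infinitePi (edgeLaw p)) :=
    ⟨subgaussian.integrable_exp_mul, fun t => (subgaussian.mgf_le t).trans (by gcongr)⟩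
  rw [binomialRandom_eq_map_infinitePi, map_measureReal_apply measurable_fromEdgeSet_setOf
    (measurableSet_le measurable_const measurable_sum)]
  simp only [Set.preimage_ofPred_eq, edgeDeviation_fromEdgeSet]
  refine (subgaussian_S.measure_ge_le hx).trans_eq ?_
  rw [Real.coe_toNNReal _ (div_nonneg ((Finset.sum_nonneg fun e _ => sq_nonneg _).trans hS)
    zero_le_four)]
  ring_nf

open Classical in
/-- The coefficient of the unordered pair `e` in the bilinear form with coefficients `c`. -/
def edgeWeight [Fintype V] (c : V → V → ℝ) (e : Sym2 V) : ℝ :=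
  ∑ q : V × V with s(q.1, q.2) = e, c q.1 q.2

lemma sum_edgeWeight_mul [Fintype V] (c : V → V → ℝ) (f : Sym2 V → ℝ) :
    ∑ e, edgeWeight c e * f e = ∑ v, ∑ w, c v w * f s(v, w) := by
  classical
  rw [← Fintype.sum_prod_type fun q : V × V => c q.1 q.2 * f s(q.1, q.2),
    ← Finset.sum_fiberwise (Finset.univ : Finset (V × V)) fun q => s(q.1, q.2)]
  refine Finset.sum_congr rfl fun e _ => ?_
  rw [edgeWeight, Finset.sum_mul]
  refine Finset.sum_congr (by congr!) fun q hq => ?_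
  rw [(Finset.mem_filter.1 hq).2]

lemma card_filter_mk_eq_le_two [Fintype V] [DecidableEq V] (e : Sym2 V) :
    (Finset.univ.filter fun q : V × V => s(q.1, q.2) = e).card ≤ 2 := by
  induction e with | _ v w => ?_
  refine (Finset.card_le_card (t := {(v, w), (w, v)}) fun q hq => ?_).trans Finset.card_le_two
  simpa [Prod.ext_iff] using hq

lemma sum_edgeWeight_sq_le [Fintype V] (c : V → V → ℝ) :
    ∑ e, edgeWeight c e ^ 2 ≤ 2 * ∑ v, ∑ w, c v w ^ 2 := by
  classical
  rw [← Fintype.sum_prod_type fun q : V × V => c q.1 q.2 ^ 2,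
    ← Finset.sum_fiberwise (Finset.univ : Finset (V × V)) fun q => s(q.1, q.2), Finset.mul_sum]
  refine Finset.sum_le_sum fun e _ => sq_sum_le_card_mul_sum_sq.trans ?_
  refine mul_le_mul_of_nonneg_right ?_ (Finset.sum_nonneg fun q _ => sq_nonneg (c q.1 q.2))
  exact_mod_cast card_filter_mk_eq_le_two e

lemma binomialRandom_bilinear_tail [Fintype V] (p : unitInterval) {c : V → V → ℝ} {S x : ℝ}
    (hS : ∑ v, ∑ w, c v w ^ 2 ≤ S) (hx : 0 ≤ x) :
    (SimpleGraph.binomialRandom V p).real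
        {G | x ≤ ∑ v, ∑ w, c v w * edgeDeviation p s(v, w) (G.Adj v w)} ≤
      Real.exp (-(x ^ 2 / S)) := by
  have sum_sq_le : ∑ e, edgeWeight c e ^ 2 ≤ 2 * S :=
    (sum_edgeWeight_sq_le c).trans (by linarith)
  have tail := binomialRandom_linear_tail p sum_sq_le hx
  simp only [sum_edgeWeight_mul c (fun e => edgeDeviation p e (e ∈ SimpleGraph.edgeSet _)),
    SimpleGraph.mem_edgeSet] at tail
  rwa [mul_div_mul_left _ _ two_ne_zero] at tail

end Edges

variable {n : ℕ}

lemma edgeDeviation_mk_adj (p : ℝ) (G : SimpleGraph (Fin n)) (v w : Fin n) :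
    edgeDeviation p s(v, w) (G.Adj v w) = adj G v w - p + if v = w then p else 0 := by
  classical
  rw [adj, SimpleGraph.adjMatrix_apply]
  by_cases hvw : v = w
  · simp [edgeDeviation, hvw]
  · simp [edgeDeviation, hvw]

lemma exists_sum_spin_mul_eq_sum_abs (f : Fin n → ℝ) :
    ∃ τ : Config n, ∑ v, spin τ v * f v = ∑ v, |f v| := by
  refine ⟨fun v => if 0 ≤ f v then 1 else -1, Finset.sum_congr rfl fun v _ => ?_⟩
  by_cases hv : 0 ≤ f v
  · simp [spin, hv, abs_of_nonneg hv]
  · simp [spin, hv, abs_of_neg (not_le.1 hv)]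

lemma quasirandom_of_edgeDeviation_le {G : SimpleGraph (Fin n)} {p δ : ℝ}
    (hp : p ∈ Set.Icc (0 : ℝ) 1) (hn : 1 ≤ δ / 2 * n)
    (degree_le : ∀ w, |∑ v, edgeDeviation p s(w, v) (G.Adj w v)| ≤ δ / 2 * n)
    (cut_le : ∀ σ : Config n,
      ∑ v, |∑ w, edgeDeviation p s(v, w) (G.Adj v w) * spin σ w| ≤ δ / 2 * (n : ℝ) ^ 2) :
    Quasirandom G p δ where
  degree w := by
    have deviation_eq : ∑ v, adj G w v - p * n =
        ∑ v, edgeDeviation p s(w, v) (G.Adj w v) - p := by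
      simp only [edgeDeviation_mk_adj, Finset.sum_add_distrib, Finset.sum_sub_distrib,
        Finset.sum_const, Finset.card_univ, Fintype.card_fin, nsmul_eq_mul, Finset.sum_ite_eq,
        Finset.mem_univ, if_true]
      ring
    rw [deviation_eq]
    refine (abs_sub _ _).trans ?_
    linarith [degree_le w, abs_of_nonneg hp.1, hp.2]
  cut σ := by
    have deviation_eq : ∀ v, ∑ w, (adj G v w - p) * spin σ w =
        ∑ w, edgeDeviation p s(v, w) (G.Adj v w) * spin σ w - p * spin σ v := fun v => by
      simp [edgeDeviation_mk_adj, add_mul, Finset.sum_add_distrib, ite_mul]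
    calc ∑ v, |∑ w, (adj G v w - p) * spin σ w|
        ≤ ∑ v, (|∑ w, edgeDeviation p s(v, w) (G.Adj v w) * spin σ w| + 1) := by
          refine Finset.sum_le_sum fun v _ => ?_
          rw [deviation_eq]
          refine (abs_sub _ _).trans (add_le_add_right ?_ _)
          rw [abs_mul, abs_spin, mul_one, abs_of_nonneg hp.1]
          exact hp.2
      _ ≤ δ / 2 * (n : ℝ) ^ 2 + δ / 2 * n * n := by
          rw [Finset.sum_add_distrib, Finset.sum_const, Finset.card_univ, Fintype.card_fin,
            nsmul_eq_mul, mul_one]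
          exact add_le_add (cut_le σ) (le_mul_of_one_le_left (Nat.cast_nonneg n) hn)
      _ = δ * (n : ℝ) ^ 2 := by ring

lemma degree_tail_le (p : unitInterval) {δ : ℝ} (hδ : 0 ≤ δ) (w : Fin n) (s : ℤˣ) :
    (SimpleGraph.binomialRandom (Fin n) p).real
        {G | δ / 2 * n ≤ ((s : ℤ) : ℝ) * ∑ v, edgeDeviation p s(w, v) (G.Adj w v)} ≤
      Real.exp (-(δ ^ 2 / 4 * n)) := by
  have sign_sq : ((s : ℤ) : ℝ) ^ 2 = 1 := by
    rcases Int.units_eq_one_or s with rfl | rfl <;> simp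
  have tail := binomialRandom_bilinear_tail p
    (c := fun v (_ : Fin n) => if v = w then ((s : ℤ) : ℝ) else 0) (S := n) (x := δ / 2 * n)
    (by simp [ite_pow, sign_sq]) (by positivity)
  simp only [ite_mul, zero_mul, Finset.sum_ite_irrel, Finset.sum_const_zero, Finset.sum_ite_eq',
    Finset.mem_univ, if_true, ← Finset.mul_sum] at tail
  refine tail.trans_eq ?_
  congr 2
  rw [mul_pow, sq (n : ℝ)]
  field_simp
  ring

lemma cut_tail_le (p : unitInterval) {δ : ℝ} (hδ : 0 ≤ δ) (τ σ : Config n) :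
    (SimpleGraph.binomialRandom (Fin n) p).real
        {G | δ / 2 * (n : ℝ) ^ 2 ≤
          ∑ v, spin τ v * ∑ w, edgeDeviation p s(v, w) (G.Adj v w) * spin σ w} ≤
      Real.exp (-(δ ^ 2 / 4 * (n : ℝ) ^ 2)) := by
  have spin_sq : ∀ (η : Config n) v, spin η v ^ 2 = 1 := fun η v => by
    rw [← sq_abs, abs_spin, one_pow]
  have tail := binomialRandom_bilinear_tail p (c := fun v w => spin τ v * spin σ w)
    (S := (n : ℝ) ^ 2) (x := δ / 2 * (n : ℝ) ^ 2)
    (by simp only [mul_pow, spin_sq]; simp [sq]) (by positivity)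
  simp only [mul_assoc, ← Finset.mul_sum, mul_comm (spin σ _)] at tail
  refine tail.trans_eq ?_
  congr 2
  field_simp
  ring

lemma not_quasirandom_le (p : unitInterval) {δ : ℝ} (hδ : 0 ≤ δ) (hn : 1 ≤ δ / 2 * n) :
    (SimpleGraph.binomialRandom (Fin n) p).real {G | ¬ Quasirandom G p δ} ≤
      2 * n * Real.exp (-(δ ^ 2 / 4 * n)) +
        2 ^ n * 2 ^ n * Real.exp (-(δ ^ 2 / 4 * (n : ℝ) ^ 2)) := by
  set μ := SimpleGraph.binomialRandom (Fin n) p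
  let atypicalDegree (q : Fin n × ℤˣ) : Set (SimpleGraph (Fin n)) :=
    {G | δ / 2 * n ≤ ((q.2 : ℤ) : ℝ) * ∑ v, edgeDeviation p s(q.1, v) (G.Adj q.1 v)}
  let atypicalCut (q : Config n × Config n) : Set (SimpleGraph (Fin n)) :=
    {G | δ / 2 * (n : ℝ) ^ 2 ≤
      ∑ v, spin q.1 v * ∑ w, edgeDeviation p s(v, w) (G.Adj v w) * spin q.2 w}
  have atypical_of_not_quasirandom : {G | ¬ Quasirandom G p δ} ⊆
      (⋃ q, atypicalDegree q) ∪ ⋃ q, atypicalCut q := by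
    intro G
    contrapose!
    simp only [Set.mem_union, Set.mem_iUnion, not_or, not_exists]
    rintro ⟨degree_lt, cut_lt⟩
    have degree_le (w : Fin n) (s : ℤˣ) :
        ((s : ℤ) : ℝ) * ∑ v, edgeDeviation p s(w, v) (G.Adj w v) ≤ δ / 2 * n :=
      le_of_not_ge (degree_lt (w, s))
    refine not_not.2 (quasirandom_of_edgeDeviation_le p.2 hn (fun w => abs_le'.2 ⟨?_, ?_⟩)
      fun σ => ?_)
    · simpa using degree_le w 1
    · simpa using degree_le w (-1)
    · obtain ⟨τ, hτ⟩ := exists_sum_spin_mul_eq_sum_abs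
        fun v => ∑ w, edgeDeviation p s(v, w) (G.Adj v w) * spin σ w
      rw [← hτ]
      exact le_of_not_ge (cut_lt (τ, σ))
  calc μ.real {G | ¬ Quasirandom G p δ}
      ≤ μ.real (⋃ q, atypicalDegree q) + μ.real (⋃ q, atypicalCut q) :=
        (measureReal_mono atypical_of_not_quasirandom).trans (measureReal_union_le _ _)
    _ ≤ ∑ q, μ.real (atypicalDegree q) + ∑ q, μ.real (atypicalCut q) :=
        add_le_add (measureReal_iUnion_fintype_le _) (measureReal_iUnion_fintype_le _)
    _ ≤ ∑ _q : Fin n × ℤˣ, Real.exp (-(δ ^ 2 / 4 * n)) +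
        ∑ _q : Config n × Config n, Real.exp (-(δ ^ 2 / 4 * (n : ℝ) ^ 2)) := by
        gcongr with q _ q _
        · exact degree_tail_le p hδ q.1 q.2
        · exact cut_tail_le p hδ q.1 q.2
    _ = _ := by
        simp [Config]
        ring

lemma eventually_two_pow_mul_exp_le {a : ℝ} (ha : 0 < a) :
    ∀ᶠ n : ℕ in Filter.atTop,
      (2 : ℝ) ^ n * 2 ^ n * Real.exp (-(a * (n : ℝ) ^ 2)) ≤ Real.exp (-n) := by
  filter_upwards [tendsto_natCast_atTop_atTop.eventually_ge_atTop (3 / a)] with n hn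
  have three_le : 3 ≤ n * a := (div_le_iff₀ ha).1 hn
  have two_pow_le : (2 : ℝ) ^ n ≤ Real.exp n := by
    rw [← Real.exp_one_pow]
    exact pow_le_pow_left₀ zero_le_two (by linarith [Real.add_one_le_exp (1 : ℝ)]) n
  calc (2 : ℝ) ^ n * 2 ^ n * Real.exp (-(a * (n : ℝ) ^ 2))
      ≤ Real.exp n * Real.exp n * Real.exp (-(a * (n : ℝ) ^ 2)) := by gcongr
    _ = Real.exp (n + n + -(a * (n : ℝ) ^ 2)) := by rw [Real.exp_add, Real.exp_add]
    _ ≤ Real.exp (-n) := by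
        refine Real.exp_le_exp.2 ?_
        nlinarith [mul_le_mul_of_nonneg_right three_le (Nat.cast_nonneg (α := ℝ) n)]

lemma tendsto_not_quasirandom (p : unitInterval) {δ : ℝ} (hδ : 0 < δ) :
    Filter.Tendsto
      (fun n : ℕ => (SimpleGraph.binomialRandom (Fin n) p).real {G | ¬ Quasirandom G p δ})
      Filter.atTop (𝓝 0) := by
  have a_pos : 0 < δ ^ 2 / 4 := by positivity
  have degree_tendsto : Filter.Tendsto
      (fun n : ℕ => 2 * (n : ℝ) * Real.exp (-(δ ^ 2 / 4 * n))) Filter.atTop (𝓝 0) := by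
    have h := ((Real.tendsto_pow_mul_exp_neg_atTop_nhds_zero 1).comp
      ((tendsto_natCast_atTop_atTop (R := ℝ)).const_mul_atTop a_pos)).const_mul (2 / (δ ^ 2 / 4))
    rw [mul_zero] at h
    refine h.congr fun n => ?_
    simp only [Function.comp_apply, pow_one]
    field_simp
  have cut_tendsto : Filter.Tendsto (fun n : ℕ => Real.exp (-(n : ℝ))) Filter.atTop (𝓝 0) :=
    Real.tendsto_exp_neg_atTop_nhds_zero.comp tendsto_natCast_atTop_atTop
  have bound_tendsto := degree_tendsto.add cut_tendsto
  rw [add_zero] at bound_tendsto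
  refine squeeze_zero' (Filter.Eventually.of_forall fun n => measureReal_nonneg) ?_ bound_tendsto
  filter_upwards [tendsto_natCast_atTop_atTop.eventually_ge_atTop (2 / δ),
    eventually_two_pow_mul_exp_le a_pos] with n hn cut_le
  have one_le : 1 ≤ δ / 2 * n := by
    rw [div_le_iff₀ hδ] at hn
    linarith
  exact (not_quasirandom_le p hδ.le one_le).trans (add_le_add le_rfl cut_le)

lemma tendsto_binomialRandom_of_quasirandom (p : unitInterval) {δ : ℝ} (hδ : 0 < δ)
    {E : ∀ n : ℕ, Set (SimpleGraph (Fin n))}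
    (hE : ∀ᶠ n in Filter.atTop, ∀ G, Quasirandom G p δ → G ∈ E n) :
    Filter.Tendsto (fun n : ℕ => SimpleGraph.binomialRandom (Fin n) p (E n)) Filter.atTop
      (𝓝 1) := by
  have lower_tendsto := ENNReal.Tendsto.sub (tendsto_const_nhds (x := (1 : ENNReal)))
    (ENNReal.tendsto_ofReal (tendsto_not_quasirandom p hδ)) (Or.inl ENNReal.one_ne_top)
  rw [ENNReal.ofReal_zero, tsub_zero] at lower_tendsto
  refine tendsto_of_tendsto_of_tendsto_of_le_of_le' lower_tendsto tendsto_const_nhds ?_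
    (Filter.Eventually.of_forall fun n => prob_le_one)
  filter_upwards [hE] with n hn
  have univ_subset : Set.univ ⊆ E n ∪ {G | ¬ Quasirandom G p δ} := fun G _ =>
    (em (Quasirandom G p δ)).imp (hn G) id
  rw [ofReal_measureReal, tsub_le_iff_right,
    ← measure_univ (μ := SimpleGraph.binomialRandom (Fin n) p)]
  exact (measure_mono univ_subset).trans (measure_union_le _ _)

end RandomGraph

/-! ### The first zero of `J` -/

section FirstZero

variable {p β h : ℝ}

lemma hasDerivAt_J (p β h : ℝ) {a : ℝ} (ha : a ∈ Set.Ioo (-1 : ℝ) 1) :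
    HasDerivAt (J p β h) (2 * β * p - 2 / (1 - a ^ 2)) a := by
  have one_sub_pos : 0 < 1 - a := by linarith [ha.2]
  have one_add_pos : 0 < 1 + a := by linarith [ha.1]
  have ratio : HasDerivAt (fun a : ℝ => (1 - a) / (1 + a))
      ((-1 * (1 + a) - (1 - a) * 1) / (1 + a) ^ 2) a :=
    ((hasDerivAt_id a).const_sub 1).div ((hasDerivAt_id a).const_add 1) one_add_pos.ne'
  refine (((((hasDerivAt_id a).const_mul p).add_const h).const_mul (2 * β)).add
    (ratio.log (div_pos one_sub_pos one_add_pos).ne')).congr_deriv ?_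
  rw [show 1 - a ^ 2 = (1 - a) * (1 + a) by ring]
  field_simp
  ring

lemma tendsto_J_nhdsGT_neg_one (p β h : ℝ) : Filter.Tendsto (J p β h) (𝓝[>] (-1)) Filter.atTop := by
  have field : Filter.Tendsto (fun a => 2 * β * (p * a + h)) (𝓝[>] (-1))
      (𝓝 (2 * β * (p * -1 + h))) :=
    Continuous.tendsto' (by fun_prop) _ _ rfl |>.mono_left nhdsWithin_le_nhds
  have numerator : Filter.Tendsto (fun a : ℝ => 1 - a) (𝓝[>] (-1)) (𝓝 2) :=
    Continuous.tendsto' (by fun_prop) _ _ (by norm_num) |>.mono_left nhdsWithin_le_nhds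
  have denominator : Filter.Tendsto (fun a : ℝ => 1 + a) (𝓝[>] (-1)) (𝓝[>] 0) :=
    tendsto_nhdsWithin_iff.2
      ⟨Continuous.tendsto' (by fun_prop) _ _ (by norm_num) |>.mono_left nhdsWithin_le_nhds,
        eventually_mem_nhdsWithin.mono fun a (ha : -1 < a) => neg_lt_iff_pos_add'.1 ha⟩
  exact field.add_atTop <| Real.tendsto_log_atTop.comp <|
    numerator.pos_mul_atTop two_pos (tendsto_inv_nhdsGT_zero.comp denominator)

/-- The spinodal magnetization: for `l = β p`, the points where the derivative of `J` vanishes are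
`± spinodal l`. -/
def spinodal (l : ℝ) : ℝ := √(1 - 1 / l)

lemma mul_one_sub_spinodal_sq {l : ℝ} (hl : 1 < l) : l * (1 - spinodal l ^ 2) = 1 := by
  have : 1 / l < 1 := (div_lt_one (by linarith)).2 hl
  rw [spinodal, Real.sq_sqrt (by linarith)]
  field_simp
  ring

lemma spinodal_mem_Ioo {l : ℝ} (hl : 1 < l) : spinodal l ∈ Set.Ioo (0 : ℝ) 1 := by
  have inv_pos : 0 < 1 / l := by positivity
  have inv_lt_one : 1 / l < 1 := (div_lt_one (by linarith)).2 hl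
  exact ⟨Real.sqrt_pos.2 (by linarith), (Real.sqrt_lt' one_pos).2 (by linarith)⟩

lemma lt_one_div_of_lt_neg_spinodal {l a : ℝ} (hl : 1 < l)
    (ha : a ∈ Set.Ioo (-1 : ℝ) (-spinodal l)) : l < 1 / (1 - a ^ 2) := by
  have spinodal_pos := (spinodal_mem_Ioo hl).1
  have sq_lt : spinodal l ^ 2 < a ^ 2 := by nlinarith [ha.2]
  have sq_lt_one : a ^ 2 < 1 := by nlinarith [ha.1, ha.2]
  refine (lt_div_iff₀ (by linarith)).2 (lt_of_lt_of_eq ?_ (mul_one_sub_spinodal_sq hl))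
  exact mul_lt_mul_of_pos_left (by linarith) (by linarith)

lemma J_neg_spinodal (hl : 1 < β * p) :
    J p β h (-spinodal (β * p)) = 2 * β * (h - p * chi (β * p)) := by
  have spinodal_lt_one := (spinodal_mem_Ioo hl).2
  have ratio_eq : (1 - -spinodal (β * p)) / (1 + -spinodal (β * p)) =
      β * p * (1 + spinodal (β * p)) ^ 2 := by
    rw [div_eq_iff (by linarith)]
    linear_combination (-1 - spinodal (β * p)) * mul_one_sub_spinodal_sq hl
  have : β * p ≠ 0 := by linarith
  have β_ne : β ≠ 0 := left_ne_zero_of_mul this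
  have p_ne : p ≠ 0 := right_ne_zero_of_mul this
  rw [J, ratio_eq, chi, ← spinodal]
  field_simp
  ring

lemma strictAntiOn_J (hl : 1 < β * p) :
    StrictAntiOn (J p β h) (Set.Ioc (-1) (-spinodal (β * p))) := by
  have spinodal_pos := (spinodal_mem_Ioo hl).1
  refine strictAntiOn_of_deriv_neg (convex_Ioc _ _) (fun a ha =>
    (hasDerivAt_J p β h ⟨ha.1, by linarith [ha.2]⟩).continuousAt.continuousWithinAt) fun a ha => ?_
  rw [interior_Ioc] at ha
  rw [(hasDerivAt_J p β h ⟨ha.1, by linarith [ha.2]⟩).deriv, ← mul_one_div 2]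
  linarith [lt_one_div_of_lt_neg_spinodal hl ha]

lemma Metastable.one_lt_mul (hmeta : Metastable p β h) (hp : 0 < p) : 1 < β * p :=
  (div_lt_iff₀ hp).1 hmeta.1

lemma Metastable.exists_J_eq_zero (hmeta : Metastable p β h) (hp : 0 < p) :
    ∃ m ∈ Set.Ioo (-1 : ℝ) (-spinodal (β * p)), J p β h m = 0 := by
  have hl := hmeta.one_lt_mul hp
  obtain ⟨spinodal_pos, spinodal_lt_one⟩ := spinodal_mem_Ioo hl
  have J_neg : J p β h (-spinodal (β * p)) < 0 := by
    have : 0 < β := lt_trans (by positivity) hmeta.1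
    rw [J_neg_spinodal hl]
    exact mul_neg_of_pos_of_neg (by positivity) (sub_neg.2 hmeta.2.2)
  obtain ⟨a, J_pos, a_gt, a_lt⟩ := ((tendsto_J_nhdsGT_neg_one p β h).eventually_gt_atTop 0 |>.and
    (Ioo_mem_nhdsGT (by linarith : -1 < -spinodal (β * p)))).exists
  obtain ⟨m, hm, J_eq_zero⟩ := intermediate_value_Ioo' a_lt.le (fun x hx =>
    (hasDerivAt_J p β h ⟨by linarith [hx.1], by linarith [hx.2]⟩).continuousAt.continuousWithinAt)
    ⟨J_neg, J_pos⟩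
  exact ⟨m, ⟨a_gt.trans hm.1, hm.2⟩, J_eq_zero⟩

/-! ### Convergence of `mn` -/

lemma log_le_harmonic_sub {k N : ℕ} (hkN : k ≤ N) :
    Real.log ((N + 1) / (k + 1)) ≤ (harmonic N : ℝ) - harmonic k := by
  induction N, hkN using Nat.le_induction with
  | base => simp [div_self (by positivity : (k : ℝ) + 1 ≠ 0)]
  | succ N _ ih =>
    have log_le : Real.log ((N + 1 + 1) / (N + 1)) ≤ ((N : ℝ) + 1)⁻¹ := by
      refine (Real.log_le_sub_one_of_pos (by positivity)).trans (le_of_eq ?_)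
      field_simp
      ring
    have log_succ : Real.log (((N + 1 : ℕ) + 1) / (k + 1)) =
        Real.log ((N + 1) / (k + 1)) + Real.log ((N + 1 + 1) / ((N : ℝ) + 1)) := by
      rw [← Real.log_mul (by positivity) (by positivity)]
      congr 1
      push_cast
      field_simp
    rw [log_succ, harmonic_succ]
    push_cast
    linarith

lemma harmonic_sub_le_log {k N : ℕ} (hk : 0 < k) (hkN : k ≤ N) :
    (harmonic N : ℝ) - harmonic k ≤ Real.log (N / k) := by
  have k_pos : (0 : ℝ) < k := Nat.cast_pos.2 hk
  induction N, hkN using Nat.le_induction with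
  | base => simp [div_self k_pos.ne']
  | succ N hN ih =>
    have N_pos : (0 : ℝ) < N := Nat.cast_pos.2 (hk.trans_le hN)
    have le_log : ((N : ℝ) + 1)⁻¹ ≤ Real.log ((N + 1) / N) := by
      refine le_trans (le_of_eq ?_) (Real.one_sub_inv_le_log_of_pos (by positivity))
      field_simp
      ring
    have log_succ : Real.log (((N + 1 : ℕ) : ℝ) / k) =
        Real.log (N / k) + Real.log ((N + 1) / N) := by
      rw [← Real.log_mul (by positivity) (by positivity)]
      congr 1
      push_cast
      field_simp
    rw [log_succ, harmonic_succ]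
    push_cast
    linarith

/-- The magnetization of the configurations on `n` vertices with exactly `k` plus spins. -/
def gridPoint (n k : ℕ) : ℝ := -1 + 2 * (k : ℝ) / n

variable {n k : ℕ}

lemma one_add_gridPoint (n k : ℕ) : 1 + gridPoint n k = 2 * k / n := by
  rw [gridPoint, add_neg_cancel_left]

lemma one_sub_gridPoint (hn : 0 < n) (hk : k ≤ n) :
    1 - gridPoint n k = 2 * (n - k : ℕ) / n := by
  rw [gridPoint, Nat.cast_sub hk]
  field_simp
  ring

lemma two_mul_le_of_gridPoint_neg (hn : 0 < n) (hk : gridPoint n k < 0) : 2 * k ≤ n := by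
  have : 2 * (k : ℝ) / n < 1 := by linarith [one_add_gridPoint n k]
  rw [div_lt_one (Nat.cast_pos.2 hn)] at this
  exact_mod_cast this.le

lemma J_gridPoint (p β h : ℝ) (hn : 0 < n) (hk : k ≤ n) :
    J p β h (gridPoint n k) =
      2 * β * (p * gridPoint n k + h) + Real.log ((n - k : ℕ) / (k : ℝ)) := by
  rw [J, one_sub_gridPoint hn hk, one_add_gridPoint, div_div_div_cancel_right₀ (by positivity),
    mul_div_mul_left _ _ two_ne_zero]

lemma deriv_In_gridPoint (hn : 0 < n) (hk : k ≤ n) :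
    deriv (In n) (gridPoint n k) = ((harmonic k : ℝ) - harmonic (n - k)) / 2 := by
  set a := gridPoint n k
  have plus_eq : (1 + a) / 2 * n + 1 = k + 1 := by
    rw [one_add_gridPoint]
    field_simp
  have minus_eq : (1 - a) / 2 * n + 1 = (n - k : ℕ) + 1 := by
    rw [one_sub_gridPoint hn hk]
    field_simp
  have deriv_plus : HasDerivAt (fun a : ℝ => (1 + a) / 2 * n + 1) (1 / 2 * n) a :=
    ((((hasDerivAt_id a).const_add 1).div_const 2).mul_const (n : ℝ)).add_const 1
  have deriv_minus : HasDerivAt (fun a : ℝ => (1 - a) / 2 * n + 1) (-1 / 2 * n) a :=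
    ((((hasDerivAt_id a).const_sub 1).div_const 2).mul_const (n : ℝ)).add_const 1
  have deriv_Gamma_plus := (plus_eq ▸ Real.hasDerivAt_Gamma_nat k).comp a deriv_plus
  have deriv_Gamma_minus := (minus_eq ▸ Real.hasDerivAt_Gamma_nat (n - k)).comp a deriv_minus
  have Gamma_plus_eq : Real.Gamma ((1 + a) / 2 * n + 1) = k.factorial := by
    rw [plus_eq, Real.Gamma_nat_eq_factorial]
  have Gamma_minus_eq : Real.Gamma ((1 - a) / 2 * n + 1) = (n - k).factorial := by
    rw [minus_eq, Real.Gamma_nat_eq_factorial]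
  have factorial_ne (j : ℕ) : (j.factorial : ℝ) ≠ 0 := Nat.cast_ne_zero.2 j.factorial_ne_zero
  have product_ne : (Real.Gamma ∘ fun a : ℝ => (1 + a) / 2 * n + 1) a *
      (Real.Gamma ∘ fun a : ℝ => (1 - a) / 2 * n + 1) a ≠ 0 := by
    simp only [Function.comp_apply, Gamma_plus_eq, Gamma_minus_eq]
    exact mul_ne_zero (factorial_ne k) (factorial_ne (n - k))
  have numerator_ne : Real.Gamma (n + 1) ≠ 0 := by
    rw [Real.Gamma_nat_eq_factorial]
    exact factorial_ne n
  have deriv_In : HasDerivAt (In n) _ a := ((((hasDerivAt_const a (Real.Gamma (n + 1))).div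
    (deriv_Gamma_plus.mul deriv_Gamma_minus) product_ne).log
      (div_ne_zero numerator_ne product_ne))).const_mul (-(1 / (n : ℝ)))
  rw [deriv_In.deriv]
  simp only [Pi.mul_apply, Pi.div_apply, Function.comp_apply, Gamma_plus_eq, Gamma_minus_eq]
  have := factorial_ne k
  have := factorial_ne (n - k)
  rw [Real.Gamma_nat_eq_factorial] at numerator_ne ⊢
  field_simp
  ring

lemma Jn_gridPoint (p β h : ℝ) (hn : 0 < n) (hk : k ≤ n) :
    Jn p β h n (gridPoint n k) =
      2 * β * (p * gridPoint n k + h) + ((harmonic (n - k) : ℝ) - harmonic k) := by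
  rw [Jn, deriv_In_gridPoint hn hk]
  ring

lemma gridPoint_succ_le (hn : 0 < n) (k : ℕ) :
    gridPoint (n + 2) (k + 1) ≤ gridPoint n k + 2 / n := by
  have : (0 : ℝ) < n := Nat.cast_pos.2 hn
  have : 0 ≤ (k : ℝ) := k.cast_nonneg
  rw [gridPoint, gridPoint, add_assoc, ← add_div]
  push_cast
  gcongr <;> linarith

lemma J_sub_le_Jn (h : ℝ) (hβp : 0 ≤ β * p) (hn : 0 < n) (hk : 2 * k ≤ n) :
    J p β h (gridPoint (n + 2) (k + 1)) - 4 * (β * p) / n ≤ Jn p β h n (gridPoint n k) := by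
  have le_sub : k ≤ n - k := by omega
  rw [Jn_gridPoint p β h hn (by omega), J_gridPoint p β h (by omega) (by omega),
    show n + 2 - (k + 1) = n - k + 1 by omega]
  push_cast
  have log_le := log_le_harmonic_sub le_sub
  have shift := mul_le_mul_of_nonneg_left (gridPoint_succ_le hn k) hβp
  have : 4 * (β * p) / n = 2 * (β * p * (2 / n)) := by ring
  linarith

lemma Jn_le_J (p β h : ℝ) (hk₀ : 0 < k) (hk : 2 * k ≤ n) :
    Jn p β h n (gridPoint n k) ≤ J p β h (gridPoint n k) := by
  rw [Jn_gridPoint p β h (by omega) (by omega), J_gridPoint p β h (by omega) (by omega)]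
  gcongr
  exact harmonic_sub_le_log hk₀ (by omega)

lemma exists_gridPoint_mem_Ioc {x : ℝ} (hn : 0 < n) (hx : -1 ≤ x) :
    ∃ k, 0 < k ∧ gridPoint n k ∈ Set.Ioc x (x + 2 / n) := by
  have n_pos : (0 : ℝ) < n := Nat.cast_pos.2 hn
  have lower := Nat.lt_floor_add_one (n * (1 + x) / 2)
  have upper := Nat.floor_le (div_nonneg (mul_nonneg n_pos.le (by linarith : 0 ≤ 1 + x)) two_pos.le)
  refine ⟨⌊n * (1 + x) / 2⌋₊ + 1, Nat.succ_pos _, ?_⟩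
  rw [gridPoint]
  push_cast
  constructor
  · rw [← sub_lt_iff_lt_add', lt_div_iff₀ n_pos]
    linarith
  · rw [← le_sub_iff_add_le', div_le_iff₀ n_pos]
    field_simp
    linarith

variable {m b : ℝ}

lemma eventually_le_of_Jn_nonpos (hβp : 0 ≤ β * p) (hm : m ∈ Set.Ioo (-1 : ℝ) b) (hb : b < 0)
    (hJ : J p β h m = 0) (hanti : StrictAntiOn (J p β h) (Set.Ioc (-1) b)) {x : ℝ} (hx : -1 < x)
    (hxm : x < m) :
    ∀ᶠ n in Filter.atTop, ∀ a ∈ magGrid n, Jn p β h n a ≤ 0 → x ≤ a := by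
  obtain ⟨y, hxy, hym⟩ := exists_between hxm
  have J_pos : 0 < J p β h y := by
    rw [← hJ]
    exact hanti ⟨by linarith, by linarith [hm.2]⟩ ⟨hm.1, hm.2.le⟩ hym
  have eventually_div_lt (A : ℝ) {c : ℝ} (hc : 0 < c) : ∀ᶠ n : ℕ in Filter.atTop, A / n < c :=
    (tendsto_const_div_atTop_nhds_zero_nat A).eventually_lt_const hc
  filter_upwards [Filter.eventually_gt_atTop 0, eventually_div_lt 2 (sub_pos.2 hxy),
    eventually_div_lt (4 * (β * p)) J_pos] with n hn mesh_lt error_lt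
  rintro _ ⟨k, _, rfl⟩ Jn_nonpos
  by_contra! lt_x
  have shift := gridPoint_succ_le hn k
  rw [← gridPoint] at lt_x Jn_nonpos
  have gt_neg_one : -1 < gridPoint (n + 2) (k + 1) := by
    rw [gridPoint, lt_add_iff_pos_right]
    positivity
  have J_le := J_sub_le_Jn h hβp hn (two_mul_le_of_gridPoint_neg hn (k := k) (by linarith [hm.2]))
  have J_ge := hanti.antitoneOn ⟨gt_neg_one, by linarith [hm.2]⟩
    ⟨by linarith, by linarith [hm.2]⟩ (by linarith : gridPoint (n + 2) (k + 1) ≤ y)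
  linarith

lemma eventually_exists_Jn_nonpos (hm : m ∈ Set.Ioo (-1 : ℝ) b) (hb : b < 0)
    (hJ : J p β h m = 0) (hanti : StrictAntiOn (J p β h) (Set.Ioc (-1) b)) {x : ℝ}
    (hmx : m < x) :
    ∀ᶠ n in Filter.atTop, ∃ a ∈ magGrid n, Jn p β h n a ≤ 0 ∧ a ≤ x := by
  filter_upwards [Filter.eventually_gt_atTop 0, (tendsto_const_div_atTop_nhds_zero_nat 2
    ).eventually_lt_const (sub_pos.2 (lt_min hmx hm.2))] with n hn mesh_lt
  obtain ⟨k, k_pos, gt_m, le_add⟩ := exists_gridPoint_mem_Ioc hn hm.1.le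
  have lt_min : gridPoint n k < min x b := by linarith
  have two_mul_le := two_mul_le_of_gridPoint_neg hn ((lt_min.trans_le (min_le_right _ _)).trans hb)
  refine ⟨gridPoint n k, ⟨k, by omega, rfl⟩, ?_, (lt_min.trans_le (min_le_left _ _)).le⟩
  refine (Jn_le_J p β h k_pos two_mul_le).trans ?_
  rw [← hJ]
  exact (hanti ⟨hm.1, hm.2.le⟩ ⟨hm.1.trans gt_m, (lt_min.trans_le (min_le_right _ _)).le⟩ gt_m).le

lemma tendsto_mn (hβp : 0 ≤ β * p) (hm : m ∈ Set.Ioo (-1 : ℝ) b) (hb : b < 0)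
    (hJ : J p β h m = 0) (hanti : StrictAntiOn (J p β h) (Set.Ioc (-1) b)) :
    Filter.Tendsto (mn p β h) Filter.atTop (𝓝 m) := by
  refine tendsto_order.2 ⟨fun x hx => ?_, fun x hx => ?_⟩
  · obtain ⟨y, max_lt, hym⟩ := exists_between (max_lt hm.1 hx)
    filter_upwards [eventually_le_of_Jn_nonpos hβp hm hb hJ hanti
      ((le_max_left _ _).trans_lt max_lt) hym,
      eventually_exists_Jn_nonpos hm hb hJ hanti hm.2] with n lower ⟨a, ha, Jn_nonpos, _⟩
    exact ((le_max_right _ _).trans_lt max_lt).trans_le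
      (le_csInf ⟨a, ha, Jn_nonpos⟩ fun a ha => lower a ha.1 ha.2)
  · obtain ⟨y, hmy, hyx⟩ := exists_between hx
    filter_upwards [eventually_exists_Jn_nonpos hm hb hJ hanti hmy] with n ⟨a, ha, Jn_nonpos, a_le⟩
    have bddBelow : BddBelow {a | a ∈ magGrid n ∧ Jn p β h n a ≤ 0} := by
      refine ⟨-1, ?_⟩
      rintro _ ⟨⟨k, _, rfl⟩, _⟩
      exact le_add_of_nonneg_right (by positivity)
    exact ((csInf_le bddBelow ⟨ha, Jn_nonpos⟩).trans a_le).trans_lt hyx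

end FirstZero

/-! ### Stability of the first zero -/

section Stability

open Matrix FiniteMarkov

variable {p β h m b : ℝ}

lemma meanDrift_eq_mul_exp_J_sub_one (p β h : ℝ) {a : ℝ} (ha : a ∈ Set.Ioo (-1 : ℝ) 1) :
    meanDrift p β h a = (1 + a) * (Real.exp (J p β h a) - 1) := by
  have one_sub_pos : 0 < 1 - a := by linarith [ha.2]
  have one_add_pos : 0 < 1 + a := by linarith [ha.1]
  rw [meanDrift, J, Real.exp_add, Real.exp_log (div_pos one_sub_pos one_add_pos)]
  field_simp

lemma meanDrift_eq_zero (hm : m ∈ Set.Ioo (-1 : ℝ) 1) (hJ : J p β h m = 0) :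
    meanDrift p β h m = 0 := by
  rw [meanDrift_eq_mul_exp_J_sub_one p β h hm, hJ, Real.exp_zero, sub_self, mul_zero]

lemma sub_mul_meanDrift_neg (hm : m ∈ Set.Ioc (-1 : ℝ) b) (hb : b < 1) (hJ : J p β h m = 0)
    (hanti : StrictAntiOn (J p β h) (Set.Ioc (-1) b)) {x : ℝ} (hx : x ∈ Set.Ioc (-1 : ℝ) b)
    (hxm : x ≠ m) : (x - m) * meanDrift p β h x < 0 := by
  have one_add_pos : 0 < 1 + x := by linarith [hx.1]
  rw [meanDrift_eq_mul_exp_J_sub_one p β h ⟨hx.1, hx.2.trans_lt hb⟩]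
  rcases hxm.lt_or_gt with lt | gt
  · have J_pos : 0 < J p β h x := hJ ▸ hanti hx hm lt
    exact mul_neg_of_neg_of_pos (by linarith)
      (mul_pos one_add_pos (sub_pos.2 (Real.one_lt_exp_iff.2 J_pos)))
  · have J_neg : J p β h x < 0 := hJ ▸ hanti hm hx gt
    exact mul_neg_of_pos_of_neg (by linarith)
      (mul_neg_of_pos_of_neg one_add_pos (sub_neg.2 (Real.exp_lt_one_iff.2 J_neg)))

lemma field_neg_of_meanDrift_eq_zero (hβ : 0 ≤ β) (hm : m ∈ Set.Ioo (-1 : ℝ) 0)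
    (hD : meanDrift p β h m = 0) : p * m + h < 0 := by
  by_contra! field_nonneg
  have : 1 ≤ Real.exp (2 * β * (p * m + h)) := Real.one_le_exp (by positivity)
  rw [meanDrift] at hD
  nlinarith [hm.2]

lemma discrepancyDrift_zero_neg (hm : m ∈ Set.Ioo (-1 : ℝ) 1) (hD : meanDrift p β h m = 0)
    (hcurv : β * p < 1 / (1 - m ^ 2)) : discrepancyDrift p β h m 0 < 0 := by
  have : 0 < 1 - m ^ 2 := by nlinarith [hm.1, hm.2]
  rw [lt_div_iff₀ this] at hcurv
  have drift_eq : (1 - m) * discrepancyDrift p β h m 0 = 2 * (β * p * (1 - m ^ 2) - 1) := by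
    rw [meanDrift] at hD
    simp only [discrepancyDrift, mul_zero, add_zero, sub_zero]
    linear_combination (2 * β * p * (1 - m) - 1) * hD
  refine neg_of_mul_neg_right (drift_eq.trans_lt ?_) (by linarith [hm.2])
  linarith

lemma exists_pos_discrepancyDrift_neg (hfield : p * m + h < 0)
    (hD : discrepancyDrift p β h m 0 < 0) :
    ∃ ρ > 0, p * m + h + 2 * ρ ≤ 0 ∧ discrepancyDrift p β h m ρ < 0 := by
  have drift_neg : ∀ᶠ ρ in 𝓝[>] (0 : ℝ), discrepancyDrift p β h m ρ < 0 := by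
    have : Continuous (discrepancyDrift p β h m) := by
      unfold discrepancyDrift
      fun_prop
    exact (this.tendsto 0).mono_left nhdsWithin_le_nhds |>.eventually_lt_const hD
  have field_neg : ∀ᶠ ρ in 𝓝[>] (0 : ℝ), p * m + h + 2 * ρ < 0 :=
    (Continuous.tendsto' (by fun_prop) _ _ (by simp)).mono_left nhdsWithin_le_nhds
      |>.eventually_lt_const hfield
  obtain ⟨ρ, ⟨drift_neg, field_neg⟩, ρ_pos⟩ :=
    ((drift_neg.and field_neg).and self_mem_nhdsWithin).exists
  exact ⟨ρ, ρ_pos, field_neg.le, drift_neg⟩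

lemma exists_forall_mul_le_neg {f : ℝ → ℝ} (hf : Continuous f) {r R : ℝ} (hr : 0 < r)
    (hR : 0 < R) (hneg : ∀ x, |x - m| ∈ Set.Icc r R → (x - m) * f x < 0) :
    ∃ c > 0, ∀ e : ℝ, |e| = 1 → ∀ x, e * (x - m) ∈ Set.Icc r R → e * f x ≤ -c := by
  have annulus_compact : IsCompact {x | |x - m| ∈ Set.Icc r R} :=
    (isCompact_closedBall m R).of_isClosed_subset
      (isClosed_Icc.preimage (by fun_prop : Continuous fun x : ℝ => |x - m|)) fun x hx => hx.2
  obtain ⟨c, c_pos, c_le⟩ := annulus_compact.exists_forall_le'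
    (by fun_prop : Continuous fun x => -((x - m) * f x)).continuousOn
    fun x hx => neg_pos.2 (hneg x hx)
  refine ⟨c / R, by positivity, fun e he x hx => ?_⟩
  have abs_eq : |x - m| = e * (x - m) := by
    rw [← abs_of_pos (hr.trans_le hx.1), abs_mul, he, one_mul]
  have e_sq : e * e = 1 := by rw [← abs_mul_abs_self, he, one_mul]
  have product_eq : (x - m) * f x = |x - m| * (e * f x) := by
    rw [abs_eq]
    linear_combination -(x - m) * f x * e_sq
  have c_le := c_le x (by rwa [Set.mem_ofPred_eq, abs_eq])
  rw [product_eq, ← mul_neg] at c_le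
  have factor_pos : 0 < -(e * f x) := pos_of_mul_pos_right (c_pos.trans_le c_le) (abs_nonneg _)
  rw [le_neg, div_le_iff₀' hR]
  exact c_le.trans (mul_le_mul_of_nonneg_right (abs_eq ▸ hx.2) factor_pos.le)

lemma exists_meanDrift_le (hm : m ∈ Set.Ioc (-1 : ℝ) b) (hb : b < 1) (hJ : J p β h m = 0)
    (hanti : StrictAntiOn (J p β h) (Set.Ioc (-1) b)) {r R : ℝ} (hr : 0 < r) (hR : 0 < R)
    (hleft : -1 < m - R) (hright : m + R ≤ b) :
    ∃ c > 0, ∀ e : ℝ, |e| = 1 → ∀ x, e * (x - m) ∈ Set.Icc r R → e * meanDrift p β h x ≤ -c := by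
  have drift_continuous : Continuous (meanDrift p β h) := by
    unfold meanDrift
    fun_prop
  refine exists_forall_mul_le_neg drift_continuous hr hR fun x hx => ?_
  have abs_le := abs_le.1 hx.2
  exact sub_mul_meanDrift_neg hm hb hJ hanti ⟨by linarith [abs_le.1], by linarith [abs_le.2]⟩
    (sub_ne_zero.1 (abs_pos.1 (hr.trans_le hx.1)))

lemma nonempty_wellConstants (hp : p ∈ Set.Icc (0 : ℝ) 1) (hβ : 0 < β)
    (hm : m ∈ Set.Ioo (-1 : ℝ) b) (hb : b < 0) (hJ : J p β h m = 0)
    (hanti : StrictAntiOn (J p β h) (Set.Ioc (-1) b)) (hcurv : β * p < 1 / (1 - m ^ 2)) :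
    Nonempty (WellConstants p β h m) := by
  obtain ⟨neg_one_lt, hmb⟩ := hm
  have m_lt_one : m < 1 := by linarith
  have drift_zero := meanDrift_eq_zero ⟨neg_one_lt, m_lt_one⟩ hJ
  have field_neg := field_neg_of_meanDrift_eq_zero hβ.le ⟨neg_one_lt, hmb.trans hb⟩ drift_zero
  obtain ⟨ρ, ρ_pos, field_add_nonpos, discrepancyDrift_neg⟩ :=
    exists_pos_discrepancyDrift_neg field_neg
      (discrepancyDrift_zero_neg ⟨neg_one_lt, m_lt_one⟩ drift_zero hcurv)
  obtain ⟨ε, ε_pos, ε_lt⟩ :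
      ∃ ε > 0, ε < min (min (1 + m) (b - m)) (min (-(p * m + h)) (ρ / (32 * β))) :=
    exists_between (lt_min (lt_min (by linarith) (by linarith))
      (lt_min (by linarith) (by positivity)))
  simp only [lt_inf_iff, lt_div_iff₀ (by positivity : 0 < 32 * β)] at ε_lt
  obtain ⟨⟨ε_lt_one_add, ε_lt_sub⟩, ε_lt_field, ε_lt_ρ⟩ := ε_lt
  obtain ⟨c, c_pos, drift_le⟩ := exists_meanDrift_le ⟨neg_one_lt, hmb.le⟩ (by linarith) hJ hanti
    (half_pos ε_pos) ε_pos (by linarith) (by linarith)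
  obtain ⟨δ, δ_pos, δ_lt⟩ : ∃ δ > 0, δ < min ρ (min (c / (8 * β)) (ρ / (32 * β))) :=
    exists_between (by positivity)
  simp only [lt_inf_iff, lt_div_iff₀ (by positivity : 0 < 8 * β),
    lt_div_iff₀ (by positivity : 0 < 32 * β)] at δ_lt
  obtain ⟨δ_lt_ρ, δ_lt_c, δ_mul_lt_ρ⟩ := δ_lt
  obtain ⟨lam, lam_pos, lam_lt⟩ : ∃ lam > 0, lam < min (1 / 2) (c / 8) :=
    exists_between (by positivity)
  obtain ⟨lam_lt_half, lam_lt_c⟩ := lt_inf_iff.1 lam_lt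
  obtain ⟨θ, θ_pos, θ_lt⟩ : ∃ θ > 0, θ < min (1 / 2) (min (lam * ε / 4) (ρ / 32)) :=
    exists_between (by positivity)
  simp only [lt_inf_iff] at θ_lt
  obtain ⟨θ_lt_half, θ_lt_lam, θ_lt_ρ⟩ := θ_lt
  exact ⟨
    { δ, ε, lam, θ, ρ, p_mem := hp, β_nonneg := hβ.le
      abs_m_le_one := abs_le.2 ⟨neg_one_lt.le, m_lt_one.le⟩
      meanDrift_eq_zero := drift_zero
      δ_pos, δ_le_ρ := δ_lt_ρ.le, ε_pos
      lam_mem := ⟨lam_pos, lam_lt_half.le⟩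
      θ_mem := ⟨θ_pos, θ_lt_half.le⟩
      field_nonpos := fun x hx => by nlinarith [(abs_le.1 hx).2, hp.1, hp.2]
      drift_le := fun e he x hx => (drift_le e he x hx).trans (by linarith)
      θ_le := by linarith
      error_le := by linarith
      field_add_nonpos, discrepancyDrift_neg }⟩

/-! ### Contraction of the coupling in the metastable well -/

variable {n : ℕ}

lemma mag_eq_volume (hn : 0 < n) (σ : Config n) : mag σ = 2 * volume σ / n - 1 := by
  have spin_eq (v : Fin n) : spin σ v = 2 * (if σ v = 1 then 1 else 0) - 1 := by
    rcases spin_cases σ v with ⟨σ_eq, spin_eq⟩ | ⟨σ_eq, spin_eq⟩ <;>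
      norm_num [σ_eq, spin_eq]
  have sum_eq : ∑ v, spin σ v = 2 * volume σ - n := by
    simp only [spin_eq, Finset.sum_sub_distrib, ← Finset.mul_sum]
    simp [volume]
  rw [mag, sum_eq]
  field_simp

lemma mag_of_mem_metastableSet (hn : 0 < n) {σ : Config n} (hσ : σ ∈ metastableSet p β h n) :
    mag σ = mn p β h n := by
  have volume_eq : (volume σ : ℝ) = n / 2 * (mn p β h n + 1) := hσ
  rw [mag_eq_volume hn, volume_eq]
  field_simp
  ring

lemma eventually_mul_pow_mul_exp_neg_le (A : ℝ) {a : ℝ} (ha : 0 < a) (k : ℕ) :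
    ∀ᶠ n : ℕ in Filter.atTop,
      A * (n : ℝ) ^ k * Real.exp (-(a * n)) ≤ Real.exp (-(n : ℝ) ^ (2 / 3 : ℝ)) / 2 := by
  have pow_mul_exp : Filter.Tendsto (fun x : ℝ => A * (x ^ (k : ℝ) * Real.exp (-(a / 2) * x)))
      Filter.atTop (𝓝 0) := by
    simpa using (tendsto_rpow_mul_exp_neg_mul_atTop_nhds_zero k (a / 2)
      (by positivity)).const_mul A
  have rpow_neg : Filter.Tendsto (fun x : ℝ => x ^ (-(1 / 3) : ℝ)) Filter.atTop (𝓝 0) :=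
    tendsto_rpow_neg_atTop (by norm_num)
  filter_upwards [Filter.eventually_gt_atTop 0,
    tendsto_natCast_atTop_atTop.eventually
      (pow_mul_exp.eventually_le_const (by norm_num : (0 : ℝ) < 1 / 2)),
    tendsto_natCast_atTop_atTop.eventually
      (rpow_neg.eventually_le_const (by positivity : 0 < a / 2))] with n hn pow_le rpow_le
  have n_pos : (0 : ℝ) < n := Nat.cast_pos.2 hn
  have exponent_le : (n : ℝ) ^ (2 / 3 : ℝ) ≤ a / 2 * n := by
    rw [show (2 / 3 : ℝ) = -(1 / 3) + 1 by norm_num, Real.rpow_add_one n_pos.ne']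
    exact mul_le_mul_of_nonneg_right rpow_le n_pos.le
  rw [Real.rpow_natCast] at pow_le
  calc A * (n : ℝ) ^ k * Real.exp (-(a * n))
      = A * ((n : ℝ) ^ k * Real.exp (-(a / 2) * n)) * Real.exp (-(a / 2 * n)) := by
        rw [mul_assoc, mul_assoc A, mul_assoc (_ ^ _), ← Real.exp_add]
        ring_nf
    _ ≤ 1 / 2 * Real.exp (-(n : ℝ) ^ (2 / 3 : ℝ)) := by gcongr
    _ = _ := by ring

namespace WellConstants

lemma exists_eventually_exp_mulVec_discrepancy_le (K : WellConstants p β h m) :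
    ∃ C > 0, ∀ᶠ n : ℕ in Filter.atTop, ∀ G : SimpleGraph (Fin n), Quasirandom G p K.δ →
      ∀ z : Config n × Config n, |mag z.1 - m| ≤ K.ε / 2 → |mag z.2 - m| ≤ K.ε / 2 →
        ∀ t ∈ Set.Icc (0 : ℝ) (2 * n),
          (NormedSpace.exp (t • coupledGen G β h) *ᵥ discrepancy) z ≤
            C * Real.exp (-K.κ * t) * discrepancy z + Real.exp (-(n : ℝ) ^ (2 / 3 : ℝ)) / 2 := by
  have ρ_pos := K.ρ_pos
  have θ_pos := K.θ_mem.1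
  set T := max 0 (-Real.log (K.ρ / 8))
  have exp_T_le : Real.exp (-T) ≤ K.ρ / 8 := by
    rw [← Real.le_log_iff_exp_le (by positivity)]
    linarith [le_max_right 0 (-Real.log (K.ρ / 8))]
  refine ⟨Real.exp ((4 * β + K.κ) * T), Real.exp_pos _, ?_⟩
  filter_upwards [Filter.eventually_gt_atTop 0, eventually_mul_pow_mul_exp_neg_le
    ((4 * β + K.κ) * 680) (by positivity : 0 < K.θ * K.ρ / 4) 7]
    with n hn error_le G hG z h₁ h₂ t ht
  refine (K.exp_mulVec_discrepancy_le hG hn (le_max_left _ _) exp_T_le h₁ h₂ ht).trans ?_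
  rw [show (n : ℝ) * K.θ * K.ρ / 4 = K.θ * K.ρ / 4 * n by ring]
  gcongr

lemma exists_eventually_coupling (K : WellConstants p β h m)
    (hmn : Filter.Tendsto (mn p β h) Filter.atTop (𝓝 m)) :
    ∃ C > 0, ∀ᶠ n : ℕ in Filter.atTop, ∀ G : SimpleGraph (Fin n), Quasirandom G p K.δ →
      ∀ σ ∈ metastableSet p β h n, ∀ σ' ∈ metastableSet p β h n, ∃ c : Coupling G β h σ σ',
        c.probNe (2 * (n : ℝ≥0)) ≤ Real.exp (-(n : ℝ) ^ (2 / 3 : ℝ)) ∧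
        ∀ t : ℝ≥0, t ≤ 2 * (n : ℝ≥0) →
          c.meanDisagreement t ≤
            C * Real.exp (-K.κ * (t : ℝ)) * ((disagreement σ σ').card : ℝ) +
              Real.exp (-(n : ℝ) ^ (2 / 3 : ℝ)) := by
  obtain ⟨C, C_pos, decay⟩ := K.exists_eventually_exp_mulVec_discrepancy_le
  refine ⟨C, C_pos, ?_⟩
  filter_upwards [Filter.eventually_gt_atTop 0, decay,
    hmn.eventually (Metric.closedBall_mem_nhds m (half_pos K.ε_pos)),
    eventually_mul_pow_mul_exp_neg_le C (mul_pos two_pos K.κ_pos) 1]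
    with n hn decay mn_close terminal_le G hG σ hσ σ' hσ'
  have mag_close {η : Config n} (hη : η ∈ metastableSet p β h n) : |mag η - m| ≤ K.ε / 2 := by
    rw [mag_of_mem_metastableSet hn hη]
    exact mn_close
  obtain ⟨c, mean_eq⟩ := exists_coupling G β h σ σ'
  have mean_le (t : ℝ≥0) (ht : t ≤ 2 * (n : ℝ≥0)) : c.meanDisagreement t ≤
      C * Real.exp (-K.κ * t) * discrepancy (σ, σ') + Real.exp (-(n : ℝ) ^ (2 / 3 : ℝ)) / 2 :=
    mean_eq t ▸ decay G hG (σ, σ') (mag_close hσ) (mag_close hσ') t ⟨t.2, by exact_mod_cast ht⟩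
  refine ⟨c, ?_, fun t ht => (mean_le t ht).trans ?_⟩
  · refine ((probNe_le_meanDisagreement c _).trans (mean_le _ le_rfl)).trans ?_
    have : C * Real.exp (-K.κ * (2 * (n : ℝ≥0) : ℝ≥0)) * discrepancy (σ, σ') ≤
        Real.exp (-(n : ℝ) ^ (2 / 3 : ℝ)) / 2 := by
      refine le_trans ?_ terminal_le
      rw [pow_one, mul_right_comm, show -K.κ * ((2 * (n : ℝ≥0) : ℝ≥0) : ℝ) = -(2 * K.κ * n) by
        push_cast; ring]
      gcongr
      exact discrepancy_le _
    linarith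
  · exact add_le_add_right (half_le_self (Real.exp_pos _).le) _

end WellConstants

end Stability

end ERGlauber

end

theorem mainTheorem5 (p β h : ℝ) (hp : p ∈ Set.Ioo (0 : ℝ) 1)
    (hmeta : ERGlauber.Metastable p β h) :
    ∃ m : ℝ, m ∈ Set.Ioo (-1 : ℝ) 0 ∧ ERGlauber.J p β h m = 0 ∧
      (∀ a ∈ Set.Ioo (-1 : ℝ) m, 0 < ERGlauber.J p β h a) ∧
      Filter.Tendsto (ERGlauber.mn p β h) Filter.atTop (nhds m) ∧
      β * p < 1 / (1 - m ^ 2) ∧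
      ∃ κ C : ℝ, 0 < κ ∧ 0 < C ∧
        Filter.Tendsto
          (fun n : ℕ =>
            SimpleGraph.binomialRandom (Fin n) ⟨p, hp.1.le, hp.2.le⟩
              {G | ∀ σ ∈ ERGlauber.metastableSet p β h n,
                ∀ σ' ∈ ERGlauber.metastableSet p β h n,
                  ∃ c : ERGlauber.Coupling G β h σ σ',
                    c.probNe (2 * (n : NNReal)) ≤ Real.exp (-(n : ℝ) ^ (2 / 3 : ℝ)) ∧
                    ∀ t : NNReal, t ≤ 2 * (n : NNReal) →
                      c.meanDisagreement t ≤
                        C * Real.exp (-κ * (t : ℝ)) *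
                            ((ERGlauber.disagreement σ σ').card : ℝ) +
                          Real.exp (-(n : ℝ) ^ (2 / 3 : ℝ))})
          Filter.atTop (nhds 1) := by
  have hl : 1 < β * p := hmeta.one_lt_mul hp.1
  have β_pos : 0 < β := pos_of_mul_pos_left (one_pos.trans hl) hp.1.le
  have neg_spinodal : -ERGlauber.spinodal (β * p) < 0 :=
    neg_neg_of_pos (ERGlauber.spinodal_mem_Ioo hl).1
  obtain ⟨m, hm, J_eq_zero⟩ := hmeta.exists_J_eq_zero hp.1
  have J_anti := ERGlauber.strictAntiOn_J (h := h) hl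
  have curvature := ERGlauber.lt_one_div_of_lt_neg_spinodal hl hm
  have mn_tendsto := ERGlauber.tendsto_mn (by linarith) hm neg_spinodal J_eq_zero J_anti
  obtain ⟨K⟩ := ERGlauber.nonempty_wellConstants ⟨hp.1.le, hp.2.le⟩ β_pos hm neg_spinodal
    J_eq_zero J_anti curvature
  obtain ⟨C, C_pos, coupling⟩ := K.exists_eventually_coupling mn_tendsto
  exact ⟨m, ⟨hm.1, hm.2.trans neg_spinodal⟩, J_eq_zero,
    fun a ha => J_eq_zero ▸ J_anti ⟨ha.1, (ha.2.trans hm.2).le⟩ ⟨hm.1, hm.2.le⟩ ha.2,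
    mn_tendsto, curvature, K.κ, C, K.κ_pos, C_pos,
    ERGlauber.tendsto_binomialRandom_of_quasirandom _ K.δ_pos coupling⟩
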